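/- Let $g\ge 1$, let $\Sigma$ be a closed orientable surface of genus $g$, and let $S^1\to M\to\Sigma$ be a circle bundle (a locally trivial bundle with fiber the circle) with trivial monodromy, i.e. such that transport of the fiber along any loop in $\Sigma$ is homotopic to the identity of the fiber. Suppose that its Euler class $e\in H^2(\Sigma,\mathbb{Z})$ (with respect to some orientation of the fibers) is nonzero. Then, for every base point, $G=\pi_1(M)$ is residually torsion-free nilpotent: for every $1\ne x\in G$ there is a normal subgroup $N$ of $G$ with $x\notin N$ such that $G/N$ is nilpotent and torsion-free. Moreover, for every prime $p$ the group $G$ is residually $p$: for every $1\ne x\in G$ there is a normal subgroup $N$ of $G$ with $x\notin N$ such that $G/N$ is a finite $p$-group. -/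

import Mathlib

noncomputable section

/-! ### Residual properties of groups -/

/-- `G` is residually torsion-free nilpotent: every nontrivial element survives in a quotient of `G`
that is nilpotent and has no nontrivial element of finite order. -/
def IsResiduallyTorsionFreeNilpotent (G : Type*) [Group G] : Prop :=
  ∀ x : G, x ≠ 1 → ∃ (N : Subgroup G) (_ : N.Normal), x ∉ N ∧ Group.IsNilpotent (G ⧸ N) ∧
    ∀ y : G ⧸ N, IsOfFinOrder y → y = 1

/-- `G` is residually `p`: every nontrivial element survives in a quotient of `G` that is a
finite `p`-group. -/
def IsResiduallyP (p : ℕ) (G : Type*) [Group G] : Prop :=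
  ∀ x : G, x ≠ 1 → ∃ (N : Subgroup G) (_ : N.Normal), x ∉ N ∧ Finite (G ⧸ N) ∧ IsPGroup p (G ⧸ N)

/-! ### Closed orientable surfaces -/

/-- The closed unit disk in `ℂ`, regarded as a polygon whose `4 * g` sides are arcs of the unit
circle. -/
abbrev PolygonDisk : Type := Metric.closedBall (0 : ℂ) 1

/-- The point with parameter `s ∈ [0, 1]` on the `j`-th side (`0 ≤ j < 4 * g`), the sides being
parametrized counterclockwise. -/
def polygonSide (g j : ℕ) (s : ℝ) : ℂ :=
  Complex.exp (((2 * Real.pi * ((j + s) / (4 * g)) : ℝ) : ℂ) * Complex.I)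

/-- The side identifications that belong to the boundary word
`a₀ b₀ a₀⁻¹ b₀⁻¹ ⋯ a_{g-1} b_{g-1} a_{g-1}⁻¹ b_{g-1}⁻¹`: for `k < g`, the side `4 k` is glued to the
side `4 k + 2`, and the side `4 k + 1` to the side `4 k + 3`, with reversed parameter. -/
def PolygonGlue (g : ℕ) (x y : PolygonDisk) : Prop :=
  ∃ k < g, ∃ s ∈ Set.Icc (0 : ℝ) 1,
    ((x : ℂ) = polygonSide g (4 * k) s ∧ (y : ℂ) = polygonSide g (4 * k + 2) (1 - s)) ∨
    ((x : ℂ) = polygonSide g (4 * k + 1) s ∧ (y : ℂ) = polygonSide g (4 * k + 3) (1 - s))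

/-- The standard closed orientable surface of genus `g ≥ 1`: the quotient of the `4 * g`-gon by the
equivalence relation generated by its side identifications, with the quotient topology. -/
def GenusSurface (g : ℕ) : Type := Quot (PolygonGlue g)

instance (g : ℕ) : TopologicalSpace (GenusSurface g) :=
  inferInstanceAs (TopologicalSpace (Quot (PolygonGlue g)))

/-- `S` is a closed orientable surface of genus `g` (used for `g ≥ 1`). -/
def IsClosedOrientableSurface (g : ℕ) (S : Type*) [TopologicalSpace S] : Prop :=
  Nonempty (S ≃ₜ GenusSurface g)

/-! ### Circle bundles and their monodromy -/

/-- `π : M → B` is a circle bundle: it is locally trivial with fibre the circle. -/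
def IsCircleBundle {M B : Type*} [TopologicalSpace M] [TopologicalSpace B] (π : M → B) : Prop :=
  ∀ b : B, ∃ e : Bundle.Trivialization Circle π, b ∈ e.baseSet

/-- The bundle has trivial monodromy: for every loop `γ` in the base, transporting the fibre along
`γ` (the family of maps `H (t, ·)` from the fibre over `γ 0` to the fibre over `γ t`, starting at
the identity) gives a self-map `φ` of the fibre that is homotopic to the identity. The homotopy
class of `φ` does not depend on the choice of the transport `H`, and a homeomorphism of the circle
is isotopic to the identity if and only if it is homotopic to the identity. -/
def HasTrivialMonodromy {M B : Type*} [TopologicalSpace M] [TopologicalSpace B]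
    (π : M → B) : Prop :=
  ∀ (b : B) (γ : Path b b),
    ∃ (H : C(unitInterval × (π ⁻¹' {b}), M)) (φ : C(π ⁻¹' {b}, π ⁻¹' {b})),
      (∀ t y, π (H (t, y)) = γ t) ∧
      (∀ y, H (0, y) = y) ∧
      (∀ y, H (1, y) = φ y) ∧
      φ.Homotopic (ContinuousMap.id _)

/-! ### Singular cohomology with integer coefficients -/

/-- Singular `n`-simplices of `X`. -/
abbrev SingularSimplex (X : Type*) [TopologicalSpace X] (n : ℕ) :=
  C(stdSimplex ℝ (Fin (n + 1)), X)

/-- The `i`-th face of a singular simplex. -/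
def SingularSimplex.face {X : Type*} [TopologicalSpace X] {n : ℕ}
    (σ : SingularSimplex X (n + 1)) (i : Fin (n + 2)) : SingularSimplex X n :=
  σ.comp ⟨stdSimplex.map i.succAbove, stdSimplex.continuous_map _⟩

/-- Singular `n`-cochains of `X` with coefficients in `ℤ`. -/
abbrev SingularCochain (X : Type*) [TopologicalSpace X] (n : ℕ) := SingularSimplex X n → ℤ

/-- The coboundary `(δ c) σ = ∑ i, (-1) ^ i * c (∂ᵢ σ)`. -/
def coboundary (X : Type*) [TopologicalSpace X] (n : ℕ) :
    SingularCochain X n →+ SingularCochain X (n + 1) where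
  toFun c σ := ∑ i : Fin (n + 2), (-1) ^ (i : ℕ) * c (σ.face i)
  map_zero' := by ext σ; simp
  map_add' c d := by ext σ; simp [mul_add, Finset.sum_add_distrib]

/-- Singular `2`-cocycles. -/
abbrev TwoCocycle (X : Type*) [TopologicalSpace X] : AddSubgroup (SingularCochain X 2) :=
  (coboundary X 2).ker

/-- The second singular cohomology group `H²(X; ℤ)`. -/
abbrev H2 (X : Type*) [TopologicalSpace X] : Type _ :=
  TwoCocycle X ⧸ ((coboundary X 1).range.addSubgroupOf (TwoCocycle X))

/-! ### The Euler class -/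

/-- The loop that runs once around the fibre over `b`, in the parametrization `φ` of this fibre, as
a singular `1`-simplex of the total space. -/
def fibreLoop {M B : Type*} [TopologicalSpace M] [TopologicalSpace B] (π : M → B) {b : B}
    (φ : Circle ≃ₜ (π ⁻¹' {b})) : SingularSimplex M 1 where
  toFun v := (φ (Circle.exp (2 * Real.pi * v.1 1)) : M)
  continuous_toFun := by
    have h : Continuous fun v : stdSimplex ℝ (Fin 2) => v.1 1 :=
      (continuous_apply 1).comp continuous_subtype_val
    exact continuous_subtype_val.comp
      (φ.continuous.comp (Circle.exp.continuous.comp (continuous_const.mul h)))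

/-- `e ∈ H²(B; ℤ)` is the Euler class of the circle bundle `π : M → B`, for some orientation of the
fibres (changing the orientation replaces `e` by `-e`). The Euler class is the transgression of the
generator of the first cohomology of the fibre: there are a `2`-cocycle `z` of `B` representing `e`
and vanishing on constant simplices, and a `1`-cochain `c` of `M` with `δ c = π^* z`, such that the
restriction of `c` to each fibre (which is a cocycle) represents a generator of the first cohomology
of that fibre, that is, takes the value `1` or `-1` on a loop running once around the fibre. -/
def IsEulerClass {M B : Type*} [TopologicalSpace M] [TopologicalSpace B] (π : C(M, B))
    (e : H2 B) : Prop :=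
  ∃ (z : TwoCocycle B) (c : SingularCochain M 1),
    QuotientAddGroup.mk z = e ∧
    (∀ b : B, z.1 (ContinuousMap.const _ b) = 0) ∧
    (∀ τ : SingularSimplex M 2, coboundary M 1 c τ = z.1 (π.comp τ)) ∧
    ∀ (b : B) (φ : Circle ≃ₜ (π ⁻¹' {b})), c (fibreLoop π φ) = 1 ∨ c (fibreLoop π φ) = -1

end

/-! An element of `π₁(M)` with nontrivial image in `π₁(Σ)` is handled by the surface group, since
both residual properties pull back, element by element, along a homomorphism
(`exists_of_map_ne_one`). An element of the kernel is the class of a loop `γ` in a fibre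
(`exists_fibre_loop`), and if it is not `1` then `c γ ≠ 0`, where `c` is the cochain with `δ c = π^*
z` that restricts to a generator on the fibres (`homotopic_refl_of_cochain_eq_zero`). Such elements
are detected by a homomorphism to the integral Heisenberg group that sends `γ` to a central element
with coordinate `-c γ` (`exists_pathFunctor_heisenberg`).

Homomorphisms are built as functors on paths. On the polygon `z` becomes a coboundary `δ d`, so on
the fibre product of the polygon with `M` the difference `c - d` is a cocycle and gives a functor to
the centre. It descends to `M` after multiplication by a potential on the polygon with suitable
jumps across the glued sides (`exists_pathFunctor_of_coneNbhd`, `exists_potential`). Such a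
potential closes up around the boundary exactly when a product of commutators cancels an integer
defect of `d`, which plays the role of the Euler number; in the Heisenberg group every central
element is a commutator, so this can be arranged. With `d = 0` the same gluing gives the universal
property of the standard presentation of `π₁(Σ)` (`exists_presentation`).

For the surface group, the first generator `P 0` acts on functions `ℤ → ℤⁿ` by the shift, and the
other generators by unitriangular matrices depending polynomially on the argument. The single
relation becomes a recursion for the matrices of `Q 0`, which has a polynomial solution with any
initial value (`exists_unipotent_representation`). Every element is a reduced word in `(Q 0)⁻¹` and
the conjugates of the other generators by powers of `P 0`, times a power of `P 0`
(`exists_surface_normalForm`). A nonzero power is seen by the shift on polynomials; a nonempty word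
is seen at the argument `0` by superdiagonal matrices that read off its letters one after the other
(`word_mulVec_ne`).

In both cases the group acts unipotently on a lattice of finite rank. Its image is then torsion-free
nilpotent, and the action modulo powers of `p` gives finite `p`-quotients
(`DescendingFlag.residual`). -/

open Set Filter Topology unitInterval

/-! ### Functors from the fundamental groupoid to a group -/

/-- A functor from the fundamental groupoid of `X` to the group `K`. -/
structure PathFunctor (X : Type*) [TopologicalSpace X] (K : Type*) [Group K] where
  /-- The value on a homotopy class of paths. -/
  val : ∀ {x y : X}, Path.Homotopic.Quotient x y → K
  map_trans : ∀ {x y z : X} (p : Path.Homotopic.Quotient x y) (q : Path.Homotopic.Quotient y z),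
    val (p.trans q) = val p * val q

namespace PathFunctor

variable {X Y K : Type*} [TopologicalSpace X] [TopologicalSpace Y] [Group K]

theorem map_refl (F : PathFunctor X K) (x : X) : F.val (.refl x) = 1 := by
  have h := F.map_trans (.refl x) (.refl x)
  rw [Path.Homotopic.Quotient.refl_trans] at h
  exact (mul_eq_left.mp h.symm)

theorem map_symm (F : PathFunctor X K) {x y : X} (p : Path.Homotopic.Quotient x y) :
    F.val p.symm = (F.val p)⁻¹ := by
  rw [eq_inv_iff_mul_eq_one, ← F.map_trans, Path.Homotopic.Quotient.symm_trans, F.map_refl]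

/-- The homomorphism on the fundamental group; since composition in the fundamental group is in
the order opposite to concatenation, it is given by the values on the reversed loops. -/
def hom (F : PathFunctor X K) (x : X) : FundamentalGroup X x →* K where
  toFun p := (F.val p)⁻¹
  map_one' := by rw [FundamentalGroup.one_def, F.map_refl, inv_one]
  map_mul' p q := by rw [FundamentalGroup.mul_def, F.map_trans, mul_inv_rev]

/-- The functor that is trivial on all paths. -/
def trivial (X K : Type*) [TopologicalSpace X] [Group K] : PathFunctor X K where
  val _ := 1
  map_trans _ _ := (mul_one 1).symm

end PathFunctor

/-- A property of homotopy classes of paths that is stable under concatenation and holds for all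
paths inside the members of a neighbourhood cover holds for all paths. -/
theorem path_induction {X : Type*} [TopologicalSpace X]
    (P : ∀ ⦃x y : X⦄, Path.Homotopic.Quotient x y → Prop)
    (trans : ∀ ⦃x y z : X⦄ (p : Path.Homotopic.Quotient x y) (q : Path.Homotopic.Quotient y z),
      P p → P q → P (p.trans q))
    (small : ∀ b : X, ∃ W ∈ 𝓝 b, ∀ ⦃x y : X⦄ (γ : Path x y), range γ ⊆ W →
      P (Path.Homotopic.Quotient.mk γ))
    {x y : X} (p : Path.Homotopic.Quotient x y) : P p := by
  induction p using Path.Homotopic.Quotient.ind with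
  | mk γ =>
  choose W hW hP using small
  obtain ⟨t, ht0, htm, ⟨n, hn⟩, hc⟩ := exists_monotone_Icc_subset_open_cover_unitInterval
    (c := fun b : X => γ ⁻¹' interior (W b)) (fun b => isOpen_interior.preimage γ.continuous)
    (fun s _ => mem_iUnion.2 ⟨γ s, mem_interior_iff_mem_nhds.2 (hW _)⟩)
  have key : ∀ n, P (Path.Homotopic.Quotient.mk (γ.subpath (t 0) (t n))) := by
    intro n
    induction n with
    | zero =>
      rw [Path.subpath_self]
      refine hP (γ (t 0)) _ ?_
      rw [Path.refl_range, singleton_subset_iff]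
      exact mem_of_mem_nhds (hW _)
    | succ n ih =>
      obtain ⟨b, hb⟩ := hc n
      have h2 : P (Path.Homotopic.Quotient.mk (γ.subpath (t n) (t (n + 1)))) := by
        refine hP b _ ?_
        rw [Path.range_subpath_of_le _ _ _ (htm n.le_succ)]
        rintro _ ⟨s, hs, rfl⟩
        exact interior_subset (hb hs)
      have h3 := trans _ _ ih h2
      rw [← Path.Homotopic.Quotient.mk_trans] at h3
      rwa [Path.Homotopic.Quotient.eq.2 ⟨Path.Homotopy.subpathTransSubpath γ _ _ _⟩] at h3
  have h := key n
  rw [ht0, hn n le_rfl, Path.subpath_zero_one] at h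
  have cast : ∀ {x' y' : X} (hx : x' = x) (hy : y' = y),
      P (Path.Homotopic.Quotient.mk (γ.cast hx hy)) → P (Path.Homotopic.Quotient.mk γ) := by
    rintro _ _ rfl rfl h
    exact h
  exact cast _ _ h

/-! ### The covering space of a germ of parallel transport -/

/-- A germ of parallel transport: an element of `K` for each pair of nearby points, flat. -/
def IsTransportGerm {X K : Type*} [TopologicalSpace X] [Group K] (τ : X → X → K) : Prop :=
  ∀ b, ∀ᶠ x in 𝓝 b, ∀ᶠ y in 𝓝 x, τ b x * τ x y = τ b y

namespace IsTransportGerm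

variable {X K : Type*} [TopologicalSpace X] [Group K] {τ : X → X → K}

/-- The total space of the covering associated with a germ of parallel transport. -/
@[ext] structure Total (hτ : IsTransportGerm τ) where
  /-- The base point. -/
  pt : X
  /-- The coordinate in the group. -/
  val : K

/-- The fibre direction is discrete: over `flatSet b` the topology is generated by pieces of the
sections `x ↦ (x, k * τ b x)`, which are open by flatness. -/
instance (hτ : IsTransportGerm τ) : TopologicalSpace hτ.Total where
  IsOpen W := ∀ e ∈ W, ∀ᶠ x in 𝓝 e.pt, ⟨x, e.val * τ e.pt x⟩ ∈ W
  isOpen_univ := fun _ _ => Eventually.of_forall fun _ => mem_univ _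
  isOpen_inter := fun _ _ hs ht e he => (hs e he.1).and (ht e he.2)
  isOpen_sUnion := fun _ hS e ⟨s, hs, he⟩ => (hS s hs e he).mono fun _ hx => ⟨s, hs, hx⟩

theorem isOpen_iff (hτ : IsTransportGerm τ) {W : Set hτ.Total} :
    IsOpen W ↔ ∀ e ∈ W, ∀ᶠ x in 𝓝 e.pt, ⟨x, e.val * τ e.pt x⟩ ∈ W := Iff.rfl

theorem continuous_pt (hτ : IsTransportGerm τ) : Continuous (Total.pt : hτ.Total → X) :=
  ⟨fun _ hs => hτ.isOpen_iff.2 fun _ he => hs.mem_nhds he⟩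

/-- The largest open set on which the transport from `b` is flat. -/
def flatSet (_ : IsTransportGerm τ) (b : X) : Set X :=
  interior {x | ∀ᶠ y in 𝓝 x, τ b x * τ x y = τ b y}

theorem flatSet_mem (hτ : IsTransportGerm τ) (b : X) : hτ.flatSet b ∈ 𝓝 b :=
  interior_mem_nhds.2 (hτ b)

theorem flat (hτ : IsTransportGerm τ) {b x : X} (hx : x ∈ hτ.flatSet b) :
    ∀ᶠ y in 𝓝 x, τ b x * τ x y = τ b y :=
  interior_subset (s := {x | ∀ᶠ y in 𝓝 x, τ b x * τ x y = τ b y}) hx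

/-- The trivialization of the covering over `flatSet b`. -/
def triv [TopologicalSpace K] [DiscreteTopology K] (hτ : IsTransportGerm τ) (b : X) :
    Bundle.Trivialization K (Total.pt : hτ.Total → X) where
  toFun e := (e.pt, e.val * (τ b e.pt)⁻¹)
  invFun z := ⟨z.1, z.2 * τ b z.1⟩
  source := Total.pt ⁻¹' hτ.flatSet b
  target := hτ.flatSet b ×ˢ univ
  map_source' e he := ⟨he, mem_univ _⟩
  map_target' z hz := hz.1
  left_inv' e he := Total.ext rfl (inv_mul_cancel_right _ _)
  right_inv' z hz := Prod.ext rfl (mul_inv_cancel_right _ _)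
  open_source := isOpen_interior.preimage hτ.continuous_pt
  open_target := isOpen_interior.prod isOpen_univ
  continuousOn_toFun := by
    intro e he
    refine ContinuousAt.continuousWithinAt ?_
    refine hτ.continuous_pt.continuousAt.prodMk ?_
    rw [ContinuousAt, nhds_discrete K, tendsto_pure]
    -- By flatness the group coordinate is constant along the sections, so its level sets are open.
    have h1 : {e' : hτ.Total | e'.pt ∈ hτ.flatSet b ∧
        e'.val * (τ b e'.pt)⁻¹ = e.val * (τ b e.pt)⁻¹} ∈ 𝓝 e := by
      refine IsOpen.mem_nhds (hτ.isOpen_iff.2 ?_) ⟨he, rfl⟩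
      rintro e' ⟨h1, h2⟩
      filter_upwards [isOpen_interior.mem_nhds h1, hτ.flat h1] with x hx hx'
      refine ⟨hx, ?_⟩
      rw [← h2, ← hx']
      simp [mul_assoc]
    exact mem_of_superset h1 fun e' h => h.2
  continuousOn_invFun := by
    rintro ⟨x, k⟩ ⟨hx, -⟩
    refine ContinuousAt.continuousWithinAt fun s hs => ?_
    rw [nhds_prod_eq, nhds_discrete K]
    obtain ⟨W, hW, hWo, hxW⟩ := mem_nhds_iff.1 hs
    have h := hτ.isOpen_iff.1 hWo _ hxW
    rw [mem_map, prod_pure, mem_map]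
    filter_upwards [h, hτ.flat hx] with y hy hy'
    refine hW ?_
    simpa [mul_assoc, hy'] using hy
  baseSet := hτ.flatSet b
  open_baseSet := isOpen_interior
  source_eq := rfl
  target_eq := rfl
  proj_toFun e he := rfl

theorem isCoveringMap (hτ : IsTransportGerm τ) :
    IsCoveringMap (Total.pt : hτ.Total → X) := by
  let : TopologicalSpace K := ⊥
  have : DiscreteTopology K := ⟨rfl⟩
  exact IsCoveringMap.mk _ (fun _ => K) (fun b => hτ.triv b)
    fun b => mem_of_mem_nhds (hτ.flatSet_mem b)

theorem continuous_translate (hτ : IsTransportGerm τ) (k : K) :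
    Continuous (fun e : hτ.Total => (⟨e.pt, k * e.val⟩ : hτ.Total)) :=
  ⟨fun _ hs => hτ.isOpen_iff.2 fun _ he => by simpa [mul_assoc] using hs _ he⟩

/-- Transport multiplies on the right, so left translations are deck transformations, and lifts are
unique. This is what makes the monodromy multiplicative. -/
theorem liftPath_translate (hτ : IsTransportGerm τ) {x y : X} (γ : Path x y) (k : K)
    (e e' : hτ.Total) (he : γ.toContinuousMap 0 = e.pt) (he' : γ.toContinuousMap 0 = e'.pt)
    (hk : e'.val = k * e.val) (t : I) :
    (hτ.isCoveringMap.liftPath γ e' he' t).val =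
      k * (hτ.isCoveringMap.liftPath γ e he t).val := by
  have h := (hτ.isCoveringMap.eq_liftPath_iff he'
    (Γ := fun t => ⟨(hτ.isCoveringMap.liftPath γ e he t).pt,
      k * (hτ.isCoveringMap.liftPath γ e he t).val⟩)).2 ⟨?_, ?_, ?_⟩
  · exact (congrArg Total.val (congrFun h t)).symm
  · exact (hτ.continuous_translate k).comp (ContinuousMap.continuous _)
  · exact hτ.isCoveringMap.liftPath_lifts γ e he
  · rw [hτ.isCoveringMap.liftPath_zero]
    exact Total.ext (he.symm.trans he') hk.symm

/-- Parallel transport along paths, from a germ of parallel transport. -/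
theorem exists_pathFunctor (hτ : IsTransportGerm τ) : ∃ F : PathFunctor X K,
    ∀ b, ∃ W ∈ 𝓝 b, ∀ ⦃x y : X⦄ (γ : Path x y), range γ ⊆ W →
      F.val (Path.Homotopic.Quotient.mk γ) = (τ b x)⁻¹ * τ b y := by
  have cov := hτ.isCoveringMap
  let base (x : X) : (Total.pt : hτ.Total → X) ⁻¹' {x} := ⟨⟨x, 1⟩, rfl⟩
  refine ⟨⟨fun {x y} p => (cov.monodromy p (base x)).1.val, ?_⟩, ?_⟩
  · intro x y z p q
    rw [cov.monodromy_trans_apply]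
    generalize cov.monodromy p (base x) = e
    induction q using Path.Homotopic.Quotient.ind with
    | mk γ => exact hτ.liftPath_translate γ e.1.val _ _ _ _ (mul_one _).symm 1
  · intro b
    refine ⟨_, hτ.flatSet_mem b, fun x y γ hγ => ?_⟩
    have hx : γ.toContinuousMap 0 = (base x).1.pt := γ.source
    -- Inside `flatSet b` the lift is explicit: it follows the flat section of `τ b` through `(x,
    -- 1)`.
    have h := (cov.eq_liftPath_iff hx
      (Γ := fun t => ⟨γ t, (τ b x)⁻¹ * τ b (γ t)⟩)).2 ⟨?_, ?_, ?_⟩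
    · refine (congrArg Total.val (congrFun h 1)).symm.trans ?_
      simp
    · refine ⟨fun s hs => isOpen_iff_mem_nhds.2 fun t ht => ?_⟩
      have h1 := hτ.isOpen_iff.1 hs _ ht
      have h2 := γ.continuous.continuousAt.eventually (h1.and (hτ.flat (hγ ⟨t, rfl⟩)))
      filter_upwards [h2] with t' ht'
      have := ht'.1
      rwa [mul_assoc, ht'.2] at this
    · rfl
    · exact Total.ext γ.source (by simp [base])

end IsTransportGerm

/-! ### Squares of paths -/

theorem Path.Homotopic.of_simplyConnected_map {A X : Type*} [TopologicalSpace A]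
    [TopologicalSpace X] [SimplyConnectedSpace A] (f : C(A, X)) {a b : A} (γ γ' : Path a b) :
    (Path.Homotopic.Quotient.mk (γ.map f.continuous)) =
      Path.Homotopic.Quotient.mk (γ'.map f.continuous) :=
  Path.Homotopic.Quotient.eq.2 ((SimplyConnectedSpace.paths_homotopic γ γ').map f)

instance : SimplyConnectedSpace (I × I) := by
  have : ContractibleSpace I := (convex_Icc (0 : ℝ) 1).contractibleSpace ⟨0, by simp⟩
  infer_instance

namespace PathFunctor

variable {X Y K : Type*} [TopologicalSpace X] [TopologicalSpace Y] [Group K]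

/-- The value of a functor on a path. -/
def path (F : PathFunctor X K) {x y : X} (γ : Path x y) : K :=
  F.val (Path.Homotopic.Quotient.mk γ)

theorem path_eq_of_coe (F : PathFunctor X K) {x y x' y' : X} {γ : Path x y} {γ' : Path x' y'}
    (h : ∀ t, γ t = γ' t) : F.path γ = F.path γ' := by
  have hx : x = x' := by rw [← γ.source, h, γ'.source]
  have hy : y = y' := by rw [← γ.target, h, γ'.target]
  subst hx hy
  rw [show γ = γ' from Path.ext (funext h)]

theorem path_const (F : PathFunctor X K) {x y : X} {γ : Path x y} (h : ∀ t, γ t = x) :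
    F.path γ = 1 :=
  (F.path_eq_of_coe (γ' := Path.refl x) h).trans (F.map_refl x)

theorem path_trans (F : PathFunctor X K) {x y z : X} (γ : Path x y) (γ' : Path y z) :
    F.path (γ.trans γ') = F.path γ * F.path γ' := by
  rw [path, Path.Homotopic.Quotient.mk_trans, F.map_trans]; rfl

theorem path_symm (F : PathFunctor X K) {x y : X} (γ : Path x y) :
    F.path γ.symm = (F.path γ)⁻¹ := by
  rw [path, Path.Homotopic.Quotient.mk_symm, F.map_symm]; rfl

/-- The two ways around a square have the same value. -/
theorem square (F : PathFunctor X K) (f : C(I × I, X)) {a b c d : X}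
    (bot : Path a b) (right : Path b d) (left : Path a c) (top : Path c d)
    (hbot : ∀ t, bot t = f (t, 0)) (hright : ∀ t, right t = f (1, t))
    (hleft : ∀ t, left t = f (0, t)) (htop : ∀ t, top t = f (t, 1)) :
    F.path bot * F.path right = F.path left * F.path top := by
  let b' : Path ((0, 0) : I × I) (1, 0) := ⟨⟨fun t => (t, 0), by fun_prop⟩, rfl, rfl⟩
  let r' : Path ((1, 0) : I × I) (1, 1) := ⟨⟨fun t => (1, t), by fun_prop⟩, rfl, rfl⟩
  let l' : Path ((0, 0) : I × I) (0, 1) := ⟨⟨fun t => (0, t), by fun_prop⟩, rfl, rfl⟩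
  let t' : Path ((0, 1) : I × I) (1, 1) := ⟨⟨fun t => (t, 1), by fun_prop⟩, rfl, rfl⟩
  have h := Path.Homotopic.of_simplyConnected_map f (b'.trans r') (l'.trans t')
  rw [Path.map_trans, Path.map_trans] at h
  have h2 := congrArg F.val h
  rw [← path, ← path, F.path_trans, F.path_trans] at h2
  rw [F.path_eq_of_coe (γ' := b'.map f.continuous) hbot,
    F.path_eq_of_coe (γ' := r'.map f.continuous) hright,
    F.path_eq_of_coe (γ' := l'.map f.continuous) hleft,
    F.path_eq_of_coe (γ' := t'.map f.continuous) htop, h2]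

end PathFunctor

/-! ### Descent of functors along maps with conical neighbourhoods -/

/-- A neighbourhood of `b` that contracts to `b`, the contraction being covered by a contraction of
its preimage under `q` to the fibre over `b`. -/
structure ConeNbhd {Y X : Type*} [TopologicalSpace Y] [TopologicalSpace X] (q : Y → X) (b : X) where
  /-- The neighbourhood. -/
  O : Set X
  isOpen : IsOpen O
  mem : b ∈ O
  /-- The contraction upstairs. -/
  H : Y → I → Y
  /-- The contraction downstairs. -/
  h : X → I → X
  contH : ContinuousOn (Function.uncurry H) ((q ⁻¹' O) ×ˢ univ)
  conth : ContinuousOn (Function.uncurry h) (O ×ˢ univ)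
  H_one : ∀ y, q y ∈ O → H y 1 = y
  H_zero : ∀ y, q y ∈ O → q (H y 0) = b
  H_self : ∀ y, q y = b → ∀ s, H y s = y
  q_H : ∀ y, q y ∈ O → ∀ s, q (H y s) = h (q y) s

namespace ConeNbhd

variable {Y X K : Type*} [TopologicalSpace Y] [TopologicalSpace X] [Group K] {q : Y → X} {b : X}

/-- The track of a point under the contraction. -/
def track (N : ConeNbhd q b) (y : Y) (hy : q y ∈ N.O) : Path (N.H y 0) y where
  toFun s := N.H y s
  continuous_toFun := N.contH.comp_continuous (f := fun s => (y, s)) (by fun_prop)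
    fun s => ⟨hy, mem_univ _⟩
  source' := rfl
  target' := N.H_one y hy

@[simp] theorem track_apply (N : ConeNbhd q b) (y : Y) (hy : q y ∈ N.O) (s : I) :
    N.track y hy s = N.H y s := rfl

/-- The contraction applied to a path upstairs, as a square. -/
def cone (N : ConeNbhd q b) {y y' : Y} (γ : Path y y') (hγ : ∀ t, q (γ t) ∈ N.O) : C(I × I, Y) where
  toFun z := N.H (γ z.1) z.2
  continuous_toFun := N.contH.comp_continuous (f := fun z : I × I => (γ z.1, z.2)) (by fun_prop)
    fun z => ⟨hγ z.1, mem_univ _⟩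

@[simp] theorem cone_apply (N : ConeNbhd q b) {y y' : Y} (γ : Path y y')
    (hγ : ∀ t, q (γ t) ∈ N.O) (z : I × I) : N.cone γ hγ z = N.H (γ z.1) z.2 := rfl

/-- The initial points of the tracks form a path in the fibre over `b`, and `hfib` makes such a path
constant. -/
theorem cone_zero_eq (N : ConeNbhd q b)
    (hfib : ∀ γ : C(I, Y), (∀ t, q (γ t) = q (γ 0)) → ∀ t, γ t = γ 0)
    {y y' : Y} (γ : Path y y') (hγ : ∀ t, q (γ t) ∈ N.O) (t : I) : N.H (γ t) 0 = N.H y 0 := by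
  have h := hfib ⟨fun t => N.cone γ hγ (t, 0), by fun_prop⟩
    (fun t => (N.H_zero _ (hγ t)).trans (N.H_zero _ (hγ 0)).symm) t
  simpa using h

/-- The cone over `γ` is a square whose edge over the vertex `b` is constant; the relation is
between its other three edges. -/
theorem track_mul (N : ConeNbhd q b)
    (hfib : ∀ γ : C(I, Y), (∀ t, q (γ t) = q (γ 0)) → ∀ t, γ t = γ 0) (k : PathFunctor Y K)
    {y y' : Y} (γ : Path y y') (hγ : ∀ t, q (γ t) ∈ N.O) (hy : q y ∈ N.O) (hy' : q y' ∈ N.O) :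
    k.path (N.track y hy) * k.path γ = k.path (N.track y' hy') := by
  have e : N.H y 0 = N.H y' 0 := by
    have := N.cone_zero_eq hfib γ hγ 1
    rw [γ.target] at this
    exact this.symm
  have h := k.square (N.cone γ hγ) ((Path.refl (N.H y 0)).cast rfl e.symm) (N.track y' hy')
    (N.track y hy) γ (fun t => (N.cone_zero_eq hfib γ hγ t).symm)
    (fun t => by simp) (fun t => by simp) fun t => (N.H_one _ (hγ t)).symm
  rw [← h, k.path_const (fun _ => rfl), one_mul]

end ConeNbhd

/-- Descent: a functor on paths upstairs, and elements of the group attached to the points upstairs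
that are compatible with it, determine a functor on paths downstairs. -/
theorem exists_pathFunctor_of_coneNbhd {Y X K : Type*} [TopologicalSpace Y] [TopologicalSpace X]
    [Group K] (q : C(Y, X)) (hq : Function.Surjective q) (N : ∀ b, ConeNbhd q b)
    (hfib : ∀ γ : C(I, Y), (∀ t, q (γ t) = q (γ 0)) → ∀ t, γ t = γ 0)
    (k : PathFunctor Y K) (U : Y → K)
    (hU : ∀ b y y' (hy : q y ∈ (N b).O) (hy' : q y' ∈ (N b).O), q y = q y' →
      U ((N b).H y 0) * k.path ((N b).track y hy) * (U y)⁻¹ =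
        U ((N b).H y' 0) * k.path ((N b).track y' hy') * (U y')⁻¹) :
    ∃ F : PathFunctor X K, ∀ {y y' : Y} (p : Path.Homotopic.Quotient y y'),
      F.val (p.map q) = U y * k.val p * (U y')⁻¹ := by
  classical
  let sec := Function.surjInv hq
  have hsec : ∀ x, q (sec x) = x := Function.surjInv_eq hq
  -- The intended value on the track from `b` to `x`, computed from a chosen lift of `x`; by `hU`
  -- every lift gives the same value.
  let τ : X → X → K := fun b x => if hx : q (sec x) ∈ (N b).O then
    U ((N b).H (sec x) 0) * k.path ((N b).track (sec x) hx) * (U (sec x))⁻¹ else 1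
  have hτ' : ∀ b y (hy : q y ∈ (N b).O), τ b (q y) =
      U ((N b).H y 0) * k.path ((N b).track y hy) * (U y)⁻¹ := by
    intro b y hy
    have h : q (sec (q y)) ∈ (N b).O := by rwa [hsec]
    simp only [τ]
    rw [dif_pos h]
    exact hU b _ _ h hy (hsec _)
  have small : ∀ b y y' (γ : Path y y') (hγ : ∀ t, q (γ t) ∈ (N b).O),
      τ b (q y) * (U y * k.path γ * (U y')⁻¹) = τ b (q y') := by
    intro b y y' γ hγ
    have hy : q y ∈ (N b).O := by simpa using hγ 0
    have hy' : q y' ∈ (N b).O := by simpa using hγ 1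
    have e := (N b).cone_zero_eq hfib γ hγ 1
    rw [γ.target] at e
    rw [hτ' b y hy, hτ' b y' hy', ← (N b).track_mul hfib k γ hγ hy hy', e]
    group
  have hτ : IsTransportGerm τ := by
    intro b
    filter_upwards [(N b).isOpen.mem_nhds (N b).mem] with x hx
    -- By compactness of `I` the track from `x` to a nearby point stays in the neighbourhood of `b`,
    -- so `small` applies to its lift and yields flatness.
    have h1 : ∀ᶠ y in 𝓝 x, ∀ s ∈ (univ : Set I), (N x).h y s ∈ (N b).O := by
      refine isCompact_univ.eventually_forall_of_forall_eventually fun s _ => ?_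
      have hc : ContinuousAt (Function.uncurry (N x).h) (x, s) :=
        (N x).conth.continuousAt
          (prod_mem_nhds ((N x).isOpen.mem_nhds (N x).mem) univ_mem)
      have hxs : (N x).h x s = x := by
        have := (N x).q_H (sec x) (by rw [hsec]; exact (N x).mem) s
        rwa [(N x).H_self _ (hsec x), hsec, eq_comm] at this
      exact hc.eventually_mem ((N b).isOpen.mem_nhds (by simpa [Function.uncurry, hxs] using hx))
    filter_upwards [h1, (N x).isOpen.mem_nhds (N x).mem] with y hy hyx
    obtain ⟨z, rfl⟩ := hq y
    have hz := (N x).H_zero z hyx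
    have h2 := small b _ _ ((N x).track z hyx) fun t => by
      rw [ConeNbhd.track_apply, (N x).q_H z hyx]; exact hy t (mem_univ _)
    rw [hz] at h2
    rw [hτ' x z hyx, h2]
  obtain ⟨F, hF⟩ := hτ.exists_pathFunctor
  refine ⟨F, fun {y y'} p => ?_⟩
  refine path_induction (fun y y' p => F.val (p.map q) = U y * k.val p * (U y')⁻¹) ?_ ?_ p
  · intro x y z p p' h h'
    have : (p.trans p').map q = (p.map q).trans (p'.map q) := by
      induction p, p' using Path.Homotopic.Quotient.ind₂ with
      | mk γ γ' =>
      rw [← Path.Homotopic.Quotient.mk_trans, ← Path.Homotopic.Quotient.mk_map, Path.map_trans]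
      rfl
    rw [this, F.map_trans, k.map_trans, h, h']
    group
  · intro y
    obtain ⟨W, hW, hWF⟩ := hF (q y)
    refine ⟨q ⁻¹' (W ∩ (N (q y)).O), q.continuous.continuousAt.preimage_mem_nhds
      (inter_mem hW ((N (q y)).isOpen.mem_nhds (N (q y)).mem)), fun x x' γ hγ => ?_⟩
    have h1 := hWF (γ.map q.continuous) (by
      rintro _ ⟨t, rfl⟩
      exact (hγ ⟨t, rfl⟩).1)
    rw [← Path.Homotopic.Quotient.mk_map, h1, ← small (q y) x x' γ fun t => (hγ ⟨t, rfl⟩).2,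
      inv_mul_cancel_left]
    rfl

/-! ### The boundary of the polygon -/

/-- The point of the unit circle with angular coordinate `u`, the sides having length one. -/
noncomputable def arc (g : ℕ) (u : ℝ) : ℂ :=
  Complex.exp (((2 * Real.pi * (u / (4 * g)) : ℝ) : ℂ) * Complex.I)

theorem polygonSide_eq_arc (g j : ℕ) (s : ℝ) : polygonSide g j s = arc g (j + s) := rfl

theorem continuous_arc (g : ℕ) : Continuous (arc g) := by
  unfold arc
  fun_prop

theorem norm_arc (g : ℕ) (u : ℝ) : ‖arc g u‖ = 1 := Complex.norm_exp_ofReal_mul_I _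

theorem arc_ne_zero (g : ℕ) (u : ℝ) : arc g u ≠ 0 := Complex.exp_ne_zero _

/-- The point of the polygon with angular coordinate `u`. -/
noncomputable def arcPt (g : ℕ) (u : ℝ) : PolygonDisk := ⟨arc g u, by simp [norm_arc]⟩

@[simp] theorem coe_arcPt (g : ℕ) (u : ℝ) : (arcPt g u : ℂ) = arc g u := rfl

theorem continuous_arcPt (g : ℕ) : Continuous (arcPt g) := (continuous_arc g).subtype_mk _

theorem arc_eq_iff {g : ℕ} (hg : 1 ≤ g) {u v : ℝ} :
    arc g u = arc g v ↔ ∃ m : ℤ, u = v + m * (4 * g) := by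
  have hg' : (g : ℝ) ≠ 0 := by positivity
  have hg'' : (g : ℂ) ≠ 0 := by exact_mod_cast hg'
  have hpi : (Real.pi : ℂ) ≠ 0 := by exact_mod_cast Real.pi_ne_zero
  unfold arc
  rw [Complex.exp_eq_exp_iff_exists_int]
  refine exists_congr fun m => ?_
  have h : (((2 * Real.pi * (u / (4 * g)) : ℝ) : ℂ) * Complex.I =
      ((2 * Real.pi * (v / (4 * g)) : ℝ) : ℂ) * Complex.I + m * (2 * Real.pi * Complex.I)) ↔
      ((u : ℂ) = v + m * (4 * g)) := by
    push_cast
    constructor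
    · intro h
      have h2 : (2 * Real.pi * Complex.I) * ((u : ℂ) / (4 * g) - v / (4 * g) - m) = 0 := by
        linear_combination h
      have h3 := (mul_eq_zero.1 h2).resolve_left (by simp [hpi])
      field_simp at h3
      linear_combination h3
    · intro h
      rw [h]
      field_simp
  rw [h]
  norm_cast

theorem arcPt_eq_iff {g : ℕ} (hg : 1 ≤ g) {u v : ℝ} :
    arcPt g u = arcPt g v ↔ ∃ m : ℤ, u = v + m * (4 * g) := by
  rw [← arc_eq_iff hg, Subtype.ext_iff]; rfl

theorem exists_arcPt {g : ℕ} (hg : 1 ≤ g) (x : PolygonDisk) (hx : ‖(x : ℂ)‖ = 1) :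
    ∃ u : ℝ, x = arcPt g u := by
  have hg' : (g : ℝ) ≠ 0 := by positivity
  refine ⟨2 * g / Real.pi * Complex.arg x, Subtype.ext ?_⟩
  rw [coe_arcPt, arc, show 2 * Real.pi * (2 * g / Real.pi * Complex.arg x / (4 * g)) =
    Complex.arg x by field_simp; ring]
  have := Complex.norm_mul_exp_arg_mul_I (x : ℂ)
  rwa [hx, Complex.ofReal_one, one_mul, eq_comm] at this

/-- The index of the side that is glued to the side `j`. -/
def partner (j : ℤ) : ℤ := if j % 4 < 2 then j + 2 else j - 2

theorem partner_partner (j : ℤ) : partner (partner j) = j := by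
  unfold partner; split_ifs <;> omega

theorem partner_ne (g : ℕ) (j m : ℤ) : partner j ≠ j + m * (4 * g) := by
  have : ∃ n, n = m * g ∧ m * (4 * g) = 4 * n := ⟨m * g, rfl, by ring⟩
  obtain ⟨n, -, h⟩ := this
  unfold partner; split_ifs <;> omega

theorem partner_add (g : ℕ) (j m : ℤ) : partner (j + m * (4 * g)) = partner j + m * (4 * g) := by
  have : ∃ n, n = m * g ∧ m * (4 * g) = 4 * n := ⟨m * g, rfl, by ring⟩
  obtain ⟨n, -, h⟩ := this
  unfold partner; split_ifs <;> omega

/-- The angular coordinate of the point glued to the point `u` of the side `j`. -/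
noncomputable def mirror (j : ℤ) (u : ℝ) : ℝ := j + 1 + partner j - u

theorem mirror_mirror (j : ℤ) (u : ℝ) : mirror (partner j) (mirror j u) = u := by
  unfold mirror
  rw [partner_partner]
  ring

theorem mirror_mem_Icc {j : ℤ} {u : ℝ} (hu : u ∈ Icc (j : ℝ) (j + 1)) :
    mirror j u ∈ Icc (partner j : ℝ) (partner j + 1) := by
  unfold mirror
  exact ⟨by linarith [hu.2], by linarith [hu.1]⟩

theorem mirror_mem_Ioo {j : ℤ} {u : ℝ} (hu : u ∈ Ioo (j : ℝ) (j + 1)) :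
    mirror j u ∈ Ioo (partner j : ℝ) (partner j + 1) := by
  unfold mirror
  exact ⟨by linarith [hu.2], by linarith [hu.1]⟩

/-- The equivalence relation generated by the gluing of the sides. -/
inductive GlueRel (g : ℕ) : PolygonDisk → PolygonDisk → Prop
  | refl (x : PolygonDisk) : GlueRel g x x
  | corner (i j : ℤ) : GlueRel g (arcPt g i) (arcPt g j)
  | side (j : ℤ) (u : ℝ) (hu : u ∈ Ioo (j : ℝ) (j + 1)) :
      GlueRel g (arcPt g u) (arcPt g (mirror j u))

theorem GlueRel.side' {g : ℕ} {j : ℤ} {u : ℝ} (hu : u ∈ Icc (j : ℝ) (j + 1)) :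
    GlueRel g (arcPt g u) (arcPt g (mirror j u)) := by
  rcases eq_or_lt_of_le hu.1 with h | h
  · have := GlueRel.corner (g := g) j (1 + partner j)
    rwa [show mirror j u = ((1 + partner j : ℤ) : ℝ) by unfold mirror; push_cast; linarith, ← h]
  rcases eq_or_lt_of_le hu.2 with h' | h'
  · have := GlueRel.corner (g := g) (j + 1) (partner j)
    rw [show mirror j u = ((partner j : ℤ) : ℝ) by unfold mirror; linarith, h']
    exact_mod_cast this
  · exact GlueRel.side j u ⟨h, h'⟩

theorem GlueRel.symm {g : ℕ} {x y : PolygonDisk} (h : GlueRel g x y) : GlueRel g y x := by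
  cases h with
  | refl => exact .refl _
  | corner i j => exact .corner j i
  | side j u hu =>
    have := GlueRel.side (g := g) _ _ (mirror_mem_Ioo hu)
    rwa [mirror_mirror] at this

theorem not_corner {g : ℕ} (hg : 1 ≤ g) {i j : ℤ} {u : ℝ} (hu : u ∈ Ioo (j : ℝ) (j + 1)) :
    arcPt g u ≠ arcPt g i := by
  intro h
  obtain ⟨m, hm⟩ := (arcPt_eq_iff hg).1 h
  have h1 : (j : ℝ) < (i + m * (4 * g) : ℤ) := by push_cast; linarith [hu.1]
  have h2 : ((i + m * (4 * g) : ℤ) : ℝ) < (j + 1 : ℤ) := by push_cast; linarith [hu.2]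
  have h1' := Int.cast_lt.1 h1
  have h2' := Int.cast_lt.1 h2
  omega

theorem side_unique {g : ℕ} (hg : 1 ≤ g) {i j : ℤ} {u v : ℝ} (hu : u ∈ Ioo (i : ℝ) (i + 1))
    (hv : v ∈ Ioo (j : ℝ) (j + 1)) (h : arcPt g u = arcPt g v) :
    ∃ m : ℤ, u = v + m * (4 * g) ∧ i = j + m * (4 * g) := by
  obtain ⟨m, hm⟩ := (arcPt_eq_iff hg).1 h
  refine ⟨m, hm, ?_⟩
  have h1 : (i : ℝ) < (j + m * (4 * g) + 1 : ℤ) := by push_cast; linarith [hu.1, hv.2]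
  have h2 : ((j + m * (4 * g) : ℤ) : ℝ) < (i + 1 : ℤ) := by push_cast; linarith [hu.2, hv.1]
  have h1' := Int.cast_lt.1 h1
  have h2' := Int.cast_lt.1 h2
  omega

theorem mirror_add {g : ℕ} (hg : 1 ≤ g) (j m : ℤ) (u : ℝ) :
    arcPt g (mirror (j + m * (4 * g)) (u + m * (4 * g))) = arcPt g (mirror j u) := by
  refine (arcPt_eq_iff hg).2 ⟨m, ?_⟩
  unfold mirror
  rw [partner_add]
  push_cast
  ring

theorem GlueRel.corner_iff {g : ℕ} (hg : 1 ≤ g) {i : ℤ} {y : PolygonDisk} :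
    GlueRel g (arcPt g i) y ↔ ∃ j : ℤ, y = arcPt g j := by
  constructor
  · intro h
    generalize hx : arcPt g i = x at h
    cases h with
    | refl => exact ⟨i, hx.symm⟩
    | corner k j => exact ⟨j, rfl⟩
    | side j u hu => exact absurd hx.symm (not_corner hg hu)
  · rintro ⟨j, rfl⟩
    exact .corner i j

theorem GlueRel.side_iff {g : ℕ} (hg : 1 ≤ g) {j : ℤ} {u : ℝ} (hu : u ∈ Ioo (j : ℝ) (j + 1))
    {y : PolygonDisk} :
    GlueRel g (arcPt g u) y ↔ y = arcPt g u ∨ y = arcPt g (mirror j u) := by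
  constructor
  · intro h
    generalize hx : arcPt g u = x at h
    cases h with
    | refl => exact Or.inl rfl
    | corner k i => exact absurd hx (not_corner hg hu)
    | side k v hv =>
      obtain ⟨m, rfl, rfl⟩ := side_unique hg hu hv hx
      exact Or.inr (mirror_add hg k m v).symm
  · rintro (rfl | rfl)
    · exact .refl _
    · exact .side j u hu

/-- The classes are explicit: single interior points, pairs of mirror points on open sides, and the
set of all corners. -/
theorem GlueRel.trans {g : ℕ} (hg : 1 ≤ g) {x y z : PolygonDisk} (h : GlueRel g x y)
    (h' : GlueRel g y z) : GlueRel g x z := by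
  cases h with
  | refl => exact h'
  | corner i j =>
    obtain ⟨k, rfl⟩ := (GlueRel.corner_iff hg).1 h'
    exact .corner i k
  | side j u hu =>
    rcases (GlueRel.side_iff hg (mirror_mem_Ioo hu)).1 h' with rfl | rfl
    · exact .side j u hu
    · rw [mirror_mirror]
      exact .refl _

theorem GlueRel.interior {g : ℕ} {x y : PolygonDisk} (h : GlueRel g x y) (hx : ‖(x : ℂ)‖ < 1) :
    x = y := by
  cases h with
  | refl => rfl
  | corner i j => simp [norm_arc] at hx
  | side j u hu => simp [norm_arc] at hx

theorem GlueRel.of_polygonGlue {g : ℕ} {x y : PolygonDisk} (h : PolygonGlue g x y) :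
    GlueRel g x y := by
  obtain ⟨k, -, s, hs, ⟨h1, h2⟩ | ⟨h1, h2⟩⟩ := h
  · have := GlueRel.side' (g := g) (j := 4 * k) (u := 4 * k + s)
      ⟨by push_cast; linarith [hs.1], by push_cast; linarith [hs.2]⟩
    convert this using 1
    · refine Subtype.ext (h1.trans ?_)
      simp [polygonSide_eq_arc]
    · refine Subtype.ext (h2.trans ?_)
      have hp : partner (4 * k) = 4 * k + 2 := by unfold partner; split_ifs <;> omega
      simp only [polygonSide_eq_arc, coe_arcPt, mirror, hp]
      congr 1
      push_cast
      ring
  · have := GlueRel.side' (g := g) (j := 4 * k + 1) (u := 4 * k + 1 + s)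
      ⟨by push_cast; linarith [hs.1], by push_cast; linarith [hs.2]⟩
    convert this using 1
    · refine Subtype.ext (h1.trans ?_)
      simp [polygonSide_eq_arc]
    · refine Subtype.ext (h2.trans ?_)
      have hp : partner (4 * k + 1) = 4 * k + 3 := by unfold partner; split_ifs <;> omega
      simp only [polygonSide_eq_arc, coe_arcPt, mirror, hp]
      congr 1
      push_cast
      ring

/-- `PolygonGlue` only speaks of the blocks `k < g`, so the block `j / 4` is reduced modulo `g`; the
quotient `m` counts full turns. -/
theorem mk_side_eq {g : ℕ} (hg : 1 ≤ g) {j : ℤ} (hj : j % 4 < 2) {s : ℝ} (hs : s ∈ Icc (0 : ℝ) 1) :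
    (Quot.mk (PolygonGlue g) (arcPt g (j + s))) = Quot.mk _ (arcPt g (j + 3 - s)) := by
  have hg0 : (g : ℤ) ≠ 0 := by positivity
  have hk0 := Int.emod_nonneg (j / 4) hg0
  have hk1 := Int.emod_lt_of_pos (j / 4) (show (0 : ℤ) < g by omega)
  obtain ⟨k, hk⟩ := Int.eq_ofNat_of_zero_le hk0
  have hkg : k < g := by omega
  set m := j / 4 / (g : ℤ) with hm
  have h4 : j / 4 = k + m * g := by
    rw [← hk, hm]
    have := Int.emod_add_mul_ediv (j / 4) g
    linarith [mul_comm (g : ℤ) (j / 4 / g)]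
  refine Quot.sound ⟨k, hkg, s, hs, ?_⟩
  have h0 : j % 4 = 0 ∨ j % 4 = 1 := by omega
  have hj4 := Int.emod_add_mul_ediv j 4
  rw [h4] at hj4
  refine h0.imp (fun h => ?_) (fun h => ?_) <;> rw [h] at hj4 <;>
    simp only [polygonSide_eq_arc, coe_arcPt] <;>
    refine ⟨(arc_eq_iff hg).2 ⟨m, ?_⟩, (arc_eq_iff hg).2 ⟨m, ?_⟩⟩ <;> rw [← hj4] <;>
    push_cast <;> ring

/-- The endpoints of the glued sides give `4k ~ 4k+3 ~ 4k+2 ~ 4k+1 ~ 4k+4`, so the corners of a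
block coincide and each block is linked to the next. -/
theorem mk_corner_eq {g : ℕ} (hg : 1 ≤ g) (i : ℤ) :
    (Quot.mk (PolygonGlue g) (arcPt g i)) = Quot.mk _ (arcPt g (0 : ℤ)) := by
  have key : ∀ k : ℤ, ∀ a b : ℤ, (a = 0 ∧ b = 3 ∨ a = 1 ∧ b = 2 ∨ a = 1 ∧ b = 4 ∨ a = 2 ∧ b = 3) →
      (Quot.mk (PolygonGlue g) (arcPt g ((4 * k + a : ℤ) : ℝ))) =
        Quot.mk _ (arcPt g ((4 * k + b : ℤ) : ℝ)) := by
    intro k a b h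
    have h0 := @mk_side_eq g hg (4 * k) (by omega)
    have h1 := @mk_side_eq g hg (4 * k + 1) (by omega)
    rcases h with ⟨rfl, rfl⟩ | ⟨rfl, rfl⟩ | ⟨rfl, rfl⟩ | ⟨rfl, rfl⟩
    · convert h0 (s := 0) (by simp) using 3 <;> push_cast <;> ring
    · convert h0 (s := 1) (by simp) using 3 <;> push_cast <;> ring
    · convert h1 (s := 0) (by simp) using 3 <;> push_cast <;> ring
    · convert h1 (s := 1) (by simp) using 3 <;> push_cast <;> ring
  have e1 : ∀ k : ℤ, (Quot.mk (PolygonGlue g) (arcPt g ((4 * k + 1 : ℤ) : ℝ))) =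
      Quot.mk _ (arcPt g ((4 * k + 0 : ℤ) : ℝ)) := fun k =>
    (key k 1 2 (by simp)).trans ((key k 2 3 (by simp)).trans (key k 0 3 (by simp)).symm)
  have e4 : ∀ k : ℤ, (Quot.mk (PolygonGlue g) (arcPt g ((4 * k + 4 : ℤ) : ℝ))) =
      Quot.mk _ (arcPt g ((4 * k + 0 : ℤ) : ℝ)) := fun k =>
    (key k 1 4 (by simp)).symm.trans (e1 k)
  have e : ∀ k : ℤ, (Quot.mk (PolygonGlue g) (arcPt g ((4 * k + 0 : ℤ) : ℝ))) =
      Quot.mk _ (arcPt g (0 : ℤ)) := by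
    intro k
    induction k using Int.induction_on with
    | zero => norm_num
    | succ n ih =>
      rw [← ih, ← e4 n]
      congr 3
    | pred n ih =>
      rw [← ih]
      have := e4 (-(n : ℤ) - 1)
      rw [← this]
      congr 3
      ring
  have hi : i = 4 * (i / 4) + i % 4 := by omega
  have h4 : i % 4 = 0 ∨ i % 4 = 1 ∨ i % 4 = 2 ∨ i % 4 = 3 := by omega
  rw [hi, ← e (i / 4)]
  rcases h4 with h | h | h | h <;> rw [h]
  · exact e1 _
  · exact (key _ 1 2 (by simp)).symm.trans (e1 _)
  · exact (key _ 0 3 (by simp)).symm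

theorem mk_eq_mk_iff {g : ℕ} (hg : 1 ≤ g) {x y : PolygonDisk} :
    Quot.mk (PolygonGlue g) x = Quot.mk _ y ↔ GlueRel g x y := by
  constructor
  · intro h
    have := Quot.eqvGen_exact h
    clear h
    induction this with
    | rel x y h => exact .of_polygonGlue h
    | refl x => exact .refl x
    | symm x y _ ih => exact ih.symm
    | trans x y z _ _ ih ih' => exact ih.trans hg ih'
  · intro h
    cases h with
    | refl => rfl
    | corner i j => rw [mk_corner_eq hg, mk_corner_eq hg j]
    | side j u hu =>
      rcases lt_or_ge (j % 4) 2 with hj | hj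
      · have := mk_side_eq hg hj (s := u - j) ⟨by linarith [hu.1], by linarith [hu.2]⟩
        convert this using 3
        · ring
        · unfold mirror partner
          rw [if_pos hj]
          push_cast
          ring
      · have := mk_side_eq hg (j := j - 2) (by omega) (s := j + 1 - u)
          ⟨by linarith [hu.2], by linarith [hu.1]⟩
        refine Eq.symm ?_
        convert this using 3
        · unfold mirror partner
          rw [if_neg (by omega)]
          push_cast
          ring
        · push_cast
          ring

/-- `q` presents its target as the quotient of the `4 * g`-gon by the gluing of its sides. -/
structure IsPolygonQuotient {S : Type*} [TopologicalSpace S] (g : ℕ) (q : PolygonDisk → S) :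
    Prop where
  isQuotientMap : IsQuotientMap q
  eq_iff : ∀ {x y}, q x = q y ↔ GlueRel g x y

theorem IsClosedOrientableSurface.exists_isPolygonQuotient {S : Type*} [TopologicalSpace S] {g : ℕ}
    (hg : 1 ≤ g) (hS : IsClosedOrientableSurface g S) :
    ∃ q : C(PolygonDisk, S), IsPolygonQuotient g q := by
  obtain ⟨f⟩ := hS
  have hq : IsQuotientMap (f.symm ∘ (Quot.mk (PolygonGlue g) : PolygonDisk → GenusSurface g)) :=
    f.symm.isQuotientMap.comp isQuotientMap_quot_mk
  refine ⟨⟨_, hq.continuous⟩, hq, fun {x y} => ?_⟩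
  rw [← mk_eq_mk_iff hg]
  exact f.symm.injective.eq_iff

/-! ### Conical neighbourhoods in the quotient of the polygon -/

/-- Contraction to the boundary point with angular coordinate `v`, linear in logarithmic polar
coordinates. -/
noncomputable def contr (g : ℕ) (v : ℝ) (x : PolygonDisk) (s : I) : PolygonDisk :=
  ⟨arc g v * Complex.exp (s * Complex.log (x / arc g v)), by
    rw [mem_closedBall_zero_iff, norm_mul, norm_arc, one_mul, Complex.norm_exp, Complex.re_ofReal_mul,
      Complex.log_re, norm_div, norm_arc, div_one, Real.exp_le_one_iff]
    exact mul_nonpos_of_nonneg_of_nonpos s.2.1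
      (Real.log_nonpos (norm_nonneg _) (mem_closedBall_zero_iff.1 x.2))⟩

theorem coe_contr (g : ℕ) (v : ℝ) (x : PolygonDisk) (s : I) : (contr g v x s : ℂ) =
    arc g v * Complex.exp (s * Complex.log (x / arc g v)) := rfl

/-- The open sector with angular coordinates between `lo` and `hi`, as seen from `v`. -/
noncomputable def sector (g : ℕ) (v lo hi : ℝ) : Set PolygonDisk :=
  {x | (x : ℂ) / arc g v ∈ Complex.slitPlane ∧
    v + 2 * g / Real.pi * Complex.arg (x / arc g v) ∈ Ioo lo hi}

theorem isOpen_sector (g : ℕ) (v lo hi : ℝ) : IsOpen (sector g v lo hi) := by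
  have h1 : Continuous fun x : PolygonDisk => (x : ℂ) / arc g v := by fun_prop
  have h2 : IsOpen ((fun x : PolygonDisk => (x : ℂ) / arc g v) ⁻¹' Complex.slitPlane) :=
    Complex.isOpen_slitPlane.preimage h1
  refine ContinuousOn.isOpen_inter_preimage (s := _ ⁻¹' Complex.slitPlane)
    (f := fun x : PolygonDisk => v + 2 * g / Real.pi * Complex.arg (x / arc g v))
    (t := Ioo lo hi) ?_ h2 isOpen_Ioo
  intro x hx
  have := (Complex.continuousAt_arg hx).comp (f := fun x : PolygonDisk => (x : ℂ) / arc g v)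
    h1.continuousAt
  exact (continuousAt_const.add (continuousAt_const.mul this)).continuousWithinAt

theorem div_arc {g : ℕ} {x : PolygonDisk} {r u : ℝ} (hx : (x : ℂ) = r * arc g u) (v : ℝ) :
    (x : ℂ) / arc g v = r * Complex.exp (((Real.pi / (2 * g) * (u - v) : ℝ) : ℂ) * Complex.I) := by
  rw [div_eq_iff (arc_ne_zero g v), hx, mul_assoc]
  congr 1
  unfold arc
  rw [← Complex.exp_add]
  congr 1
  push_cast
  rcases eq_or_ne (g : ℂ) 0 with h | h
  · simp [h]
  · field_simp
    ring

theorem angle_mem {g : ℕ} (hg : 1 ≤ g) {u v : ℝ} (h : |u - v| < 2 * g) :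
    -Real.pi < Real.pi / (2 * g) * (u - v) ∧ Real.pi / (2 * g) * (u - v) < Real.pi := by
  have hg' : (0 : ℝ) < 2 * g := by positivity
  obtain ⟨h1, h2⟩ := abs_lt.1 h
  have hp := Real.pi_pos
  rw [div_mul_eq_mul_div, lt_div_iff₀ hg', div_lt_iff₀ hg']
  constructor <;> nlinarith

/-- The bound `|u - v| < 2 * g` is half a turn, so the principal logarithm of `x / arc g v` has the
expected argument and the contraction is linear in `(log r, u)`. -/
theorem contr_polar {g : ℕ} (hg : 1 ≤ g) {x : PolygonDisk} {r u v : ℝ} (hr : 0 < r)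
    (hx : (x : ℂ) = r * arc g u) (h : |u - v| < 2 * g) (s : I) :
    (contr g v x s : ℂ) = Complex.exp (s * (Real.log r : ℂ)) * arc g (v + s * (u - v)) := by
  obtain ⟨h1, h2⟩ := angle_mem hg h
  have hg' : (g : ℂ) ≠ 0 := by
    have : g ≠ 0 := by omega
    exact_mod_cast this
  rw [coe_contr, div_arc hx, Complex.log_ofReal_mul hr (Complex.exp_ne_zero _), Complex.log_exp]
  · rw [mul_add, Complex.exp_add, ← mul_assoc, mul_comm (arc g v), mul_assoc]
    congr 1
    unfold arc
    rw [← Complex.exp_add]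
    congr 1
    push_cast
    field_simp
    ring
  · rwa [Complex.im_ofReal_mul, Complex.I_im, mul_one]
  · rw [Complex.im_ofReal_mul, Complex.I_im, mul_one]; exact h2.le

/-- The contraction preserves the boundary and is affine in the angular coordinate there, hence
commutes with `mirror`. A straight-line contraction would leave the boundary and not descend to the
surface. -/
theorem contr_arcPt {g : ℕ} (hg : 1 ≤ g) {u v : ℝ} (h : |u - v| < 2 * g) (s : I) :
    contr g v (arcPt g u) s = arcPt g (v + s * (u - v)) := by
  refine Subtype.ext ?_
  rw [contr_polar hg one_pos (x := arcPt g u) (u := u) (by simp) h]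
  simp

theorem exists_polar_of_mem_sector {g : ℕ} (hg : 1 ≤ g) {v lo hi : ℝ} {x : PolygonDisk}
    (hx : x ∈ sector g v lo hi) : ∃ u ∈ Ioo lo hi, 0 < ‖(x : ℂ)‖ ∧ (x : ℂ) = ‖(x : ℂ)‖ * arc g u := by
  have hg' : (g : ℝ) ≠ 0 := by positivity
  refine ⟨_, hx.2, ?_, ?_⟩
  · refine norm_pos_iff.2 fun h => Complex.slitPlane_ne_zero hx.1 (by simp [h])
  · have h1 := Complex.norm_mul_exp_arg_mul_I ((x : ℂ) / arc g v)
    rw [norm_div, norm_arc, div_one, eq_div_iff (arc_ne_zero g v)] at h1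
    generalize Complex.arg ((x : ℂ) / arc g v) = θ at h1
    refine h1.symm.trans ?_
    rw [mul_assoc]
    congr 1
    unfold arc
    rw [← Complex.exp_add]
    congr 1
    have hg'' : (g : ℂ) ≠ 0 := by exact_mod_cast hg'
    have hpi : (Real.pi : ℂ) ≠ 0 := by exact_mod_cast Real.pi_ne_zero
    push_cast
    field_simp
    ring

theorem mem_sector {g : ℕ} (hg : 1 ≤ g) {v lo hi u r : ℝ} {x : PolygonDisk} (hu : u ∈ Ioo lo hi)
    (hv : |u - v| < 2 * g) (hr : 0 < r) (hx : (x : ℂ) = r * arc g u) : x ∈ sector g v lo hi := by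
  obtain ⟨h1, h2⟩ := angle_mem hg hv
  have hg' : (g : ℝ) ≠ 0 := by positivity
  have h3 := div_arc hx v
  have h4 : Complex.arg ((x : ℂ) / arc g v) = Real.pi / (2 * g) * (u - v) := by
    rw [h3, Complex.arg_real_mul _ hr, Complex.arg_exp_mul_I, toIocMod_eq_self]
    exact ⟨by linarith, by linarith⟩
  refine ⟨?_, ?_⟩
  · rw [Complex.mem_slitPlane_iff_arg, h4]
    refine ⟨h2.ne, ?_⟩
    rw [h3]
    exact mul_ne_zero (by exact_mod_cast hr.ne') (Complex.exp_ne_zero _)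
  · rw [h4]
    convert hu using 1
    have := Real.pi_ne_zero
    field_simp
    ring

theorem continuousAt_contr {g : ℕ} {v : ℝ} {x : PolygonDisk} (s : I)
    (hx : (x : ℂ) / arc g v ∈ Complex.slitPlane) :
    ContinuousAt (Function.uncurry (contr g v)) (x, s) := by
  refine IsInducing.subtypeVal.continuousAt_iff.2 ?_
  have h1 : ContinuousAt (fun z : PolygonDisk × I => (z.1 : ℂ) / arc g v) (x, s) := by fun_prop
  have h2 := h1.clog hx
  have h3 : ContinuousAt (fun z : PolygonDisk × I => ((z.2 : ℝ) : ℂ)) (x, s) := by fun_prop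
  exact continuousAt_const.mul (h3.mul h2).cexp

/-- A function downstairs is continuous on an open set if it is so upstairs. -/
theorem Topology.IsQuotientMap.continuousOn_prod {X Y Z : Type*} [TopologicalSpace X]
    [TopologicalSpace Y] [TopologicalSpace Z] {q : Y → X} (hq : IsQuotientMap q) {O : Set X}
    (hO : IsOpen O) {f : X → I → Z}
    (hf : ContinuousOn (Function.uncurry fun y => f (q y)) ((q ⁻¹' O) ×ˢ univ)) :
    ContinuousOn (Function.uncurry f) (O ×ˢ univ) := by
  -- Since `I` is locally compact, the product of a quotient map with `I` is again a quotient map.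
  have h1 := (hq.restrictPreimage_isOpen hO).continuous_lift_prod_left
    (g := fun z : O × I => f z.1 z.2) ?_
  · rw [continuousOn_iff_continuous_domRestrict]
    exact h1.comp (f := fun z : (O ×ˢ univ : Set (X × I)) => ((⟨z.1.1, z.2.1⟩, z.1.2) : O × I))
      (by fun_prop)
  · exact hf.comp_continuous (f := fun z : (q ⁻¹' O) × I => ((z.1 : Y), z.2)) (by fun_prop)
      fun z => ⟨z.1.2, mem_univ _⟩

namespace IsPolygonQuotient

variable {S : Type*} [TopologicalSpace S] {g : ℕ} {q : PolygonDisk → S}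

theorem surjective (hq : IsPolygonQuotient g q) : Function.Surjective q := hq.isQuotientMap.surjective

/-- The relation between two points with the same image in the neighbourhood of `b`. -/
def TrackRel (g : ℕ) {b : S} (N : ConeNbhd q b) (y y' : PolygonDisk) : Prop :=
  y = y' ∨ ((∀ s, N.H y s = y) ∧ ∀ s, N.H y' s = y') ∨
    ∃ (j : ℤ) (u v : ℝ), u ∈ Ioo (j : ℝ) (j + 1) ∧ v ∈ Icc (j : ℝ) (j + 1) ∧
      ∀ s : I, N.H y s = arcPt g (v + s * (u - v)) ∧
        N.H y' s = arcPt g (mirror j (v + s * (u - v)))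

/-- The open disk is saturated and `q` is injective on it, so the straight-line contraction to `p`
descends. -/
theorem exists_coneNbhd_interior (hq : IsPolygonQuotient g q) (p : PolygonDisk)
    (hp : ‖(p : ℂ)‖ < 1) : ∃ N : ConeNbhd q (q p), ∀ y y', q y ∈ N.O → q y = q y' →
      TrackRel g N y y' := by
  classical
  let V : Set PolygonDisk := {x | ‖(x : ℂ)‖ < 1}
  have hV : IsOpen V := isOpen_lt (by fun_prop) continuous_const
  have hqV : q ⁻¹' (q '' V) = V := by
    refine Subset.antisymm ?_ (subset_preimage_image q V)
    rintro x ⟨y, hy, hyx⟩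
    rwa [← (hq.eq_iff.1 hyx).interior hy]
  have inj : ∀ {y y'}, q y ∈ q '' V → q y = q y' → y = y' := by
    intro y y' hy h
    have : y ∈ q ⁻¹' (q '' V) := hy
    rw [hqV] at this
    exact (hq.eq_iff.1 h).interior this
  have hH (x : PolygonDisk) (s : I) : (p : ℂ) + (s : ℝ) • ((x : ℂ) - p) ∈ Metric.closedBall (0 : ℂ) 1 :=
    (convex_closedBall (0 : ℂ) 1).add_smul_sub_mem p.2 x.2 s.2
  let H : PolygonDisk → I → PolygonDisk := fun x s => ⟨_, hH x s⟩
  have cH : Continuous (Function.uncurry H) := by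
    refine Continuous.subtype_mk ?_ _
    fun_prop
  refine ⟨{
    O := q '' V
    isOpen := by rwa [← hq.isQuotientMap.isOpen_preimage, hqV]
    mem := ⟨p, hp, rfl⟩
    H := H
    h := fun x s => q (H (Function.surjInv hq.surjective x) s)
    contH := cH.continuousOn
    conth := ?_
    H_one := fun y _ => Subtype.ext (by simp [H])
    H_zero := fun y _ => congrArg q (Subtype.ext (by simp [H]))
    H_self := ?_
    q_H := ?_ }, fun y y' hy h => Or.inl (inj hy h)⟩
  · refine hq.isQuotientMap.continuousOn_prod (by rwa [← hq.isQuotientMap.isOpen_preimage, hqV]) ?_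
    refine (hq.isQuotientMap.continuous.comp cH).continuousOn.congr ?_
    rintro ⟨y, s⟩ ⟨hy, -⟩
    have := inj hy (Function.surjInv_eq hq.surjective (q y)).symm
    simp [Function.uncurry, ← this]
  · intro y hy s
    have : p = y := inj ⟨p, hp, rfl⟩ hy.symm
    subst this
    exact Subtype.ext (by simp [H])
  · intro y hy s
    rw [← inj hy (Function.surjInv_eq hq.surjective (q y)).symm]

/-- A common construction for corners and for points of open sides: sectors around the points of the
fibre, each contracted to its centre. By `hdisj` two sectors that meet differ by full turns; by
`hsat` their union is saturated and the gluing matches the centres, so the contraction descends. -/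
theorem exists_coneNbhd_of_sectors (hq : IsPolygonQuotient g q) (hg : 1 ≤ g) (b : S) {ι : Type*}
    [Nonempty ι] (v lo hi : ι → ℝ) (hlo : ∀ i, lo i < v i) (hhi : ∀ i, v i < hi i)
    (hlen : ∀ i, hi i - lo i ≤ 1)
    (hdisj : ∀ i i' u u', u ∈ Ioo (lo i) (hi i) → u' ∈ Ioo (lo i') (hi i') →
      arcPt g u = arcPt g u' → ∃ m : ℤ, u = u' + m * (4 * g) ∧ v i = v i' + m * (4 * g))
    (hsat : ∀ i u, u ∈ Ioo (lo i) (hi i) → ∀ x, GlueRel g (arcPt g u) x →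
      ∃ i' u', u' ∈ Ioo (lo i') (hi i') ∧ x = arcPt g u' ∧ (arcPt g u = x ∨
        (u = v i ∧ u' = v i') ∨ ∃ j : ℤ, u ∈ Ioo (j : ℝ) (j + 1) ∧ v i ∈ Icc (j : ℝ) (j + 1) ∧
          u' = mirror j u ∧ v i' = mirror j (v i)))
    (hfib : ∀ y, q y = b ↔ ∃ i, y = arcPt g (v i)) :
    ∃ N : ConeNbhd q b, ∀ y y', q y ∈ N.O → q y = q y' → TrackRel g N y y' := by
  classical
  have hg' : (1 : ℝ) ≤ g := by exact_mod_cast hg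
  have hclose : ∀ i u, u ∈ Ioo (lo i) (hi i) → |u - v i| < 2 * g := by
    intro i u hu
    rw [abs_lt]
    constructor <;> linarith [hlo i, hhi i, hlen i, hu.1, hu.2]
  let sec : ι → Set PolygonDisk := fun i => sector g (v i) (lo i) (hi i)
  have harc : ∀ i u, u ∈ Ioo (lo i) (hi i) → arcPt g u ∈ sec i := fun i u hu =>
    mem_sector hg hu (hclose i u hu) one_pos (by simp)
  have hbd : ∀ i x, x ∈ sec i → ‖(x : ℂ)‖ = 1 → ∃ u ∈ Ioo (lo i) (hi i), x = arcPt g u := by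
    intro i x hx h1
    obtain ⟨u, hu, -, h⟩ := exists_polar_of_mem_sector hg hx
    rw [h1, Complex.ofReal_one, one_mul] at h
    exact ⟨u, hu, Subtype.ext h⟩
  let V : Set PolygonDisk := ⋃ i, sec i
  have hV : IsOpen V := isOpen_iUnion fun i => isOpen_sector _ _ _ _
  -- The sector is chosen arbitrarily; `hH` shows that the result does not depend on the choice.
  -- Outside the sectors the value is irrelevant.
  let H : PolygonDisk → I → PolygonDisk := fun x s =>
    if h : ∃ i, x ∈ sec i then contr g (v h.choose) x s else x
  have hH : ∀ i x, x ∈ sec i → ∀ s, H x s = contr g (v i) x s := by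
    intro i x hx s
    have h : ∃ i, x ∈ sec i := ⟨i, hx⟩
    simp only [H, dif_pos h]
    generalize h.choose = k, h.choose_spec = hk
    obtain ⟨u, hu, hr, hxu⟩ := exists_polar_of_mem_sector hg hx
    obtain ⟨u', hu', -, hxu'⟩ := exists_polar_of_mem_sector hg hk
    have he : arcPt g u' = arcPt g u := by
      refine Subtype.ext ?_
      have hr' : (‖(x : ℂ)‖ : ℂ) ≠ 0 := by exact_mod_cast hr.ne'
      exact mul_left_cancel₀ hr' (hxu'.symm.trans hxu)
    obtain ⟨m, hm, hm'⟩ := hdisj _ _ _ _ hu' hu he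
    refine Subtype.ext ?_
    rw [contr_polar hg hr hxu (hclose _ _ hu), contr_polar hg hr hxu' (hclose _ _ hu')]
    congr 1
    refine (arc_eq_iff hg).2 ⟨m, ?_⟩
    rw [hm, hm']
    ring
  have hHarc : ∀ i u, u ∈ Ioo (lo i) (hi i) → ∀ s : I,
      H (arcPt g u) s = arcPt g (v i + s * (u - v i)) := fun i u hu s => by
    rw [hH i _ (harc i u hu), contr_arcPt hg (hclose i u hu)]
  have hqV : q ⁻¹' (q '' V) = V := by
    refine Subset.antisymm ?_ (subset_preimage_image q V)
    rintro x ⟨y, hy, hyx⟩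
    have h := hq.eq_iff.1 hyx
    rcases lt_or_eq_of_le (mem_closedBall_zero_iff.1 y.2) with h1 | h1
    · rwa [← h.interior h1]
    · obtain ⟨i, hi⟩ := mem_iUnion.1 hy
      obtain ⟨u, hu, rfl⟩ := hbd i y hi h1
      obtain ⟨i', u', hu', rfl, -⟩ := hsat i u hu x h
      exact mem_iUnion.2 ⟨i', harc i' u' hu'⟩
  have hO : IsOpen (q '' V) := by rwa [← hq.isQuotientMap.isOpen_preimage, hqV]
  have hrel : ∀ y y', q y ∈ q '' V → q y = q y' → y = y' ∨
      ((∀ s, H y s = y) ∧ ∀ s, H y' s = y') ∨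
      ∃ (j : ℤ) (u v : ℝ), u ∈ Ioo (j : ℝ) (j + 1) ∧ v ∈ Icc (j : ℝ) (j + 1) ∧
        ∀ s : I, H y s = arcPt g (v + s * (u - v)) ∧
          H y' s = arcPt g (mirror j (v + s * (u - v))) := by
    intro y y' hy h
    have hy' : y ∈ V := by rw [← hqV]; exact hy
    have h := hq.eq_iff.1 h
    rcases lt_or_eq_of_le (mem_closedBall_zero_iff.1 y.2) with h1 | h1
    · exact Or.inl (h.interior h1)
    · obtain ⟨i, hi⟩ := mem_iUnion.1 hy'
      obtain ⟨u, hu, rfl⟩ := hbd i y hi h1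
      obtain ⟨i', u', hu', rfl, h2⟩ := hsat i u hu _ h
      refine h2.imp id (Or.imp ?_ ?_)
      · rintro ⟨e, e'⟩
        refine ⟨fun s => ?_, fun s => ?_⟩
        · rw [hHarc i u hu, e]; simp
        · rw [hHarc i' u' hu', e']; simp
      · rintro ⟨j, hj, hvj, e, e'⟩
        refine ⟨j, u, v i, hj, hvj, fun s => ⟨hHarc i u hu s, ?_⟩⟩
        rw [hHarc i' u' hu', e, e']
        congr 1
        unfold mirror
        ring
  have hdesc : ∀ y y', q y ∈ q '' V → q y = q y' → ∀ s, q (H y s) = q (H y' s) := by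
    intro y y' hy h s
    rcases hrel y y' hy h with rfl | ⟨h1, h2⟩ | ⟨j, u, w, hu, hw, h1⟩
    · rfl
    · rw [h1, h2, h]
    · rw [(h1 s).1, (h1 s).2, hq.eq_iff]
      refine GlueRel.side' ?_
      exact (convex_Icc (j : ℝ) (j + 1)).add_smul_sub_mem hw (Ioo_subset_Icc_self hu) s.2
  have cH : ContinuousOn (Function.uncurry H) ((q ⁻¹' (q '' V)) ×ˢ univ) := by
    rintro ⟨x, s⟩ ⟨hx, -⟩
    rw [hqV] at hx
    obtain ⟨i, hi⟩ := mem_iUnion.1 hx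
    refine ContinuousAt.continuousWithinAt ?_
    refine (continuousAt_contr s hi.1).congr ?_
    have : ∀ᶠ z : PolygonDisk × I in 𝓝 (x, s), z.1 ∈ sec i :=
      continuousAt_fst.eventually_mem ((isOpen_sector _ _ _ _).mem_nhds hi)
    exact this.mono fun z hz => (hH i z.1 hz z.2).symm
  refine ⟨{
    O := q '' V
    isOpen := hO
    mem := ?_
    H := H
    h := fun x s => q (H (Function.surjInv hq.surjective x) s)
    contH := cH
    conth := ?_
    H_one := ?_
    H_zero := ?_
    H_self := ?_
    q_H := ?_ }, hrel⟩
  · obtain ⟨i⟩ := ‹Nonempty ι›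
    exact ⟨arcPt g (v i), mem_iUnion.2 ⟨i, harc i _ ⟨hlo i, hhi i⟩⟩, (hfib _).2 ⟨i, rfl⟩⟩
  · refine hq.isQuotientMap.continuousOn_prod hO ?_
    refine (hq.isQuotientMap.continuous.comp_continuousOn cH).congr ?_
    rintro ⟨y, s⟩ ⟨hy, -⟩
    exact (hdesc y _ hy (Function.surjInv_eq hq.surjective (q y)).symm s).symm
  · intro y hy
    have hy' : y ∈ V := by rw [← hqV]; exact hy
    obtain ⟨i, hi⟩ := mem_iUnion.1 hy'
    rw [hH i y hi]
    refine Subtype.ext ?_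
    simp only [contr]
    rw [Set.Icc.coe_one, Complex.ofReal_one, one_mul, Complex.exp_log (Complex.slitPlane_ne_zero hi.1),
      mul_div_cancel₀ _ (arc_ne_zero _ _)]
  · intro y hy
    have hy' : y ∈ V := by rw [← hqV]; exact hy
    obtain ⟨i, hi⟩ := mem_iUnion.1 hy'
    rw [hH i y hi]
    refine (hfib _).2 ⟨i, Subtype.ext ?_⟩
    simp [contr]
  · intro y hy s
    obtain ⟨i, rfl⟩ := (hfib y).1 hy
    rw [hHarc i _ ⟨hlo i, hhi i⟩]
    simp
  · intro y hy s
    exact hdesc y _ hy (Function.surjInv_eq hq.surjective (q y)).symm s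

theorem exists_coneNbhd (hq : IsPolygonQuotient g q) (hg : 1 ≤ g) (b : S) :
    ∃ N : ConeNbhd q b, ∀ y y', q y ∈ N.O → q y = q y' → TrackRel g N y y' := by
  obtain ⟨p, rfl⟩ := hq.surjective b
  rcases lt_or_eq_of_le (mem_closedBall_zero_iff.1 p.2) with h1 | h1
  · exact hq.exists_coneNbhd_interior p h1
  obtain ⟨w, rfl⟩ := exists_arcPt hg p h1
  rcases eq_or_lt_of_le (Int.floor_le w) with hw | hw
  -- At a corner the fibre consists of all corners, indexed by all integers (with repetition modulo
  -- `4 * g`); the radius `1 / 2` keeps different corners apart.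
  · refine hq.exists_coneNbhd_of_sectors hg _ (ι := ℤ) (fun i => i) (fun i => i - 1 / 2)
      (fun i => i + 1 / 2) (fun i => by linarith) (fun i => by linarith) (fun i => by linarith)
      ?_ ?_ ?_
    · intro i i' u u' hu hu' h
      obtain ⟨m, hm⟩ := (arcPt_eq_iff hg).1 h
      refine ⟨m, hm, ?_⟩
      have h1 : (i : ℝ) < (i' + m * (4 * g) + 1 : ℤ) := by push_cast; linarith [hu.1, hu'.2]
      have h2 : ((i' + m * (4 * g) : ℤ) : ℝ) < (i + 1 : ℤ) := by push_cast; linarith [hu.2, hu'.1]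
      have h1' := Int.cast_lt.1 h1
      have h2' := Int.cast_lt.1 h2
      have : i = i' + m * (4 * g) := by omega
      rw [this]
      push_cast
      ring
    · intro i u hu x hx
      rcases lt_trichotomy u i with h | h | h
      · have hu' : u ∈ Ioo ((i - 1 : ℤ) : ℝ) ((i - 1 : ℤ) + 1) := by
          push_cast
          exact ⟨by linarith [hu.1], by linarith⟩
        rcases (GlueRel.side_iff hg hu').1 hx with rfl | rfl
        · exact ⟨i, u, hu, rfl, Or.inl rfl⟩
        · refine ⟨partner (i - 1), _, ?_, rfl, Or.inr (Or.inr ⟨i - 1, hu', ?_, rfl, ?_⟩)⟩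
          · unfold mirror
            push_cast
            exact ⟨by linarith [hu.2], by linarith [hu.1]⟩
          · push_cast
            exact ⟨by linarith, by linarith⟩
          · unfold mirror
            push_cast
            ring
      · subst h
        obtain ⟨k, rfl⟩ := (GlueRel.corner_iff hg).1 hx
        exact ⟨k, k, ⟨by linarith, by linarith⟩, rfl, Or.inr (Or.inl ⟨rfl, rfl⟩)⟩
      · have hu' : u ∈ Ioo (i : ℝ) (i + 1) := ⟨h, by linarith [hu.2]⟩
        rcases (GlueRel.side_iff hg hu').1 hx with rfl | rfl
        · exact ⟨i, u, hu, rfl, Or.inl rfl⟩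
        · refine ⟨partner i + 1, _, ?_, rfl, Or.inr (Or.inr ⟨i, hu', ?_, rfl, ?_⟩)⟩
          · unfold mirror
            push_cast
            exact ⟨by linarith [hu.2], by linarith [hu.1]⟩
          · exact ⟨le_rfl, by linarith⟩
          · unfold mirror
            push_cast
            ring
    · intro y
      rw [eq_comm, hq.eq_iff, ← hw, GlueRel.corner_iff hg]
  · have hw' : w ∈ Ioo (⌊w⌋ : ℝ) (⌊w⌋ + 1) := ⟨hw, Int.lt_floor_add_one w⟩
    generalize ⌊w⌋ = j at hw'
    have hm := mirror_mem_Ioo hw'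
    -- For a point of an open side the fibre is the point and its mirror image, and the two whole
    -- open sides serve as angular ranges.
    refine hq.exists_coneNbhd_of_sectors hg _ (ι := Bool) (fun i => bif i then mirror j w else w)
      (fun i => bif i then partner j else j) (fun i => bif i then partner j + 1 else j + 1)
      ?_ ?_ ?_ ?_ ?_ ?_
    · rintro (_ | _)
      exacts [hw'.1, hm.1]
    · rintro (_ | _)
      exacts [hw'.2, hm.2]
    · rintro (_ | _) <;> simp
    · have hself : ∀ m : ℤ, ∀ k : ℤ, k = k + m * (4 * g) → (m : ℝ) * (4 * g) = 0 := by
        intro m k h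
        have : m * (4 * g) = 0 := by linarith
        exact_mod_cast this
      rintro (_ | _) (_ | _) u u' hu hu' h
      · obtain ⟨m, h1, h2⟩ := side_unique hg hu hu' h
        exact ⟨m, h1, by rw [hself m j h2, add_zero]⟩
      · obtain ⟨m, h1, h2⟩ := side_unique hg hu' hu h.symm
        exact absurd h2 (partner_ne g j m)
      · obtain ⟨m, h1, h2⟩ := side_unique hg hu hu' h
        exact absurd h2 (partner_ne g j m)
      · obtain ⟨m, h1, h2⟩ := side_unique hg hu hu' h
        exact ⟨m, h1, by rw [hself m _ h2, add_zero]⟩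
    · rintro (_ | _) u hu x hx
      · rcases (GlueRel.side_iff hg hu).1 hx with rfl | rfl
        · exact ⟨false, u, hu, rfl, Or.inl rfl⟩
        · exact ⟨true, _, mirror_mem_Ioo hu, rfl,
            Or.inr (Or.inr ⟨j, hu, Ioo_subset_Icc_self hw', rfl, rfl⟩)⟩
      · rcases (GlueRel.side_iff hg hu).1 hx with rfl | rfl
        · exact ⟨true, u, hu, rfl, Or.inl rfl⟩
        · refine ⟨false, _, ?_, rfl,
            Or.inr (Or.inr ⟨partner j, hu, Ioo_subset_Icc_self hm, rfl, (mirror_mirror j w).symm⟩)⟩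
          have := mirror_mem_Ioo hu
          rwa [partner_partner] at this
    · intro y
      rw [eq_comm, hq.eq_iff, GlueRel.side_iff hg hw']
      simp

end IsPolygonQuotient

/-! ### Potentials on the polygon -/

/-- The change of `d` under the gluing of the side `j`. -/
noncomputable def glueDefect (d : ℝ → ℝ → ℤ) (j : ℤ) (a b : ℝ) : ℤ := d (mirror j a) (mirror j b) - d a b

/-- The total defect of the `k`-th quadruple of sides. -/
noncomputable def quadDefect (d : ℝ → ℝ → ℤ) (k : ℤ) : ℤ :=
  glueDefect d (4 * k) (4 * k : ℤ) ((4 * k : ℤ) + 1) +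
    glueDefect d (4 * k + 1) (4 * k + 1 : ℤ) ((4 * k + 1 : ℤ) + 1)

open Classical in
/-- The potential on the polygon with values `u` on the corners and `A` on the open sides. -/
noncomputable def potential {K : Type*} [Group K] (g : ℕ) (u : ℤ → K) (A : ℤ → ℝ → K)
    (x : PolygonDisk) : K :=
  if h : ∃ i : ℤ, x = arcPt g i then u h.choose else
  if h : ∃ z : ℤ × ℝ, z.2 ∈ Ioo (z.1 : ℝ) (z.1 + 1) ∧ x = arcPt g z.2 then A h.choose.1 h.choose.2
  else 1

theorem potential_corner {K : Type*} [Group K] {g : ℕ} (hg : 1 ≤ g) {u : ℤ → K} {A : ℤ → ℝ → K}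
    (hu : ∀ i m : ℤ, u (i + m * (4 * g)) = u i) (i : ℤ) : potential g u A (arcPt g i) = u i := by
  have h : ∃ j : ℤ, arcPt g i = arcPt g j := ⟨i, rfl⟩
  rw [potential, dif_pos h]
  obtain ⟨m, hm⟩ := (arcPt_eq_iff hg).1 h.choose_spec
  have : i = h.choose + m * (4 * g) := by exact_mod_cast hm
  conv_rhs => rw [this, hu]

theorem potential_side {K : Type*} [Group K] {g : ℕ} (hg : 1 ≤ g) {u : ℤ → K} {A : ℤ → ℝ → K}
    (hA : ∀ (j m : ℤ) (s : ℝ), A (j + m * (4 * g)) (s + m * (4 * g)) = A j s) {j : ℤ} {s : ℝ}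
    (hs : s ∈ Ioo (j : ℝ) (j + 1)) : potential g u A (arcPt g s) = A j s := by
  have h : ∃ z : ℤ × ℝ, z.2 ∈ Ioo (z.1 : ℝ) (z.1 + 1) ∧ arcPt g s = arcPt g z.2 := ⟨(j, s), hs, rfl⟩
  rw [potential, dif_neg (fun ⟨i, hi⟩ => not_corner hg hs hi), dif_pos h]
  obtain ⟨m, h1, h2⟩ := side_unique hg hs h.choose_spec.1 h.choose_spec.2
  conv_rhs => rw [h1, h2, hA]

theorem int_mod_four (j : ℤ) : ∃ k, j = 4 * k ∨ j = 4 * k + 1 ∨ j = 4 * k + 2 ∨ j = 4 * k + 3 :=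
  ⟨j / 4, by omega⟩

/-- A potential that is compatible with the gluing of the sides, with prescribed jumps `α` and `β`
across the sides. -/
theorem exists_potential {K : Type*} [Group K] {g : ℕ} (hg : 1 ≤ g) (t : K) (ht : ∀ x, t * x = x * t)
    (d : ℝ → ℝ → ℤ)
    (hper : ∀ (m : ℤ) (a b : ℝ), d (a + m * (4 * g)) (b + m * (4 * g)) = d a b)
    (hd : ∀ (j : ℤ) (a b c : ℝ), a ∈ Icc (j : ℝ) (j + 1) → b ∈ Icc (j : ℝ) (j + 1) →
      c ∈ Icc (j : ℝ) (j + 1) → glueDefect d j a b + glueDefect d j b c = glueDefect d j a c)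
    (α β c : ℤ → K) (hα : ∀ k m : ℤ, α (k + m * g) = α k) (hβ : ∀ k m : ℤ, β (k + m * g) = β k)
    (hc : ∀ k m : ℤ, c (k + m * g) = c k)
    (hc' : ∀ k, c (k + 1) = c k * (α k * (β k)⁻¹ * (α k)⁻¹ * β k) * t ^ quadDefect d k) :
    ∃ U : PolygonDisk → K,
      (∀ (j : ℤ) (u v : ℝ), u ∈ Ioo (j : ℝ) (j + 1) → v ∈ Icc (j : ℝ) (j + 1) →
        U (arcPt g v) * (t ^ d v u)⁻¹ * (U (arcPt g u))⁻¹ =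
          U (arcPt g (mirror j v)) * (t ^ d (mirror j v) (mirror j u))⁻¹ *
            (U (arcPt g (mirror j u)))⁻¹) ∧
      (∀ (k : ℤ) (u : ℝ), u ∈ Ioo ((4 * k : ℤ) : ℝ) ((4 * k : ℤ) + 1) → U (arcPt g u) = 1 ∧
        U (arcPt g (mirror (4 * k) u)) = α k * (t ^ glueDefect d (4 * k) (4 * k : ℤ) u)⁻¹) ∧
      (∀ (k : ℤ) (u : ℝ), u ∈ Ioo ((4 * k + 1 : ℤ) : ℝ) ((4 * k + 1 : ℤ) + 1) →
        U (arcPt g u) = 1 ∧ U (arcPt g (mirror (4 * k + 1) u)) =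
          β k * (t ^ glueDefect d (4 * k + 1) (4 * k + 1 : ℤ) u)⁻¹) := by
  have htz : ∀ (n : ℤ) (x : K), t ^ n * x = x * t ^ n := fun n x =>
    ((show Commute t x from ht x).zpow_left n)
  have hti : ∀ (n : ℤ) (x : K), (t ^ n)⁻¹ * x = x * (t ^ n)⁻¹ := fun n x => by
    rw [← zpow_neg]; exact htz _ x
  have hgd : ∀ (m j : ℤ) (a b : ℝ), glueDefect d (j + m * (4 * g)) (a + m * (4 * g))
      (b + m * (4 * g)) = glueDefect d j a b := by
    intro m j a b
    unfold glueDefect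
    have e : ∀ s, mirror (j + m * (4 * g)) (s + m * (4 * g)) = mirror j s + m * (4 * g) := by
      intro s
      unfold mirror
      rw [partner_add]
      push_cast
      ring
    rw [e, e, hper, hper]
  let n0 : ℤ → ℤ := fun k => glueDefect d (4 * k) (4 * k : ℤ) ((4 * k : ℤ) + 1)
  let n1 : ℤ → ℤ := fun k => glueDefect d (4 * k + 1) (4 * k + 1 : ℤ) ((4 * k + 1 : ℤ) + 1)
  -- The corner values are forced by the jumps: side `4k` relates `4k` to `4k+3` and `4k+1` to
  -- `4k+2`, and side `4k+1` relates `4k+2` to `4k+3` and `4k+1` to `4k+4`. The value thus reached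
  -- at `4k+4` is the right side of `hc'`.
  let u : ℤ → K := fun i => if i % 4 = 0 then c (i / 4) else
    if i % 4 = 1 then c (i / 4) * α (i / 4) * (β (i / 4))⁻¹ * (α (i / 4))⁻¹ *
      t ^ n0 (i / 4) * t ^ n1 (i / 4) else
    if i % 4 = 2 then c (i / 4) * α (i / 4) * (β (i / 4))⁻¹ * t ^ n1 (i / 4) else c (i / 4) * α (i / 4)
  -- The potential is normalised to `1` on the first side of each glued pair, so the whole jump,
  -- corrected by the defect of `d`, sits on the second.
  let A : ℤ → ℝ → K := fun j s => if j % 4 < 2 then 1 else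
    (if j % 4 = 2 then α (j / 4) else β (j / 4)) * (t ^ glueDefect d (j - 2) (j - 2 : ℤ) (mirror j s))⁻¹
  have hdiv : ∀ i m : ℤ, (i + m * (4 * g)) / 4 = i / 4 + m * g := by
    intro i m
    rw [show i + m * (4 * (g : ℤ)) = i + m * g * 4 by ring, Int.add_mul_ediv_right _ _ (by norm_num)]
  have hmod : ∀ i m : ℤ, (i + m * (4 * g)) % 4 = i % 4 := by
    intro i m
    rw [show i + m * (4 * (g : ℤ)) = i + m * g * 4 by ring, Int.add_mul_emod_self_right]
  have hn0 : ∀ k m : ℤ, n0 (k + m * g) = n0 k := by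
    intro k m
    simp only [n0]
    rw [← hgd m (4 * k)]
    congr 1 <;> push_cast <;> ring
  have hn1 : ∀ k m : ℤ, n1 (k + m * g) = n1 k := by
    intro k m
    simp only [n1]
    rw [← hgd m (4 * k + 1)]
    congr 1 <;> push_cast <;> ring
  have hu : ∀ i m : ℤ, u (i + m * (4 * g)) = u i := by
    intro i m
    simp only [u, hdiv, hmod, hα, hβ, hc, hn0, hn1]
  have hA : ∀ (j m : ℤ) (s : ℝ), A (j + m * (4 * g)) (s + m * (4 * g)) = A j s := by
    intro j m s
    simp only [A, hdiv, hmod, hα, hβ]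
    have : glueDefect d (j + m * (4 * g) - 2) ((j + m * (4 * g) - 2 : ℤ) : ℝ)
        (mirror (j + m * (4 * g)) (s + m * (4 * g))) =
        glueDefect d (j - 2) ((j - 2 : ℤ) : ℝ) (mirror j s) := by
      rw [← hgd m (j - 2)]
      unfold mirror
      rw [partner_add]
      congr 1 <;> push_cast <;> ring
    rw [this]
  have U0 := fun i => potential_corner hg (A := A) hu i
  have U1 := fun (j : ℤ) (s : ℝ) (hs : s ∈ Ioo (j : ℝ) (j + 1)) => potential_side hg (u := u) hA hs
  have hA01 : ∀ j s, j % 4 < 2 → A j s = 1 := fun j s h => if_pos h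
  have hA2 : ∀ k s, A (4 * k + 2) s = α k * (t ^ glueDefect d (4 * k) (4 * k : ℤ)
      (mirror (4 * k + 2) s))⁻¹ := by
    intro k s
    simp only [A]
    rw [if_neg (by omega), if_pos (by omega), show (4 * k + 2) / 4 = k by omega,
      show 4 * k + 2 - 2 = 4 * k by ring]
  have hA3 : ∀ k s, A (4 * k + 3) s = β k * (t ^ glueDefect d (4 * k + 1) (4 * k + 1 : ℤ)
      (mirror (4 * k + 3) s))⁻¹ := by
    intro k s
    simp only [A]
    rw [if_neg (by omega), if_neg (by omega), show (4 * k + 3) / 4 = k by omega,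
      show 4 * k + 3 - 2 = 4 * k + 1 by ring]
  have hu0 : ∀ k, u (4 * k) = c k := by
    intro k
    simp only [u]
    rw [if_pos (by omega), show 4 * k / 4 = k by omega]
  have hu1 : ∀ k, u (4 * k + 1) = c k * α k * (β k)⁻¹ * (α k)⁻¹ * t ^ n0 k * t ^ n1 k := by
    intro k
    simp only [u]
    rw [if_neg (by omega), if_pos (by omega), show (4 * k + 1) / 4 = k by omega]
  have hu2 : ∀ k, u (4 * k + 2) = c k * α k * (β k)⁻¹ * t ^ n1 k := by
    intro k
    simp only [u]
    rw [if_neg (by omega), if_neg (by omega), if_pos (by omega), show (4 * k + 2) / 4 = k by omega]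
  have hu3 : ∀ k, u (4 * k + 3) = c k * α k := by
    intro k
    simp only [u]
    rw [if_neg (by omega), if_neg (by omega), if_neg (by omega), show (4 * k + 3) / 4 = k by omega]
  have hu4 : ∀ k, u (4 * k + 4) = c k * (α k * (β k)⁻¹ * (α k)⁻¹ * β k) * t ^ n0 k * t ^ n1 k := by
    intro k
    rw [show 4 * k + 4 = 4 * (k + 1) by ring, hu0, hc', mul_assoc _ (t ^ n0 k), ← zpow_add]
    rfl
  have hp0 : ∀ k, partner (4 * k) = 4 * k + 2 := fun k => by unfold partner; split_ifs <;> omega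
  have hp1 : ∀ k, partner (4 * k + 1) = 4 * k + 3 := fun k => by unfold partner; split_ifs <;> omega
  have hm : ∀ (j : ℤ) (s : ℝ), mirror (partner j) (mirror j s) = s := mirror_mirror
  let U := potential g u A
  -- the values on the sides and on their mirror images
  have side0 : ∀ (k : ℤ) (s : ℝ), s ∈ Ioo ((4 * k : ℤ) : ℝ) ((4 * k : ℤ) + 1) →
      U (arcPt g s) = 1 ∧
        U (arcPt g (mirror (4 * k) s)) = α k * (t ^ glueDefect d (4 * k) (4 * k : ℤ) s)⁻¹ := by
    intro k s hs
    refine ⟨(U1 _ s hs).trans (hA01 _ _ (by omega)), ?_⟩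
    have h := U1 _ _ (mirror_mem_Ioo hs)
    refine h.trans ?_
    rw [hp0, hA2, ← hp0, hm]
  have side1 : ∀ (k : ℤ) (s : ℝ), s ∈ Ioo ((4 * k + 1 : ℤ) : ℝ) ((4 * k + 1 : ℤ) + 1) →
      U (arcPt g s) = 1 ∧ U (arcPt g (mirror (4 * k + 1) s)) =
        β k * (t ^ glueDefect d (4 * k + 1) (4 * k + 1 : ℤ) s)⁻¹ := by
    intro k s hs
    refine ⟨(U1 _ s hs).trans (hA01 _ _ (by omega)), ?_⟩
    have h := U1 _ _ (mirror_mem_Ioo hs)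
    refine h.trans ?_
    rw [hp1, hA3, ← hp1, hm]
  -- a common form of the compatibility on the sides of either type
  have core : ∀ (j : ℤ) (a : K)
      (_ : ∀ s ∈ Ioo (j : ℝ) (j + 1), U (arcPt g s) = 1 ∧
        U (arcPt g (mirror j s)) = a * (t ^ glueDefect d j j s)⁻¹)
      (_ : U (arcPt g (mirror j j)) = U (arcPt g j) * a)
      (_ : U (arcPt g (mirror j (j + 1))) =
        U (arcPt g (j + 1)) * a * (t ^ glueDefect d j j (j + 1))⁻¹)
      (u v : ℝ), u ∈ Ioo (j : ℝ) (j + 1) → v ∈ Icc (j : ℝ) (j + 1) →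
        U (arcPt g v) * (t ^ d v u)⁻¹ * (U (arcPt g u))⁻¹ =
          U (arcPt g (mirror j v)) * (t ^ d (mirror j v) (mirror j u))⁻¹ *
            (U (arcPt g (mirror j u)))⁻¹ := by
    intro j a h1 h2 h3 u v hu hv
    have hjj : (j : ℝ) ∈ Icc (j : ℝ) (j + 1) := ⟨le_rfl, by linarith⟩
    have hv' : U (arcPt g (mirror j v)) = U (arcPt g v) * a * (t ^ glueDefect d j j v)⁻¹ := by
      rcases eq_or_lt_of_le hv.1 with h | h
      · have h0 : glueDefect d j j j = 0 := by
          have := hd j j j j hjj hjj hjj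
          omega
        rw [← h, h2, h0, zpow_zero, inv_one, mul_one]
      rcases eq_or_lt_of_le hv.2 with h' | h'
      · rw [h', h3]
      · rw [(h1 v ⟨h, h'⟩).1, (h1 v ⟨h, h'⟩).2, one_mul]
    rw [hv', (h1 u hu).1, (h1 u hu).2]
    have hsum := hd j j v u hjj hv (Ioo_subset_Icc_self hu)
    have hdd : d (mirror j v) (mirror j u) = glueDefect d j v u + d v u := by
      unfold glueDefect; ring
    rw [hdd, ← hsum]
    simp only [mul_inv_rev, inv_one, mul_one, ← zpow_neg]
    rw [mul_assoc (_ * a), ← zpow_add, mul_assoc (_ * a), ← mul_assoc (t ^ _) (t ^ _), ← zpow_add,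
      htz, ← mul_assoc, mul_inv_cancel_right]
    congr 2
    ring
  -- Since `mirror` is an involution, compatibility on a side is also compatibility on its partner.
  have swap : ∀ (j : ℤ), (∀ (u v : ℝ), u ∈ Ioo (j : ℝ) (j + 1) → v ∈ Icc (j : ℝ) (j + 1) →
        U (arcPt g v) * (t ^ d v u)⁻¹ * (U (arcPt g u))⁻¹ =
          U (arcPt g (mirror j v)) * (t ^ d (mirror j v) (mirror j u))⁻¹ *
            (U (arcPt g (mirror j u)))⁻¹) →
      ∀ (u v : ℝ), u ∈ Ioo (partner j : ℝ) (partner j + 1) →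
        v ∈ Icc (partner j : ℝ) (partner j + 1) →
        U (arcPt g v) * (t ^ d v u)⁻¹ * (U (arcPt g u))⁻¹ =
          U (arcPt g (mirror (partner j) v)) * (t ^ d (mirror (partner j) v)
            (mirror (partner j) u))⁻¹ * (U (arcPt g (mirror (partner j) u)))⁻¹ := by
    intro j h u v hu hv
    have hu' := mirror_mem_Ioo hu
    have hv' := mirror_mem_Icc hv
    rw [partner_partner] at hu' hv'
    have := h _ _ hu' hv'
    have hmm : ∀ s, mirror j (mirror (partner j) s) = s := by
      intro s
      have := hm (partner j) s
      rwa [partner_partner] at this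
    rw [hmm, hmm] at this
    exact this.symm
  have c0 : ∀ k : ℤ, _ := fun k => core (4 * k) (α k) (side0 k) (by
      have h1 : U (arcPt g (mirror (4 * k) (4 * k : ℤ))) = u (4 * k + 3) := by
        rw [← U0]
        congr 2
        unfold mirror
        rw [hp0]
        push_cast
        ring
      rw [h1, hu3, show U (arcPt g ((4 * k : ℤ) : ℝ)) = u (4 * k) from U0 _, hu0]) (by
      have h1 : U (arcPt g (mirror (4 * k) ((4 * k : ℤ) + 1))) = u (4 * k + 2) := by
        rw [← U0]
        congr 2
        unfold mirror
        rw [hp0]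
        push_cast
        ring
      have h2 : U (arcPt g (((4 * k : ℤ) : ℝ) + 1)) = u (4 * k + 1) := by
        rw [← U0]
        congr 2
        push_cast
        ring
      rw [h1, h2, hu1, hu2]
      change _ = _ * _ * (t ^ n0 k)⁻¹
      rw [mul_assoc _ (t ^ n0 k), ← zpow_add, mul_assoc _ (t ^ _), htz, ← mul_assoc,
        inv_mul_cancel_right, mul_assoc _ (t ^ _), ← zpow_neg, ← zpow_add]
      congr 2
      ring)
  have c1 : ∀ k : ℤ, _ := fun k => core (4 * k + 1) (β k) (side1 k) (by
      have h1 : U (arcPt g (mirror (4 * k + 1) (4 * k + 1 : ℤ))) = u (4 * k + 4) := by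
        rw [← U0]
        congr 2
        unfold mirror
        rw [hp1]
        push_cast
        ring
      rw [h1, hu4, show U (arcPt g ((4 * k + 1 : ℤ) : ℝ)) = u (4 * k + 1) from U0 _, hu1,
        mul_assoc _ (t ^ n0 k), mul_assoc _ (t ^ n0 k), ← zpow_add, mul_assoc _ (t ^ _), htz]
      simp only [mul_assoc]) (by
      have h1 : U (arcPt g (mirror (4 * k + 1) ((4 * k + 1 : ℤ) + 1))) = u (4 * k + 3) := by
        rw [← U0]
        congr 2
        unfold mirror
        rw [hp1]
        push_cast
        ring
      have h2 : U (arcPt g (((4 * k + 1 : ℤ) : ℝ) + 1)) = u (4 * k + 2) := by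
        rw [← U0]
        congr 2
        push_cast
        ring
      rw [h1, h2, hu2, hu3]
      change _ = _ * _ * (t ^ n1 k)⁻¹
      rw [mul_assoc _ (t ^ n1 k), htz, ← mul_assoc, inv_mul_cancel_right, mul_inv_cancel_right])
  refine ⟨U, fun j u v hu hv => ?_, side0, side1⟩
  obtain ⟨k, rfl | rfl | rfl | rfl⟩ := int_mod_four j
  · exact c0 k u v hu hv
  · exact c1 k u v hu hv
  · rw [← hp0] at hu hv ⊢
    exact swap _ (c0 k) u v hu hv
  · rw [← hp1] at hu hv ⊢
    exact swap _ (c1 k) u v hu hv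

theorem quadDefect_add {g : ℕ} {d : ℝ → ℝ → ℤ}
    (hper : ∀ (m : ℤ) (a b : ℝ), d (a + m * (4 * g)) (b + m * (4 * g)) = d a b) (k m : ℤ) :
    quadDefect d (k + m * g) = quadDefect d k := by
  have hgd : ∀ (j : ℤ) (a b : ℝ), glueDefect d (j + m * (4 * g)) (a + m * (4 * g))
      (b + m * (4 * g)) = glueDefect d j a b := by
    intro j a b
    unfold glueDefect
    have e : ∀ s, mirror (j + m * (4 * g)) (s + m * (4 * g)) = mirror j s + m * (4 * g) := by
      intro s
      unfold mirror
      rw [partner_add]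
      push_cast
      ring
    rw [e, e, hper, hper]
  unfold quadDefect
  rw [← hgd (4 * k), ← hgd (4 * k + 1)]
  congr 2 <;> push_cast <;> ring

/-- The existence of a potential, with the closing condition in the form of a product. -/
theorem exists_potential_of_prod {K : Type*} [Group K] {g : ℕ} (hg : 1 ≤ g) (t : K)
    (ht : ∀ x, t * x = x * t) (d : ℝ → ℝ → ℤ)
    (hper : ∀ (m : ℤ) (a b : ℝ), d (a + m * (4 * g)) (b + m * (4 * g)) = d a b)
    (hd : ∀ (j : ℤ) (a b c : ℝ), a ∈ Icc (j : ℝ) (j + 1) → b ∈ Icc (j : ℝ) (j + 1) →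
      c ∈ Icc (j : ℝ) (j + 1) → glueDefect d j a b + glueDefect d j b c = glueDefect d j a c)
    (α β : ℕ → K) (hprod : ((List.range g).map fun k =>
      α k * (β k)⁻¹ * (α k)⁻¹ * β k * t ^ quadDefect d k).prod = 1) :
    ∃ U : PolygonDisk → K,
      (∀ (j : ℤ) (u v : ℝ), u ∈ Ioo (j : ℝ) (j + 1) → v ∈ Icc (j : ℝ) (j + 1) →
        U (arcPt g v) * (t ^ d v u)⁻¹ * (U (arcPt g u))⁻¹ =
          U (arcPt g (mirror j v)) * (t ^ d (mirror j v) (mirror j u))⁻¹ *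
            (U (arcPt g (mirror j u)))⁻¹) ∧
      (∀ k < g, ∀ u : ℝ, u ∈ Ioo ((4 * k : ℤ) : ℝ) ((4 * k : ℤ) + 1) → U (arcPt g u) = 1 ∧
        U (arcPt g (mirror (4 * k) u)) = α k * (t ^ glueDefect d (4 * k) (4 * k : ℤ) u)⁻¹) ∧
      (∀ k < g, ∀ u : ℝ, u ∈ Ioo ((4 * k + 1 : ℤ) : ℝ) ((4 * k + 1 : ℤ) + 1) →
        U (arcPt g u) = 1 ∧ U (arcPt g (mirror (4 * k + 1) u)) =
          β k * (t ^ glueDefect d (4 * k + 1) (4 * k + 1 : ℤ) u)⁻¹) := by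
  have hg0 : (0 : ℤ) < g := by exact_mod_cast hg
  let r : ℤ → ℕ := fun k => (k % g).toNat
  have hr : ∀ k m, r (k + m * g) = r k := fun k m => by simp [r, Int.add_mul_emod_self_right]
  have hr' : ∀ k < g, r (k : ℤ) = k := by
    intro k hk
    simp only [r]
    rw [Int.emod_eq_of_lt (by positivity) (by exact_mod_cast hk)]
    simp
  have hrlt : ∀ k, r k < g := by
    intro k
    have := Int.emod_lt_of_pos k hg0
    have := Int.emod_nonneg k hg0.ne'
    simp only [r]; omega
  have hrk : ∀ k : ℤ, ∃ m : ℤ, k = r k + m * g := by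
    intro k
    refine ⟨k / g, ?_⟩
    have := Int.emod_nonneg k hg0.ne'
    have h2 := Int.emod_add_mul_ediv k g
    simp only [r]
    rw [Int.toNat_of_nonneg this]
    linarith
  let f : ℕ → K := fun k => α k * (β k)⁻¹ * (α k)⁻¹ * β k * t ^ quadDefect d k
  -- `c k` is the product over the blocks before `k mod g`; `hprod` is needed only for the return
  -- from the block `g - 1` to the block `0`.
  obtain ⟨U, h1, h2, h3⟩ := exists_potential hg t ht d hper hd (fun k => α (r k)) (fun k => β (r k))
    (fun k => ((List.range (r k)).map f).prod) (fun k m => by rw [hr]) (fun k m => by rw [hr])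
    (fun k m => by rw [hr]) (by
      intro k
      have hq : quadDefect d k = quadDefect d (r k) := by
        obtain ⟨m, hm⟩ := hrk k
        conv_lhs => rw [hm]
        exact quadDefect_add hper _ _
      rw [hq, mul_assoc]
      change _ = _ * f (r k)
      have h0 : ((List.range (r k + 1)).map f).prod = ((List.range (r k)).map f).prod * f (r k) := by
        rw [List.range_succ, List.map_append, List.prod_append]
        simp
      rw [← h0]
      obtain ⟨m, hm⟩ := hrk k
      rcases lt_or_eq_of_le (Nat.succ_le_of_lt (hrlt k)) with h | h
      · have : r (k + 1) = r k + 1 := by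
          conv_lhs => rw [hm, show (r k : ℤ) + m * g + 1 = ((r k + 1 : ℕ) : ℤ) + m * g by
            push_cast; ring, hr, hr' _ h]
        rw [this]
      · have : r (k + 1) = 0 := by
          conv_lhs => rw [hm, show (r k : ℤ) + m * g + 1 = ((r k + 1 : ℕ) : ℤ) + m * g by
            push_cast; ring, hr]
          rw [show r k + 1 = g from h]
          simp [r]
        rw [this, show r k + 1 = g from h]
        exact hprod.symm)
  refine ⟨U, h1, fun k hk u hu => ?_, fun k hk u hu => ?_⟩
  · have := h2 k u hu
    rwa [hr' k hk] at this
  · have := h3 k u hu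
    rwa [hr' k hk] at this

/-! ### Tautological functors -/

namespace PathFunctor

variable {X Y K : Type*} [TopologicalSpace X] [TopologicalSpace Y] [Group K]

/-- The pullback of a functor along a map. -/
def comap (F : PathFunctor X K) (f : C(Y, X)) : PathFunctor Y K where
  val p := F.val (p.map f)
  map_trans p q := by
    rw [← F.map_trans]
    congr 1
    induction p, q using Path.Homotopic.Quotient.ind₂ with
    | mk γ γ' =>
      rw [← Path.Homotopic.Quotient.mk_trans, ← Path.Homotopic.Quotient.mk_map, Path.map_trans]
      rfl

theorem path_comap (F : PathFunctor X K) (f : C(Y, X)) {x y : Y} (γ : Path x y) :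
    F.path (γ.map f.continuous) = (F.comap f).path γ := rfl

/-- The normalisation at `x₀` makes the tautological functor send a loop at `x₀` to the inverse of
its class, without conjugation. -/
theorem exists_tail [PathConnectedSpace X] (x₀ : X) :
    ∃ T : ∀ x, Path.Homotopic.Quotient x₀ x, T x₀ = .refl x₀ := by
  classical
  refine ⟨fun x => if h : x₀ = x then h ▸ .refl x₀ else
    .mk (PathConnectedSpace.somePath x₀ x), ?_⟩
  simp

/-- The functor that sends a path to the class of the loop obtained from it by adding standard
paths to the base point. -/
noncomputable def tautological [PathConnectedSpace X] (x₀ : X) :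
    PathFunctor X (FundamentalGroup X x₀) where
  val {x y} p := (show FundamentalGroup X x₀ from
    (((exists_tail x₀).choose x).trans p).trans ((exists_tail x₀).choose y).symm)⁻¹
  map_trans {x y z} p q := by
    rw [← mul_inv_rev]
    congr 1
    rw [FundamentalGroup.mul_def]
    simp only [Path.Homotopic.Quotient.trans_assoc]
    rw [← Path.Homotopic.Quotient.trans_assoc (Path.Homotopic.Quotient.symm _),
      Path.Homotopic.Quotient.symm_trans, Path.Homotopic.Quotient.refl_trans]

theorem tautological_val [PathConnectedSpace X] (x₀ : X) (p : FundamentalGroup X x₀) :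
    (tautological x₀).val p = p⁻¹ := by
  change (show FundamentalGroup X x₀ from _)⁻¹ = _
  rw [(exists_tail x₀).choose_spec]
  congr 1
  rw [Path.Homotopic.Quotient.refl_trans, ← FundamentalGroup.one_def, ← FundamentalGroup.inv_def,
    inv_one, FundamentalGroup.one_def]
  exact Path.Homotopic.Quotient.trans_refl _

/-- Every functor factors through the tautological one up to a gauge transformation; the gauge `a`
consists of its values on the tails. -/
theorem exists_hom_tautological [PathConnectedSpace X] (x₀ : X) (Φ : PathFunctor X K) :
    ∃ a : X → K, a x₀ = 1 ∧ ∀ {x y : X} (p : Path.Homotopic.Quotient x y),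
      Φ.hom x₀ ((tautological x₀).val p) = a x * Φ.val p * (a y)⁻¹ := by
  refine ⟨fun x => Φ.val ((exists_tail x₀).choose x), ?_, fun {x y} p => ?_⟩
  · change Φ.val _ = 1
    rw [(exists_tail x₀).choose_spec, Φ.map_refl]
  · change Φ.hom x₀ ((show FundamentalGroup X x₀ from _)⁻¹) = _
    rw [map_inv]
    change ((Φ.val _)⁻¹)⁻¹ = _
    rw [inv_inv, Φ.map_trans, Φ.map_trans, Φ.map_symm]

theorem val_eq_one_of_simplyConnected [SimplyConnectedSpace X] (F : PathFunctor X K) {x : X}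
    (p : Path.Homotopic.Quotient x x) : F.val p = 1 := by
  rw [Subsingleton.elim p (.refl x), F.map_refl]

/-- On a simply connected space, a functor is the coboundary of a function. -/
theorem exists_coboundary [SimplyConnectedSpace X] (F : PathFunctor X K) (x₀ : X) :
    ∃ δ : X → K, δ x₀ = 1 ∧ (∀ x (p : Path.Homotopic.Quotient x₀ x), F.val p = δ x) ∧
      ∀ {x y : X} (p : Path.Homotopic.Quotient x y), F.val p = (δ x)⁻¹ * δ y := by
  refine ⟨fun x => F.val (.mk (PathConnectedSpace.somePath x₀ x)), ?_, fun x p => ?_,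
    fun {x y} p => ?_⟩
  · exact F.val_eq_one_of_simplyConnected _
  · rw [Subsingleton.elim p]
  · rw [eq_inv_mul_iff_mul_eq, ← F.map_trans]
    congr 1
    exact Subsingleton.elim _ _

end PathFunctor

/-! ### The fundamental group of the glued polygon -/

instance : SimplyConnectedSpace PolygonDisk := by
  have : ContractibleSpace PolygonDisk :=
    (convex_closedBall (0 : ℂ) 1).contractibleSpace ⟨0, by simp⟩
  infer_instance

/-- The path on the boundary of the polygon from the parameter `a` to the parameter `b`. -/
noncomputable def arcPath (g : ℕ) (a b : ℝ) : Path (arcPt g a) (arcPt g b) where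
  toFun s := arcPt g (a + s * (b - a))
  continuous_toFun := (continuous_arcPt g).comp (by fun_prop)
  source' := by simp
  target' := by simp

@[simp] theorem arcPath_apply (g : ℕ) (a b : ℝ) (s : I) :
    arcPath g a b s = arcPt g (a + s * (b - a)) := rfl

theorem add_mul_sub_mem_Icc {j : ℤ} {a b : ℝ} (ha : a ∈ Icc (j : ℝ) (j + 1))
    (hb : b ∈ Icc (j : ℝ) (j + 1)) (s : I) : a + s * (b - a) ∈ Icc (j : ℝ) (j + 1) := by
  obtain ⟨s, h0, h1⟩ := s
  have := (convex_Icc (j : ℝ) (j + 1)) ha hb (a := 1 - s) (b := s) (by linarith) h0 (by ring)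
  simp only [smul_eq_mul] at this
  rwa [show (1 - s) * a + s * b = a + s * (b - a) by ring] at this

theorem mirror_line (j : ℤ) (a b s : ℝ) :
    mirror j (a + s * (b - a)) = mirror j a + s * (mirror j b - mirror j a) := by
  unfold mirror; ring

namespace IsPolygonQuotient

variable {S : Type*} [TopologicalSpace S] {g : ℕ} {q : C(PolygonDisk, S)}

/-- The fibres of `q` are countable, and a countable connected subset of the disk has at most one
point. -/
theorem fibre_path (hq : IsPolygonQuotient g q) (hg : 1 ≤ g) (γ : C(I, PolygonDisk))
    (h : ∀ t, q (γ t) = q (γ 0)) (t : I) : γ t = γ 0 := by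
  have hc : (range γ).Countable := by
    have hsub : ∀ x, {y | GlueRel g x y}.Countable := by
      intro x
      rcases lt_or_eq_of_le (mem_closedBall_zero_iff.1 x.2) with h1 | h1
      · exact (countable_singleton x).mono fun y hy => (GlueRel.interior hy h1).symm
      obtain ⟨w, rfl⟩ := exists_arcPt hg x h1
      rcases eq_or_lt_of_le (Int.floor_le w) with hw | hw
      · rw [← hw]
        refine (countable_range fun i : ℤ => arcPt g i).mono fun y hy => ?_
        obtain ⟨i, rfl⟩ := (GlueRel.corner_iff hg).1 hy
        exact ⟨i, rfl⟩
      · refine ((countable_singleton (arcPt g (mirror ⌊w⌋ w))).insert (arcPt g w)).mono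
          fun y hy => ?_
        exact (GlueRel.side_iff hg ⟨hw, Int.lt_floor_add_one w⟩).1 hy
    refine (hsub (γ 0)).mono ?_
    rintro _ ⟨s, rfl⟩
    exact hq.eq_iff.1 (h s).symm
  have hp : IsPreconnected (range γ) := isPreconnected_range γ.continuous
  exact hc.isTotallyDisconnected _ Subset.rfl hp ⟨t, rfl⟩ ⟨0, rfl⟩

theorem pathConnectedSpace (hq : IsPolygonQuotient g q) : PathConnectedSpace S :=
  hq.surjective.pathConnectedSpace q.continuous

/-- A functor on the surface takes the same value on the two images of a path in a side. -/
theorem path_mirror (hq : IsPolygonQuotient g q) {K : Type*} [Group K] (F : PathFunctor S K)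
    {j : ℤ} {a b : ℝ} (ha : a ∈ Icc (j : ℝ) (j + 1)) (hb : b ∈ Icc (j : ℝ) (j + 1)) :
    (F.comap q).path (arcPath g a b) = (F.comap q).path (arcPath g (mirror j a) (mirror j b)) := by
  rw [← F.path_comap, ← F.path_comap]
  refine F.path_eq_of_coe fun s => ?_
  simp only [Path.map_coe, Function.comp_apply, arcPath_apply]
  rw [← mirror_line]
  exact hq.eq_iff.2 (GlueRel.side' (add_mul_sub_mem_Icc ha hb s))

/-- Functors on the surface from potentials on the polygon. -/
theorem exists_pathFunctor (hq : IsPolygonQuotient g q) (hg : 1 ≤ g) {K : Type*} [Group K]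
    (U : PolygonDisk → K)
    (hU : ∀ (j : ℤ) (u v : ℝ), u ∈ Ioo (j : ℝ) (j + 1) → v ∈ Icc (j : ℝ) (j + 1) →
        U (arcPt g v) * (U (arcPt g u))⁻¹ =
          U (arcPt g (mirror j v)) * (U (arcPt g (mirror j u)))⁻¹) :
    ∃ F : PathFunctor S K, ∀ {y y' : PolygonDisk} (p : Path.Homotopic.Quotient y y'),
      F.val (p.map q) = U y * (U y')⁻¹ := by
  choose N hN using hq.exists_coneNbhd hg
  obtain ⟨F, hF⟩ := exists_pathFunctor_of_coneNbhd q hq.surjective N (hq.fibre_path hg)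
    (PathFunctor.trivial _ K) U (by
      intro b y y' hy hy' h
      change _ * 1 * _ = _ * 1 * _
      rw [mul_one, mul_one]
      rcases hN b y y' hy h with rfl | ⟨h1, h2⟩ | ⟨j, u, v, hu, hv, hs⟩
      · rfl
      · rw [h1, h2, mul_inv_cancel, mul_inv_cancel]
      · have h0 := hs 0
        have h1 := hs 1
        rw [(N b).H_one y hy, (N b).H_one y' hy'] at h1
        simp only [Icc.coe_zero, Icc.coe_one, zero_mul, one_mul, add_zero,
          add_sub_cancel] at h0 h1
        rw [h0.1, h0.2, h1.1, h1.2, hU j u v hu hv])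
  refine ⟨F, fun p => ?_⟩
  rw [hF]
  change _ * 1 * _ = _
  rw [mul_one]

/-- The presentation of the fundamental group of the surface. -/
theorem exists_presentation.{v} {S : Type*} [TopologicalSpace S] {g : ℕ} {q : C(PolygonDisk, S)}
    (hq : IsPolygonQuotient g q) (hg : 1 ≤ g) (y₀ : PolygonDisk) :
    ∃ P Q : ℕ → FundamentalGroup S (q y₀),
      Subgroup.closure (P '' Iio g ∪ Q '' Iio g) = ⊤ ∧
      ((List.range g).map fun k => P k * (Q k)⁻¹ * (P k)⁻¹ * Q k).prod = 1 ∧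
      ∀ (K : Type v) [Group K] (α β : ℕ → K),
        ((List.range g).map fun k => α k * (β k)⁻¹ * (α k)⁻¹ * β k).prod = 1 →
        ∃ θ : FundamentalGroup S (q y₀) →* K, ∀ k < g, θ (P k) = α k ∧ θ (Q k) = β k := by
  have := hq.pathConnectedSpace
  let Γ := FundamentalGroup S (q y₀)
  let F : PathFunctor S Γ := PathFunctor.tautological (q y₀)
  obtain ⟨δ, hδ0, hδ1, hδ2⟩ := (F.comap q).exists_coboundary y₀
  let D : ℝ → Γ := fun u => δ (arcPt g u)
  have hDper : ∀ (u : ℝ) (m : ℤ), D (u + m * (4 * g)) = D u := by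
    intro u m
    exact congrArg δ ((arcPt_eq_iff hg).2 ⟨m, rfl⟩)
  -- The jump of the primitive `δ` across the side `j`. It is constant along the side (`hE`) because
  -- the functor comes from the surface; the jumps of the sides `4k` and `4k+1` are the generators.
  let E : ℤ → Γ := fun j => D j * (D (mirror j j))⁻¹
  have hE : ∀ (j : ℤ) (u : ℝ), u ∈ Icc (j : ℝ) (j + 1) → D u * (D (mirror j u))⁻¹ = E j := by
    intro j u hu
    have h := hq.path_mirror F (a := j) ⟨le_rfl, by linarith⟩ hu
    rw [PathFunctor.path, PathFunctor.path, hδ2, hδ2] at h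
    change (D _)⁻¹ * D _ = (D _)⁻¹ * D _ at h
    simp only [E]
    rw [inv_mul_eq_iff_eq_mul] at h
    rw [h]
    group
  have hEp : ∀ j, E (partner j) = (E j)⁻¹ := by
    intro j
    rw [← hE j (j + 1) ⟨by linarith, le_rfl⟩]
    have h1 : mirror j ((j : ℝ) + 1) = partner j := by unfold mirror; ring
    have h2 : mirror (partner j) (partner j) = (j : ℝ) + 1 := by
      unfold mirror; rw [partner_partner]; ring
    simp only [E]
    rw [h1, h2]
    group
  have hEper : ∀ j m : ℤ, E (j + m * (4 * g)) = E j := by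
    intro j m
    simp only [E]
    have e : mirror (j + m * (4 * g)) ((j + m * (4 * g) : ℤ) : ℝ) = mirror j j + m * (4 * g) := by
      unfold mirror
      rw [partner_add]
      push_cast
      ring
    rw [e, hDper, ← hDper j m]
    push_cast
    rfl
  let P : ℤ → Γ := fun k => E (4 * k)
  let Q : ℤ → Γ := fun k => E (4 * k + 1)
  let c : ℤ → Γ := fun i => D i
  have hp0 : ∀ k, partner (4 * k) = 4 * k + 2 := fun k => by unfold partner; split_ifs <;> omega
  have hp1 : ∀ k, partner (4 * k + 1) = 4 * k + 3 := fun k => by unfold partner; split_ifs <;> omega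
  have e0 : ∀ k, c (4 * k) = P k * c (4 * k + 3) := by
    intro k
    simp only [P, E, c]
    rw [show mirror (4 * k) ((4 * k : ℤ) : ℝ) = ((4 * k + 3 : ℤ) : ℝ) by
      unfold mirror; rw [hp0]; push_cast; ring]
    group
  have e1 : ∀ k, c (4 * k + 1) = P k * c (4 * k + 2) := by
    intro k
    have h := hE (4 * k) ((4 * k : ℤ) + 1) ⟨by linarith, le_rfl⟩
    simp only [P]
    rw [← h, show mirror (4 * k) (((4 * k : ℤ) : ℝ) + 1) = ((4 * k + 2 : ℤ) : ℝ) by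
      unfold mirror; rw [hp0]; push_cast; ring]
    simp only [c]
    push_cast
    group
  have e2 : ∀ k, c (4 * k + 1) = Q k * c (4 * k + 4) := by
    intro k
    simp only [Q, E, c]
    rw [show mirror (4 * k + 1) ((4 * k + 1 : ℤ) : ℝ) = ((4 * k + 4 : ℤ) : ℝ) by
      unfold mirror; rw [hp1]; push_cast; ring]
    group
  have e3 : ∀ k, c (4 * k + 2) = Q k * c (4 * k + 3) := by
    intro k
    have h := hE (4 * k + 1) ((4 * k + 1 : ℤ) + 1) ⟨by linarith, le_rfl⟩
    simp only [Q]
    rw [← h, show mirror (4 * k + 1) (((4 * k + 1 : ℤ) : ℝ) + 1) = ((4 * k + 3 : ℤ) : ℝ) by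
      unfold mirror; rw [hp1]; push_cast; ring]
    simp only [c]
    rw [show (((4 * k + 1 : ℤ) : ℝ) + 1) = ((4 * k + 2 : ℤ) : ℝ) by push_cast; ring]
    group
  refine ⟨fun k => P k, fun k => Q k, ?_, ?_, ?_⟩
  · set G := Subgroup.closure ((fun k : ℕ => P k) '' Iio g ∪ (fun k : ℕ => Q k) '' Iio g) with hG
    have hPQ : ∀ k : ℤ, P k ∈ G ∧ Q k ∈ G := by
      intro k
      have hg0 : (0 : ℤ) < g := by exact_mod_cast hg
      have h1 := Int.emod_lt_of_pos k hg0
      have h2 := Int.emod_nonneg k hg0.ne'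
      have h3 := Int.emod_add_mul_ediv k g
      obtain ⟨n, hn⟩ := Int.eq_ofNat_of_zero_le h2
      have hk : k = n + (k / g) * g := by rw [← hn]; linarith
      have hP : P k = P n := by
        simp only [P]
        rw [← hEper (4 * n) (k / g)]
        congr 1
        conv_lhs => rw [hk]
        ring
      have hQ : Q k = Q n := by
        simp only [Q]
        rw [← hEper (4 * n + 1) (k / g)]
        congr 1
        conv_lhs => rw [hk]
        ring
      rw [hP, hQ]
      have hn' : n ∈ Iio g := by rw [hn] at h1; exact_mod_cast h1
      exact ⟨Subgroup.subset_closure (Or.inl ⟨n, hn', rfl⟩),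
        Subgroup.subset_closure (Or.inr ⟨n, hn', rfl⟩)⟩
    have hEG : ∀ j, E j ∈ G := by
      intro j
      obtain ⟨k, rfl | rfl | rfl | rfl⟩ := int_mod_four j
      · exact (hPQ k).1
      · exact (hPQ k).2
      · rw [← hp0, hEp]; exact G.inv_mem (hPQ k).1
      · rw [← hp1, hEp]; exact G.inv_mem (hPQ k).2
    have hcG : ∀ i j, c i * (c j)⁻¹ ∈ G := by
      have h4 : ∀ k, c (4 * k) * (c 0)⁻¹ ∈ G := by
        have hstep : ∀ k, c (4 * (k + 1)) = (Q k)⁻¹ * P k * Q k * (P k)⁻¹ * c (4 * k) := by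
          intro k
          rw [show 4 * (k + 1) = 4 * k + 4 by ring, e0 k]
          have h2 := e2 k
          rw [e1, e3] at h2
          rw [eq_inv_mul_of_mul_eq h2.symm]
          group
        intro k
        induction k using Int.induction_on with
        | zero => simp
        | succ i ih =>
          rw [hstep, mul_assoc]
          exact G.mul_mem (G.mul_mem (G.mul_mem (G.mul_mem (G.inv_mem (hPQ _).2) (hPQ _).1)
            (hPQ _).2) (G.inv_mem (hPQ _).1)) ih
        | pred i ih =>
          have h := hstep (-i - 1)
          rw [sub_add_cancel] at h
          rw [h, mul_assoc] at ih
          exact (G.mul_mem_cancel_left (G.mul_mem (G.mul_mem (G.mul_mem (G.inv_mem (hPQ _).2)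
            (hPQ _).1) (hPQ _).2) (G.inv_mem (hPQ _).1))).1 ih
      have h : ∀ i, c i * (c 0)⁻¹ ∈ G := by
        intro i
        obtain ⟨k, rfl | rfl | rfl | rfl⟩ := int_mod_four i
        · exact h4 k
        · have := h4 (k + 1)
          rw [show 4 * (k + 1) = 4 * k + 4 by ring] at this
          rw [e2, mul_assoc]
          exact G.mul_mem (hPQ _).2 this
        · have := h4 k
          rw [e0, mul_assoc] at this
          rw [e3, mul_assoc]
          exact G.mul_mem (hPQ _).2 ((G.mul_mem_cancel_left (hPQ _).1).1 this)
        · have := h4 k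
          rw [e0, mul_assoc] at this
          exact (G.mul_mem_cancel_left (hPQ _).1).1 this
      intro i j
      have := G.mul_mem (h i) (G.inv_mem (h j))
      convert this using 1
      group
    have hell : ∀ x x', q x = q x' → δ x * (δ x')⁻¹ ∈ G := by
      intro x x' h
      have h := hq.eq_iff.1 h
      cases h with
      | refl => simp
      | corner i j => exact hcG i j
      | side j u hu =>
        have := hE j u (Ioo_subset_Icc_self hu)
        rw [show δ (arcPt g u) * (δ (arcPt g (mirror j u)))⁻¹ = E j from this]
        exact hEG j
    -- The value on a path is compared with `δ` at arbitrary lifts of its endpoints. A small path is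
    -- contracted to the vertex of a cone, which leaves a quotient of values of `δ` at two glued
    -- points, an element of `G` by `hell`.
    have key : ∀ {x y : S} (p : Path.Homotopic.Quotient x y), ∀ a b, q a = x → q b = y →
        δ a * F.val p * (δ b)⁻¹ ∈ G := by
      intro x y p
      refine path_induction (fun x y p => ∀ a b, q a = x → q b = y →
        δ a * F.val p * (δ b)⁻¹ ∈ G) ?_ ?_ p
      · intro x y z p p' h h' a b ha hb
        obtain ⟨m, hm⟩ := hq.surjective y
        have := G.mul_mem (h a m ha hm) (h' m b hm hb)
        rw [F.map_trans]
        simpa [mul_assoc] using this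
      · intro b
        obtain ⟨N, -⟩ := hq.exists_coneNbhd hg b
        refine ⟨N.O, N.isOpen.mem_nhds N.mem, fun x y γ hγ a a' ha ha' => ?_⟩
        subst ha ha'
        have hO : ∀ t, γ t ∈ N.O := fun t => hγ ⟨t, rfl⟩
        have haO : q a ∈ N.O := by simpa using hO 0
        have haO' : q a' ∈ N.O := by simpa using hO 1
        have hh0 : ∀ x ∈ N.O, N.h x 0 = b := by
          intro x hx
          obtain ⟨y, rfl⟩ := hq.surjective x
          rw [← N.q_H y hx, N.H_zero y hx]
        have hh1 : ∀ x ∈ N.O, N.h x 1 = x := by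
          intro x hx
          obtain ⟨y, rfl⟩ := hq.surjective x
          rw [← N.q_H y hx, N.H_one y hx]
        have hcont : Continuous fun z : I × I => N.h (γ z.1) z.2 :=
          N.conth.comp_continuous (f := fun z : I × I => (γ z.1, z.2)) (by fun_prop)
            fun z => mk_mem_prod (hO z.1) (mem_univ _)
        have hsq := F.square ⟨fun z : I × I => N.h (γ z.1) z.2, hcont⟩
          ((Path.refl (q (N.H a 0))).cast rfl (by rw [N.H_zero _ haO, N.H_zero _ haO']))
          ((N.track a' haO').map q.continuous) ((N.track a haO).map q.continuous) γ
          (fun t => (N.H_zero _ haO).trans (hh0 _ (hO t)).symm)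
          (fun t => by
            change q (N.H a' t) = N.h (γ 1) t
            rw [N.q_H _ haO', γ.target])
          (fun t => by
            change q (N.H a t) = N.h (γ 0) t
            rw [N.q_H _ haO, γ.source])
          (fun t => (hh1 _ (hO t)).symm)
        rw [F.path_const (fun _ => rfl), one_mul, F.path_comap, F.path_comap, PathFunctor.path,
          PathFunctor.path, hδ2, hδ2] at hsq
        change _ = _ * F.val _ at hsq
        rw [← inv_mul_eq_iff_eq_mul] at hsq
        rw [← hsq]
        have := hell (N.H a 0) (N.H a' 0) (by rw [N.H_zero _ haO, N.H_zero _ haO'])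
        convert this using 1
        group
    rw [eq_top_iff]
    intro p _
    have h := key p y₀ y₀ rfl rfl
    rw [hδ0, one_mul, inv_one, mul_one, PathFunctor.tautological_val] at h
    exact G.inv_mem_iff.1 h
  -- Passing one block changes the corner value by a commutator; the corner `4 * g` is the corner
  -- `0`, so the product is trivial.
  · have h : ∀ n : ℕ, c 0 = ((List.range n).map fun k : ℕ =>
        P k * (Q k)⁻¹ * (P k)⁻¹ * Q k).prod * c (4 * n) := by
      intro n
      induction n with
      | zero => simp
      | succ n ih =>
        rw [List.range_succ, List.map_append, List.prod_append, ih]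
        have h2 := e2 n
        rw [e1, e3] at h2
        have h0 := e0 n
        rw [eq_inv_mul_of_mul_eq h0.symm] at h2
        push_cast
        rw [show 4 * ((n : ℤ) + 1) = 4 * n + 4 by ring, eq_inv_mul_of_mul_eq h2.symm]
        simp only [List.map_cons, List.map_nil, List.prod_cons, List.prod_nil]
        group
    have hg4 : c (4 * g) = c 0 := by
      have := hDper 0 1
      simp only [c]
      push_cast
      simpa using this
    have := h g
    rw [hg4] at this
    exact (mul_eq_right.1 this.symm)
  · intro K _ α β hprod
    -- With `t = 1` and `d = 0` a potential with jumps `α` and `β` is exactly what descends to a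
    -- functor on the surface.
    obtain ⟨U, hU, hα, hβ⟩ := exists_potential_of_prod hg (1 : K) (fun x => by simp)
      (fun _ _ => 0) (fun _ _ _ => rfl) (fun _ _ _ _ _ _ _ => rfl) α β (by simpa using hprod)
    obtain ⟨Φ, hΦ⟩ := hq.exists_pathFunctor hg U (fun j u v hu hv => by simpa using hU j u v hu hv)
    obtain ⟨a, ha0, ha⟩ := Φ.exists_hom_tautological (q y₀)
    have hval : ∀ x, Φ.hom (q y₀) (δ x) = U y₀ * (U x)⁻¹ * (a (q x))⁻¹ := by
      intro x
      rw [← hδ1 x (.mk (PathConnectedSpace.somePath y₀ x))]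
      change Φ.hom (q y₀) (F.val (Path.Homotopic.Quotient.map _ q)) = _
      rw [ha, ha0, one_mul, hΦ]
    have hell : ∀ x x', q x = q x' →
        Φ.hom (q y₀) (δ x * (δ x')⁻¹) = U y₀ * ((U x)⁻¹ * U x') * (U y₀)⁻¹ := by
      intro x x' h
      rw [map_mul, map_inv, hval, hval, h]
      group
    have hEu : ∀ (j : ℤ), Φ.hom (q y₀) (E j) = U y₀ * ((U (arcPt g (j + 1 / 2)))⁻¹ *
        U (arcPt g (mirror j (j + 1 / 2)))) * (U y₀)⁻¹ := by
      intro j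
      have hm : (j : ℝ) + 1 / 2 ∈ Icc (j : ℝ) (j + 1) := ⟨by linarith, by linarith⟩
      rw [← hE j _ hm]
      exact hell _ _ (hq.eq_iff.2 (GlueRel.side' hm))
    -- The generators are sent to the jumps conjugated by the potential at the base point; this
    -- conjugation is undone.
    refine ⟨(MulAut.conj (U y₀)⁻¹).toMonoidHom.comp (Φ.hom (q y₀)), fun k hk => ⟨?_, ?_⟩⟩
    · have h := hα k hk ((4 * k : ℤ) + 1 / 2) ⟨by linarith, by linarith⟩
      change (MulAut.conj (U y₀)⁻¹) (Φ.hom (q y₀) (E (4 * k))) = _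
      rw [hEu, h.1, h.2]
      simp [mul_assoc]
    · have h := hβ k hk ((4 * k + 1 : ℤ) + 1 / 2) ⟨by linarith, by linarith⟩
      change (MulAut.conj (U y₀)⁻¹) (Φ.hom (q y₀) (E (4 * k + 1))) = _
      rw [hEu, h.1, h.2]
      simp [mul_assoc]

end IsPolygonQuotient

/-! ### Unipotent actions and residual properties -/

/-- A finite descending flag. -/
structure DescendingFlag (V : Type*) [AddCommGroup V] where
  /-- The members of the flag. -/
  L : ℕ → Submodule ℤ V
  anti : Antitone L
  /-- The length of the flag. -/
  len : ℕ
  eq_bot : L len = ⊥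

namespace DescendingFlag

variable {V : Type*} [AddCommGroup V] (F : DescendingFlag V)

theorem le_of_unipotent {φ : V ≃ₗ[ℤ] V} (h : ∀ i, ∀ v ∈ F.L i, φ v - v ∈ F.L (i + 1)) {i : ℕ}
    {v : V} (hv : v ∈ F.L i) : φ v ∈ F.L i := by
  have := (F.L i).add_mem (F.anti i.le_succ (h i v hv)) hv
  rwa [sub_add_cancel] at this

/-- Induction from the bottom of the flag, using `φ⁻¹ v = v - φ⁻¹ (φ v - v)`. -/
theorem symm_mem {φ : V ≃ₗ[ℤ] V} (h : ∀ i, ∀ v ∈ F.L i, φ v - v ∈ F.L (i + 1)) {i : ℕ}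
    {v : V} (hv : v ∈ F.L i) : φ.symm v ∈ F.L i := by
  have key : ∀ n i, F.len ≤ i + n → ∀ v ∈ F.L i, φ.symm v ∈ F.L i := by
    intro n
    induction n with
    | zero =>
      intro i hi v hv
      have := F.anti hi hv
      rw [F.eq_bot, Submodule.mem_bot] at this
      simp [this]
    | succ n ih =>
      intro i hi v hv
      have h1 := F.anti i.le_succ (ih (i + 1) (by omega) _ (h i v hv))
      rw [map_sub, LinearEquiv.symm_apply_apply] at h1
      have := (F.L i).sub_mem hv h1
      rwa [sub_sub_cancel] at this
  exact key F.len i (by omega) v hv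

/-- The group of automorphisms that act trivially on the quotients of the flag. -/
def unipotent : Subgroup (V ≃ₗ[ℤ] V) where
  carrier := {φ | ∀ i, ∀ v ∈ F.L i, φ v - v ∈ F.L (i + 1)}
  one_mem' := fun i v _ => by simp
  mul_mem' := by
    intro φ ψ hφ hψ i v hv
    have h := (F.L (i + 1)).add_mem (hφ i _ (F.le_of_unipotent hψ hv)) (hψ i v hv)
    rwa [sub_add_sub_cancel] at h
  inv_mem' := by
    intro φ hφ i v hv
    have h := (F.L (i + 1)).neg_mem (F.symm_mem hφ (hφ i v hv))
    rw [map_sub, LinearEquiv.symm_apply_apply, neg_sub] at h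
    exact h

variable {G : Type*} [Group G] {ρ : G →* (V ≃ₗ[ℤ] V)}

theorem apply_mem (hρ : ∀ g, ρ g ∈ F.unipotent) (g : G) {i : ℕ} {v : V} (hv : v ∈ F.L i) :
    ρ g v ∈ F.L i := F.le_of_unipotent (hρ g) hv

theorem map_mul_apply (g h : G) (v : V) : ρ (g * h) v = ρ g (ρ h v) := by rw [map_mul]; rfl

theorem map_inv_apply (g : G) (v : V) : ρ g⁻¹ (ρ g v) = v := by
  rw [← map_mul_apply, inv_mul_cancel, map_one]; rfl

theorem map_apply_inv (g : G) (v : V) : ρ g (ρ g⁻¹ v) = v := by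
  rw [← map_mul_apply, mul_inv_cancel, map_one]; rfl

/-- The normal subgroup of the elements that act trivially modulo `q`. -/
def congruenceKernel (hρ : ∀ g, ρ g ∈ F.unipotent) (q : ℤ) : Subgroup G where
  carrier := {g | ∀ v ∈ F.L 0, ∃ w ∈ F.L 0, ρ g v - v = q • w}
  one_mem' := fun v _ => ⟨0, zero_mem _, by simp⟩
  mul_mem' := by
    intro g h hg hh v hv
    obtain ⟨w, hw, e⟩ := hh v hv
    obtain ⟨w', hw', e'⟩ := hg _ (F.apply_mem hρ h hv)
    refine ⟨w + w', add_mem hw hw', ?_⟩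
    rw [map_mul_apply, smul_add, ← e, ← e']
    abel
  inv_mem' := by
    intro g hg v hv
    obtain ⟨w, hw, e⟩ := hg _ (F.apply_mem hρ g⁻¹ hv)
    refine ⟨-w, neg_mem hw, ?_⟩
    rw [map_apply_inv] at e
    rw [smul_neg, ← e]
    abel

instance normal_congruenceKernel (hρ : ∀ g, ρ g ∈ F.unipotent) (q : ℤ) :
    (F.congruenceKernel hρ q).Normal where
  conj_mem := by
    intro n hn g v hv
    obtain ⟨w, hw, e⟩ := hn _ (F.apply_mem hρ g⁻¹ hv)
    refine ⟨ρ g w, F.apply_mem hρ g hw, ?_⟩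
    rw [map_mul_apply, map_mul_apply, ← map_smul, ← e, map_sub, map_apply_inv]

theorem mem_congruenceKernel_zero (hρ : ∀ g, ρ g ∈ F.unipotent) {g : G} :
    g ∈ F.congruenceKernel hρ 0 ↔ ∀ v ∈ F.L 0, ρ g v = v := by
  refine ⟨fun h v hv => ?_, fun h v hv => ⟨0, zero_mem _, by rw [h v hv]; simp⟩⟩
  obtain ⟨w, -, e⟩ := h v hv
  rwa [zero_smul, sub_eq_zero] at e

/-- The elements whose action minus the identity lowers the flag by `j + 1` steps form a descending
central series modulo the kernel: with `w = (h g)⁻¹ v`, the commutator moves `v` by `(g - 1)(h - 1)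
w - (h - 1)(g - 1) w`. -/
theorem isNilpotent_quotient (hρ : ∀ g, ρ g ∈ F.unipotent) :
    Group.IsNilpotent (G ⧸ F.congruenceKernel hρ 0) := by
  let T : ℕ → Subgroup G := fun j =>
    { carrier := {g | ∀ i, ∀ v ∈ F.L i, ρ g v - v ∈ F.L (i + j + 1)}
      one_mem' := fun i v _ => by simp
      mul_mem' := by
        intro g h hg hh i v hv
        rw [map_mul_apply]
        have := (F.L (i + j + 1)).add_mem (hg i _ (F.apply_mem hρ h hv)) (hh i v hv)
        rwa [sub_add_sub_cancel] at this
      inv_mem' := by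
        intro g hg i v hv
        have h := (F.L (i + j + 1)).neg_mem (hg i _ (F.apply_mem hρ g⁻¹ hv))
        rwa [map_apply_inv, neg_sub] at h }
  rw [Subgroup.nilpotent_iff_finite_descending_central_series]
  refine ⟨F.len, fun j => (T j).map (QuotientGroup.mk' _), ⟨?_, ?_⟩, ?_⟩
  · rw [eq_top_iff]
    intro x _
    obtain ⟨g, rfl⟩ := QuotientGroup.mk'_surjective _ x
    exact ⟨g, fun i v hv => hρ g i v hv, rfl⟩
  · rintro _ j ⟨g, hg, rfl⟩ y
    obtain ⟨h, rfl⟩ := QuotientGroup.mk'_surjective _ y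
    refine ⟨g * h * g⁻¹ * h⁻¹, ?_, by simp [commutatorElement_def]⟩
    intro i v hv
    set w := ρ (g⁻¹ * h⁻¹) v with hw
    have hwL : w ∈ F.L i := F.apply_mem hρ _ hv
    have e : v = ρ h (ρ g w) := by
      rw [hw, ← map_mul_apply, ← map_mul_apply]
      simp
    have e2 : ρ (g * h * g⁻¹ * h⁻¹) v = ρ g (ρ h w) := by
      rw [hw, ← map_mul_apply, ← map_mul_apply]
      simp [mul_assoc]
    have h1 := hg (i + 1) _ (hρ h i w hwL)
    have h2 := hρ h (i + j + 1) _ (hg i w hwL)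
    rw [show i + 1 + j + 1 = i + j + 1 + 1 by ring] at h1
    have h3 := Submodule.sub_mem _ h1 h2
    have h4 : ρ g (ρ h w) - ρ h (ρ g w) ∈ F.L (i + j + 1 + 1) := by
      convert h3 using 1
      rw [map_sub, map_sub]
      abel
    rwa [← e, ← e2] at h4
  · rw [eq_bot_iff]
    rintro _ ⟨g, hg, rfl⟩
    rw [Subgroup.mem_bot, QuotientGroup.mk'_apply, QuotientGroup.eq_one_iff]
    rw [mem_congruenceKernel_zero]
    intro v hv
    have := F.anti (show F.len ≤ 0 + F.len + 1 by omega) (hg 0 v hv)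
    rwa [F.eq_bot, Submodule.mem_bot, sub_eq_zero] at this

theorem pow_apply_eq {φ : V →ₗ[ℤ] V} {v : V} {w : V} (h : φ v = v + w) (hw : φ w = w) (n : ℕ) :
    (φ ^ n) v = v + n • w := by
  induction n with
  | zero => simp
  | succ n ih =>
    rw [pow_succ', Module.End.mul_apply, ih, map_add, h, map_nsmul, hw, succ_nsmul]
    abel

/-- Induction from the bottom of the flag: if `g` is trivial on `L (i + 1)`, then `g ^ n v = v + n
(g v - v)` on `L i`, so `g ^ n = 1` forces `g v = v` in the absence of torsion. -/
theorem torsionFree_quotient (hρ : ∀ g, ρ g ∈ F.unipotent)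
    (htf : ∀ v ∈ F.L 0, ∀ n : ℕ, n ≠ 0 → n • v = 0 → v = 0)
    (y : G ⧸ F.congruenceKernel hρ 0) (hy : IsOfFinOrder y) : y = 1 := by
  obtain ⟨g, rfl⟩ := QuotientGroup.mk'_surjective _ y
  obtain ⟨n, hn, h⟩ := isOfFinOrder_iff_pow_eq_one.1 hy
  rw [← map_pow, QuotientGroup.mk'_apply, QuotientGroup.eq_one_iff, mem_congruenceKernel_zero] at h
  rw [QuotientGroup.mk'_apply, QuotientGroup.eq_one_iff, mem_congruenceKernel_zero]
  have key : ∀ m i, F.len ≤ i + m → ∀ v ∈ F.L i, ρ g v = v := by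
    intro m
    induction m with
    | zero =>
      intro i hi v hv
      have := F.anti hi hv
      rw [F.eq_bot, Submodule.mem_bot] at this
      simp [this]
    | succ m ih =>
      intro i hi v hv
      have h1 := ih (i + 1) (by omega) _ (hρ g i v hv)
      have h0 : v ∈ F.L 0 := F.anti (Nat.zero_le i) hv
      have h2 := pow_apply_eq (φ := (ρ g : V →ₗ[ℤ] V)) (v := v) (w := ρ g v - v) (by simp)
        (by simpa using h1) n
      have h3 : ((ρ g : V →ₗ[ℤ] V) ^ n) v = v := by
        have : ρ (g ^ n) v = ((ρ g : V →ₗ[ℤ] V) ^ n) v := by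
          have : ∀ k, ρ (g ^ k) v = ((ρ g : V →ₗ[ℤ] V) ^ k) v := by
            intro k
            induction k with
            | zero => simp
            | succ k ih => rw [pow_succ', map_mul_apply, ih, pow_succ']; rfl
          exact this n
        rw [← this, h v h0]
      rw [h3, left_eq_add] at h2
      exact sub_eq_zero.1 (htf _ (sub_mem (F.apply_mem hρ g h0) h0) n hn.ne' h2)
  exact key F.len 0 (by omega)

/-- Induction from the bottom of the flag: if `h` is trivial on `L (i + 1)` modulo `p ^ m`, then `h
^ s v ≡ v + s (h v - v)` on `L i`, so `h ^ (p ^ m)` is trivial there. Each step of the flag costs a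
factor `p ^ m` in the exponent. -/
theorem isPGroup_quotient (hρ : ∀ g, ρ g ∈ F.unipotent) (p m : ℕ) :
    IsPGroup p (G ⧸ F.congruenceKernel hρ ((p : ℤ) ^ m)) := by
  intro y
  obtain ⟨g, rfl⟩ := QuotientGroup.mk'_surjective _ y
  suffices key : ∀ n i, F.len ≤ i + n → ∃ k : ℕ, ∀ v ∈ F.L i, ∃ w ∈ F.L 0,
      ρ (g ^ p ^ k) v - v = ((p : ℤ) ^ m) • w by
    obtain ⟨k, hk⟩ := key F.len 0 (by omega)
    refine ⟨k, ?_⟩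
    rw [← map_pow, QuotientGroup.mk'_apply, QuotientGroup.eq_one_iff]
    exact hk
  intro n
  induction n with
  | zero =>
    intro i hi
    refine ⟨0, fun v hv => ⟨0, zero_mem _, ?_⟩⟩
    have := F.anti hi hv
    rw [F.eq_bot, Submodule.mem_bot] at this
    simp [this]
  | succ n ih =>
    intro i hi
    obtain ⟨k, hk⟩ := ih (i + 1) (by omega)
    refine ⟨k + m, fun v hv => ?_⟩
    set h := g ^ p ^ k with hh
    have h0 : v ∈ F.L 0 := F.anti (Nat.zero_le i) hv
    obtain ⟨w, hw, e⟩ := hk _ (hρ h i v hv)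
    have key : ∀ s : ℕ, ∃ w' ∈ F.L 0, ρ (h ^ s) v = v + s • (ρ h v - v) + ((p : ℤ) ^ m) • w' := by
      intro s
      induction s with
      | zero => exact ⟨0, zero_mem _, by simp⟩
      | succ s ihs =>
        obtain ⟨w', hw', e'⟩ := ihs
        refine ⟨s • w + ρ h w', add_mem (nsmul_mem hw s) (F.apply_mem hρ h hw'), ?_⟩
        rw [pow_succ', map_mul_apply, e', map_add, map_add, map_nsmul, map_zsmul,
          sub_eq_iff_eq_add.1 e, smul_add, smul_add, succ_nsmul, smul_comm s]
        abel
    obtain ⟨w', hw', e'⟩ := key (p ^ m)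
    refine ⟨ρ h v - v + w', add_mem (sub_mem (F.apply_mem hρ h h0) h0) hw', ?_⟩
    rw [pow_add, pow_mul, ← hh, e', smul_add, ← natCast_zsmul]
    push_cast
    abel

/-- The quotient acts faithfully on the finite group `L 0 / q L 0`. -/
theorem finite_quotient (hρ : ∀ g, ρ g ∈ F.unipotent) [Module.Finite ℤ (F.L 0)] {q : ℤ}
    (hq : q ≠ 0) : Finite (G ⧸ F.congruenceKernel hρ q) := by
  let A : Submodule ℤ (F.L 0) := LinearMap.range (q • (LinearMap.id : F.L 0 →ₗ[ℤ] F.L 0))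
  have hfin : Finite (F.L 0 ⧸ A) := by
    refine Module.finite_of_fg_torsion _ fun {x} => ?_
    obtain ⟨v, rfl⟩ := A.mkQ_surjective x
    refine ⟨⟨q, mem_nonZeroDivisors_of_ne_zero hq⟩, ?_⟩
    change q • A.mkQ v = 0
    rw [← map_smul, Submodule.mkQ_apply, Submodule.Quotient.mk_eq_zero]
    exact ⟨v, rfl⟩
  let Φ : G → (F.L 0 ⧸ A) → (F.L 0 ⧸ A) := fun g c =>
    A.mkQ ⟨ρ g (Function.surjInv A.mkQ_surjective c).1,
      F.apply_mem hρ g (Function.surjInv A.mkQ_surjective c).2⟩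
  have hA : ∀ v w : F.L 0, A.mkQ v = A.mkQ w ↔ ∃ u ∈ F.L 0, v.1 - w.1 = q • u := by
    intro v w
    rw [Submodule.mkQ_apply, Submodule.mkQ_apply, Submodule.Quotient.eq]
    constructor
    · rintro ⟨u, hu⟩
      exact ⟨u.1, u.2, by simpa using congrArg Subtype.val hu.symm⟩
    · rintro ⟨u, hu, e⟩
      exact ⟨⟨u, hu⟩, Subtype.ext (by simpa using e.symm)⟩
  refine Finite.of_injective (fun x : G ⧸ F.congruenceKernel hρ q => Φ x.out) fun x y h => ?_
  rw [← QuotientGroup.out_eq' x, ← QuotientGroup.out_eq' y, QuotientGroup.eq]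
  intro v hv
  set r := Function.surjInv A.mkQ_surjective (A.mkQ ⟨v, hv⟩) with hr
  obtain ⟨u, hu, e⟩ := (hA r ⟨v, hv⟩).1 (Function.surjInv_eq A.mkQ_surjective _)
  obtain ⟨u', hu', e'⟩ := (hA _ _).1 (congrFun h (A.mkQ ⟨v, hv⟩))
  change ρ _ r.1 - ρ _ r.1 = q • u' at e'
  change r.1 - v = q • u at e
  rw [sub_eq_iff_eq_add.1 e, map_add, map_add, map_smul, map_smul] at e'
  refine ⟨ρ x.out⁻¹ (ρ x.out u - ρ y.out u - u'), F.apply_mem hρ _ (sub_mem (sub_mem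
    (F.apply_mem hρ _ hu) (F.apply_mem hρ _ hu)) hu'), ?_⟩
  rw [← map_smul, map_mul_apply]
  have : ρ x.out⁻¹ (ρ y.out v) - v = ρ x.out⁻¹ (ρ y.out v - ρ x.out v) := by
    rw [map_sub, map_inv_apply]
  rw [this]
  congr 1
  rw [smul_sub, smul_sub, ← e']
  abel

/-- An element that acts nontrivially in a unipotent representation on a finitely generated
torsion-free group survives in a torsion-free nilpotent quotient and in finite `p`-quotients. -/
theorem residual (hρ : ∀ g, ρ g ∈ F.unipotent) {κ : Type*} [Finite κ] (ι : F.L 0 →ₗ[ℤ] (κ → ℤ))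
    (hι : Function.Injective ι) {x : G} {v : V} (hv : v ∈ F.L 0) (hx : ρ x v ≠ v) :
    (∃ (N : Subgroup G) (_ : N.Normal), x ∉ N ∧ Group.IsNilpotent (G ⧸ N) ∧
      ∀ y : G ⧸ N, IsOfFinOrder y → y = 1) ∧
    ∀ p : ℕ, p.Prime → ∃ (N : Subgroup G) (_ : N.Normal), x ∉ N ∧ Finite (G ⧸ N) ∧
      IsPGroup p (G ⧸ N) := by
  refine ⟨⟨F.congruenceKernel hρ 0, inferInstance, fun h => hx ?_, F.isNilpotent_quotient hρ,
    F.torsionFree_quotient hρ ?_⟩, fun p hp => ?_⟩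
  · exact (F.mem_congruenceKernel_zero hρ).1 h v hv
  · intro w hw n hn h
    have h2 : n • (⟨w, hw⟩ : F.L 0) = 0 := Subtype.ext h
    have h3 := congrArg ι h2
    rw [map_nsmul, map_zero] at h3
    have h4 : ι ⟨w, hw⟩ = 0 := (smul_eq_zero.1 h3).resolve_left hn
    exact congrArg Subtype.val (hι (h4.trans (map_zero ι).symm))
  · have hfin : Module.Finite ℤ (F.L 0) := Module.Finite.of_injective ι hι
    let w : F.L 0 := ⟨ρ x v - v, sub_mem (F.apply_mem hρ x hv) hv⟩
    have hw : ι w ≠ 0 := fun h => hx (sub_eq_zero.1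
      (congrArg Subtype.val (hι (h.trans (map_zero ι).symm) : w = 0)))
    obtain ⟨i, hi⟩ := Function.ne_iff.1 hw
    have hi' : ι w i ≠ 0 := hi
    -- A nonzero integer of absolute value `m` is not divisible by `p ^ m`, because `p ^ m > m`.
    let m := (ι w i).natAbs
    refine ⟨F.congruenceKernel hρ ((p : ℤ) ^ m), inferInstance, fun h => ?_,
      F.finite_quotient hρ (pow_ne_zero _ (by exact_mod_cast hp.ne_zero)),
      F.isPGroup_quotient hρ p m⟩
    obtain ⟨u, hu, e⟩ := h v hv
    have h1 : w = ((p : ℤ) ^ m) • (⟨u, hu⟩ : F.L 0) := Subtype.ext e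
    have h2 : ι w i = (p : ℤ) ^ m * ι ⟨u, hu⟩ i := by
      rw [h1, map_smul]; simp
    have h3 : p ^ m ∣ (ι w i).natAbs := by
      rw [← Int.natCast_dvd]
      push_cast
      exact Dvd.intro _ h2.symm
    have h4 := Nat.le_of_dvd (Int.natAbs_pos.2 hi') h3
    exact absurd h4 (not_le.2 (Nat.lt_pow_self hp.one_lt))

end DescendingFlag

/-! ### Polynomial functions on the integers -/

/-- The forward difference. -/
def forwardDiff : (ℤ → ℤ) →ₗ[ℤ] (ℤ → ℤ) where
  toFun f k := f (k + 1) - f k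
  map_add' f g := by ext k; simp; ring
  map_smul' a f := by ext k; simp; ring

theorem forwardDiff_apply (f : ℤ → ℤ) (k : ℤ) : forwardDiff f k = f (k + 1) - f k := rfl

/-- The functions whose `c`-th difference vanishes. -/
def polyFun : ℕ → Submodule ℤ (ℤ → ℤ)
  | 0 => ⊥
  | c + 1 => (polyFun c).comap forwardDiff

theorem mem_polyFun_succ {c : ℕ} {f : ℤ → ℤ} : f ∈ polyFun (c + 1) ↔ forwardDiff f ∈ polyFun c :=
  Iff.rfl

theorem mem_polyFun_zero {f : ℤ → ℤ} : f ∈ polyFun 0 ↔ f = 0 := Iff.rfl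

theorem polyFun_le_succ (c : ℕ) : polyFun c ≤ polyFun (c + 1) := by
  induction c with
  | zero =>
    intro f hf
    rw [mem_polyFun_zero] at hf
    rw [hf]
    exact zero_mem _
  | succ c ih => exact fun f hf => ih hf

theorem polyFun_mono : Monotone polyFun := monotone_nat_of_le_succ polyFun_le_succ

theorem forwardDiff_mem {c : ℕ} {f : ℤ → ℤ} (hf : f ∈ polyFun c) :
    forwardDiff f ∈ polyFun (c - 1) := by
  cases c with
  | zero => rw [mem_polyFun_zero] at hf; rw [hf, map_zero]; exact zero_mem _
  | succ c => exact hf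

theorem shift_mem {c : ℕ} {f : ℤ → ℤ} (hf : f ∈ polyFun c) (a : ℤ) :
    (fun k => f (k + a)) ∈ polyFun c := by
  induction c generalizing f with
  | zero =>
    rw [mem_polyFun_zero] at hf ⊢
    rw [hf]; rfl
  | succ c ih =>
    have h := ih (mem_polyFun_succ.1 hf)
    rw [mem_polyFun_succ]
    convert h using 1
    ext k
    simp only [forwardDiff_apply]
    rw [add_right_comm]

theorem const_mem_polyFun (a : ℤ) : (fun _ => a) ∈ polyFun 1 := by
  rw [mem_polyFun_succ, mem_polyFun_zero]
  ext k
  simp [forwardDiff_apply]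

/-- Induction with the Leibniz rule `Δ (f h) = Δ f · h (· + 1) + f · Δ h`. The index `c + d` is not
sharp, but some bound is all that is needed. -/
theorem mul_mem_polyFun {c d : ℕ} {f h : ℤ → ℤ} (hf : f ∈ polyFun c) (hh : h ∈ polyFun d) :
    f * h ∈ polyFun (c + d) := by
  generalize hn : c + d = n
  induction n generalizing c d f h with
  | zero =>
    have : c = 0 := by omega
    subst this
    rw [mem_polyFun_zero] at hf
    rw [hf, zero_mul]
    exact zero_mem _
  | succ n ih =>
    rcases Nat.eq_zero_or_pos c with rfl | hc
    · rw [mem_polyFun_zero] at hf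
      rw [hf, zero_mul]
      exact zero_mem _
    rcases Nat.eq_zero_or_pos d with rfl | hd
    · rw [mem_polyFun_zero] at hh
      rw [hh, mul_zero]
      exact zero_mem _
    have h1 := ih (forwardDiff_mem hf) (shift_mem hh 1) (by omega)
    have h2 := ih hf (forwardDiff_mem hh) (by omega)
    rw [mem_polyFun_succ]
    convert add_mem h1 h2 using 1
    ext k
    simp only [forwardDiff_apply, Pi.mul_apply, Pi.add_apply]
    ring

/-- The values at `0, …, c - 1` determine the function; this gives the finite rank of the lattice of
polynomial functions. -/
theorem eq_zero_of_mem_polyFun {c : ℕ} {f : ℤ → ℤ} (hf : f ∈ polyFun c)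
    (h0 : ∀ k : ℕ, k < c → f k = 0) : f = 0 := by
  induction c generalizing f with
  | zero => exact hf
  | succ c ih =>
    have h := ih (mem_polyFun_succ.1 hf) fun k hk => by
      have := h0 (k + 1) (by omega)
      push_cast at this
      rw [forwardDiff_apply, this, h0 k (by omega), sub_zero]
    have hs : ∀ k, f (k + 1) = f k := fun k => sub_eq_zero.1 (congrFun h k)
    ext k
    induction k using Int.induction_on with
    | zero => exact h0 0 (by omega)
    | succ i ih => rw [hs]; exact ih
    | pred i ih =>
      have := hs (-i - 1)
      rw [sub_add_cancel] at this
      rw [← this]; exact ih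

/-- The ring of polynomial functions. -/
def polyRing : Subring (ℤ → ℤ) where
  carrier := {f | ∃ c, f ∈ polyFun c}
  mul_mem' := fun ⟨_, hf⟩ ⟨_, hh⟩ => ⟨_, mul_mem_polyFun hf hh⟩
  one_mem' := ⟨1, const_mem_polyFun 1⟩
  add_mem' := fun ⟨c, hf⟩ ⟨d, hh⟩ => ⟨max c d, add_mem (polyFun_mono (le_max_left _ _) hf)
    (polyFun_mono (le_max_right _ _) hh)⟩
  zero_mem' := ⟨0, zero_mem _⟩
  neg_mem' := fun ⟨c, hf⟩ => ⟨c, neg_mem hf⟩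

theorem const_mem_polyRing (a : ℤ) : (fun _ => a) ∈ polyRing := ⟨1, const_mem_polyFun a⟩

theorem sub_const_mem_polyRing (a : ℤ) : (fun k => k - a) ∈ polyRing := by
  refine ⟨2, ?_⟩
  rw [mem_polyFun_succ]
  convert const_mem_polyFun 1 using 1
  ext k
  simp [forwardDiff_apply]

theorem mem_polyRing_of_diff {f : ℤ → ℤ} (h : forwardDiff f ∈ polyRing) : f ∈ polyRing := by
  obtain ⟨c, hc⟩ := h
  exact ⟨c + 1, hc⟩

theorem shift_mem_polyRing {f : ℤ → ℤ} (h : f ∈ polyRing) (a : ℤ) :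
    (fun k => f (k + a)) ∈ polyRing := by
  obtain ⟨c, hc⟩ := h
  exact ⟨c, shift_mem hc a⟩

theorem eventually_mem_polyFun {f : ℤ → ℤ} (h : f ∈ polyRing) : ∀ᶠ H in atTop, f ∈ polyFun H := by
  obtain ⟨c, hc⟩ := h
  filter_upwards [eventually_ge_atTop c] with H hH using polyFun_mono hH hc

/-! ### Unitriangular matrices of polynomial functions -/

/-- A family of matrices indexed by the integers that is unitriangular with polynomial entries. -/
structure IsUniPoly {n : ℕ} (A : ℤ → Matrix (Fin n) (Fin n) ℤ) : Prop where
  lower : ∀ i j, j < i → ∀ k, A k i j = 0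
  diag : ∀ i k, A k i i = 1
  poly : ∀ i j, (fun k => A k i j) ∈ polyRing

namespace IsUniPoly

variable {n : ℕ} {A B : ℤ → Matrix (Fin n) (Fin n) ℤ}

/-- A row of the product differs from the row of `B` only by lower rows of `B`. The later results on
inverses and recursions follow by induction on rows from the last one upwards. -/
theorem mul_apply (hA : IsUniPoly A) (k : ℤ) (B : Matrix (Fin n) (Fin n) ℤ) (i j : Fin n) :
    (A k * B) i j = B i j + ∑ l ∈ Finset.univ.filter (i < ·), A k i l * B l j := by
  rw [Matrix.mul_apply, ← Finset.add_sum_erase _ _ (Finset.mem_univ i), hA.diag, one_mul]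
  congr 1
  symm
  refine Finset.sum_subset (fun l hl => ?_) fun l hl hl' => ?_
  · simp only [Finset.mem_filter, Finset.mem_univ, true_and] at hl
    simp [hl.ne']
  · simp only [Finset.mem_filter, Finset.mem_univ, true_and, not_lt] at hl'
    rw [hA.lower i l (lt_of_le_of_ne hl' (Finset.ne_of_mem_erase hl)), zero_mul]

theorem one : IsUniPoly (fun _ => (1 : Matrix (Fin n) (Fin n) ℤ)) where
  lower _ _ h _ := Matrix.one_apply_ne h.ne'
  diag i _ := Matrix.one_apply_eq i
  poly _ _ := const_mem_polyRing _

theorem sum_mem (hA : IsUniPoly A) {i j : Fin n}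
    (h : ∀ l, i < l → (fun k => B k l j) ∈ polyRing) :
    (fun k => ∑ l ∈ Finset.univ.filter (i < ·), A k i l * B k l j) ∈ polyRing := by
  have : (fun k => ∑ l ∈ Finset.univ.filter (i < ·), A k i l * B k l j) =
      ∑ l ∈ Finset.univ.filter (i < ·), (fun k => A k i l) * (fun k => B k l j) := by
    ext k; simp
  rw [this]
  exact polyRing.sum_mem fun l hl => polyRing.mul_mem (hA.poly i l)
    (h l (Finset.mem_filter.1 hl).2)

theorem sum_eq_zero (k : ℤ) {i j : Fin n} (h : ∀ l, i < l → B k l j = 0) :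
    ∑ l ∈ Finset.univ.filter (i < ·), A k i l * B k l j = 0 :=
  Finset.sum_eq_zero fun l hl => by rw [h l (Finset.mem_filter.1 hl).2, mul_zero]

theorem mul (hA : IsUniPoly A) (hB : IsUniPoly B) : IsUniPoly (fun k => A k * B k) where
  lower i j h k := by
    rw [hA.mul_apply, hB.lower i j h, sum_eq_zero k fun l hl => hB.lower l j (h.trans hl) k, zero_add]
  diag i k := by
    rw [hA.mul_apply, hB.diag, sum_eq_zero k fun l hl => hB.lower l i hl k, add_zero]
  poly i j := by
    simp only [hA.mul_apply]
    exact polyRing.add_mem (hB.poly i j) (hA.sum_mem fun l _ => hB.poly l j)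

theorem of_mul_eq_one (hA : IsUniPoly A) (h : ∀ k, A k * B k = 1) : IsUniPoly B := by
  have e : ∀ i j k, B k i j = (1 : Matrix (Fin n) (Fin n) ℤ) i j -
      ∑ l ∈ Finset.univ.filter (i < ·), A k i l * B k l j := by
    intro i j k
    rw [← h k, hA.mul_apply]
    ring
  have low : ∀ i j, j < i → ∀ k, B k i j = 0 := by
    intro i
    induction i using WellFoundedGT.induction with
    | ind i ih =>
      intro j hj k
      rw [e, sum_eq_zero k fun l hl => ih l hl j (hj.trans hl) k, Matrix.one_apply_ne hj.ne', sub_zero]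
  refine ⟨low, fun i k => ?_, ?_⟩
  · rw [e, sum_eq_zero k fun l hl => low l i hl k, Matrix.one_apply_eq, sub_zero]
  · intro i
    induction i using WellFoundedGT.induction with
    | ind i ih =>
      intro j
      simp only [e i j]
      exact polyRing.sub_mem (const_mem_polyRing _) (hA.sum_mem fun l hl => ih l hl j)

/-- The difference of an entry of `B` is a polynomial expression in lower rows, and a function with
polynomial difference is polynomial. Entries on and below the diagonal have zero difference, so they
keep their value at `0`. -/
theorem of_recursion (hA : IsUniPoly A) (h : ∀ k, A k * B (k + 1) = B k)
    (h0 : ∀ i j, j < i → B 0 i j = 0) (h1 : ∀ i, B 0 i i = 1) : IsUniPoly B := by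
  have e : ∀ i j k, B k i j = B (k + 1) i j +
      ∑ l ∈ Finset.univ.filter (i < ·), A k i l * B (k + 1) l j := by
    intro i j k
    rw [← h k, hA.mul_apply]
  have const : ∀ i j, (∀ k, B k i j = B (k + 1) i j) → ∀ k, B k i j = B 0 i j := by
    intro i j hs k
    induction k using Int.induction_on with
    | zero => rfl
    | succ m ih => rw [← hs, ih]
    | pred m ih => rw [hs, sub_add_cancel, ih]
  have low : ∀ i j, j < i → ∀ k, B k i j = 0 := by
    intro i
    induction i using WellFoundedGT.induction with
    | ind i ih =>
      intro j hj
      have := const i j fun k => by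
        rw [e, sum_eq_zero (B := fun k => B (k + 1)) k
          fun l hl => ih l hl j (hj.trans hl) (k + 1), add_zero]
      intro k
      rw [this, h0 i j hj]
  refine ⟨low, fun i => ?_, ?_⟩
  · have := const i i fun k => by
      rw [e, sum_eq_zero (B := fun k => B (k + 1)) k fun l hl => low l i hl (k + 1), add_zero]
    intro k
    rw [this, h1]
  · intro i
    induction i using WellFoundedGT.induction with
    | ind i ih =>
      intro j
      refine mem_polyRing_of_diff ?_
      have : forwardDiff (fun k => B k i j) = -(fun k => ∑ l ∈ Finset.univ.filter (i < ·),
          A k i l * B (k + 1) l j) := by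
        ext k
        rw [forwardDiff_apply, e i j k, Pi.neg_apply]
        ring
      rw [this]
      exact polyRing.neg_mem (hA.sum_mem (B := fun k => B (k + 1))
        fun l hl => shift_mem_polyRing (ih l hl j) 1)

theorem list_prod {ι : Type*} (l : List ι) (f : ι → ℤ → (Matrix (Fin n) (Fin n) ℤ)ˣ)
    (h : ∀ i, IsUniPoly fun k => (f i k).1) :
    IsUniPoly fun k => ((l.map f).prod k).1 := by
  induction l with
  | nil => exact one
  | cons a l ih =>
    simp only [List.map_cons, List.prod_cons]
    exact (h a).mul ih

theorem inv {A : ℤ → (Matrix (Fin n) (Fin n) ℤ)ˣ} (h : IsUniPoly fun k => (A k).1) :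
    IsUniPoly fun k => (A⁻¹ k).1 :=
  h.of_mul_eq_one fun k => by simp

end IsUniPoly

/-! ### The representation on polynomial functions -/

/-- The pointwise action of a family of invertible matrices. -/
def pointwise (n : ℕ) : (ℤ → (Matrix (Fin n) (Fin n) ℤ)ˣ) →* ((ℤ → Fin n → ℤ) ≃ₗ[ℤ] (ℤ → Fin n → ℤ)) where
  toFun A :=
    { toFun := fun v k => (A k).1.mulVec (v k)
      invFun := fun v k => (A k)⁻¹.1.mulVec (v k)
      left_inv := fun v => by
        ext1 k
        change (A k)⁻¹.1.mulVec ((A k).1.mulVec (v k)) = v k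
        rw [Matrix.mulVec_mulVec, ← Units.val_mul, inv_mul_cancel, Units.val_one, Matrix.one_mulVec]
      right_inv := fun v => by
        ext1 k
        change (A k).1.mulVec ((A k)⁻¹.1.mulVec (v k)) = v k
        rw [Matrix.mulVec_mulVec, ← Units.val_mul, mul_inv_cancel, Units.val_one, Matrix.one_mulVec]
      map_add' := fun v w => by ext1 k; exact Matrix.mulVec_add _ _ _
      map_smul' := fun a v => by ext1 k; exact Matrix.mulVec_smul (A k).1 a (v k) }
  map_one' := by
    apply LinearEquiv.ext
    intro v
    ext1 k
    exact Matrix.one_mulVec _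
  map_mul' A B := by
    apply LinearEquiv.ext
    intro v
    ext1 k
    exact (Matrix.mulVec_mulVec (v k) (A k).1 (B k).1).symm

theorem pointwise_apply {n : ℕ} (A : ℤ → (Matrix (Fin n) (Fin n) ℤ)ˣ) (v : ℤ → Fin n → ℤ) (k : ℤ) :
    pointwise n A v k = (A k).1.mulVec (v k) := rfl

/-- The shift of the argument. -/
def shiftEquiv (n : ℕ) : (ℤ → Fin n → ℤ) ≃ₗ[ℤ] (ℤ → Fin n → ℤ) where
  toFun v k := v (k + 1)
  invFun v k := v (k - 1)
  left_inv v := by ext1 k; simp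
  right_inv v := by ext1 k; simp
  map_add' v w := rfl
  map_smul' a v := rfl

theorem shiftEquiv_apply {n : ℕ} (v : ℤ → Fin n → ℤ) (k : ℤ) : shiftEquiv n v k = v (k + 1) := rfl

theorem shiftEquiv_zpow_apply {n : ℕ} (m : ℤ) (v : ℤ → Fin n → ℤ) (k : ℤ) :
    (shiftEquiv n ^ m) v k = v (k + m) := by
  induction m using Int.induction_on generalizing v k with
  | zero => simp
  | succ i ih =>
    rw [zpow_add_one, LinearEquiv.mul_apply, ih, shiftEquiv_apply, add_assoc]
  | pred i ih =>
    rw [zpow_sub_one, LinearEquiv.mul_apply, ih]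
    change v _ = v _
    congr 1
    ring

theorem shift_conj {n : ℕ} (m : ℤ) (A : ℤ → (Matrix (Fin n) (Fin n) ℤ)ˣ) :
    shiftEquiv n ^ m * pointwise n A * (shiftEquiv n ^ m)⁻¹ =
      pointwise n (fun k => A (k + m)) := by
  rw [mul_inv_eq_iff_eq_mul]
  apply LinearEquiv.ext
  intro v
  ext1 k
  simp only [LinearEquiv.mul_apply, shiftEquiv_zpow_apply, pointwise_apply]

/-- The flag of polynomial functions. -/
def polyFlag (n H : ℕ) : DescendingFlag (ℤ → Fin n → ℤ) where
  L e :=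
    { carrier := {v | ∀ i : Fin n, (fun k => v k i) ∈ polyFun (H * (n - i) - e)}
      add_mem' := fun hv hw i => add_mem (hv i) (hw i)
      zero_mem' := fun i => zero_mem _
      smul_mem' := fun a v hv i => (polyFun _).smul_mem a (hv i) }
  anti := fun e e' h v hv i => polyFun_mono (by omega) (hv i)
  len := H * n
  eq_bot := by
    rw [eq_bot_iff]
    intro v hv
    rw [Submodule.mem_bot]
    ext k i
    have h := hv i
    have h2 : H * (n - i) ≤ H * n := Nat.mul_le_mul_left _ (Nat.sub_le _ _)
    rw [Nat.sub_eq_zero_of_le h2, mem_polyFun_zero] at h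
    exact congrFun h k

theorem mem_polyFlag {n H e : ℕ} {v : ℤ → Fin n → ℤ} :
    v ∈ (polyFlag n H).L e ↔ ∀ i : Fin n, (fun k => v k i) ∈ polyFun (H * (n - i) - e) := Iff.rfl

theorem exists_embedding_polyFlag (n H : ℕ) :
    ∃ ι : (polyFlag n H).L 0 →ₗ[ℤ] (Fin n × Fin (H * n) → ℤ), Function.Injective ι := by
  refine ⟨{ toFun := fun v z => v.1 (z.2 : ℕ) z.1, map_add' := fun _ _ => rfl,
            map_smul' := fun _ _ => rfl }, ?_⟩
  rw [← LinearMap.ker_eq_bot, eq_bot_iff]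
  intro v hv
  rw [Submodule.mem_bot]
  refine Subtype.ext (funext fun k => funext fun i => ?_)
  have h := eq_zero_of_mem_polyFun (mem_polyFlag.1 v.2 i) fun k hk => by
    have h2 : H * (n - i) ≤ H * n := Nat.mul_le_mul_left _ (Nat.sub_le _ _)
    exact congrFun hv (i, ⟨k, by omega⟩)
  exact congrFun h k

theorem shiftEquiv_mem_unipotent (n H : ℕ) : shiftEquiv n ∈ (polyFlag n H).unipotent := by
  intro e v hv i
  have := forwardDiff_mem (hv i)
  rwa [Nat.sub_sub] at this

/-- The weight `H` per coordinate exceeds the order `C` of the entries. Entries above the diagonal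
bring in coordinates `l > i`, whose allowed order is smaller by at least `H ≥ C + 1`, so multiplying
by them still lands one step further down the flag. -/
theorem eventually_pointwise_mem_unipotent {n : ℕ} {A : ℤ → (Matrix (Fin n) (Fin n) ℤ)ˣ}
    (hA : IsUniPoly fun k => (A k).1) :
    ∀ᶠ H in atTop, pointwise n A ∈ (polyFlag n H).unipotent := by
  have h : ∀ᶠ C in atTop, ∀ i j, (fun k => (A k).1 i j) ∈ polyFun C :=
    eventually_all.2 fun i => eventually_all.2 fun j => eventually_mem_polyFun (hA.poly i j)
  obtain ⟨C, hC⟩ := h.exists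
  filter_upwards [eventually_ge_atTop (C + 1)] with H hH
  intro e v hv i
  have e1 : (fun k => (pointwise n A v - v) k i) =
      ∑ l ∈ Finset.univ.filter (i < ·), (fun k => (A k).1 i l) * (fun k => v k l) := by
    ext k
    have := hA.mul_apply k (Matrix.of fun l _ => v k l) i i
    simp only [Matrix.mul_apply, Matrix.of_apply] at this
    rw [Pi.sub_apply, Pi.sub_apply, pointwise_apply, Matrix.mulVec, dotProduct, this]
    simp
  change (fun k => (pointwise n A v - v) k i) ∈ polyFun _
  rw [e1]
  refine sum_mem fun l hl => ?_
  have hil : i < l := (Finset.mem_filter.1 hl).2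
  -- The subtraction is truncated, so the case in which the coordinate `l` already vanishes is
  -- treated apart.
  rcases Nat.eq_zero_or_pos (H * (n - l) - e) with h0 | h0
  · have := hv l
    rw [h0, mem_polyFun_zero] at this
    rw [this, mul_zero]
    exact zero_mem _
  · refine polyFun_mono ?_ (mul_mem_polyFun (hC i l) (hv l))
    have h1 : H * (n - l) + H ≤ H * (n - i) := by
      rw [← Nat.mul_succ]
      exact Nat.mul_le_mul_left _ (by have := l.2; have : i.1 < l.1 := hil; omega)
    omega

/-- The orbit of `(0, b₀)` under the permutation `(k, x) ↦ (k + 1, (u k)⁻¹ x)` solves the recursion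
in both directions at once. -/
theorem exists_cocycle {U : Type*} [Group U] (u : ℤ → U) (b₀ : U) :
    ∃ b : ℤ → U, b 0 = b₀ ∧ ∀ k, u k * b (k + 1) = b k := by
  let s : Equiv.Perm (ℤ × U) :=
    { toFun := fun z => (z.1 + 1, (u z.1)⁻¹ * z.2)
      invFun := fun z => (z.1 - 1, u (z.1 - 1) * z.2)
      left_inv := fun z => by simp
      right_inv := fun z => by simp }
  have h1 : ∀ k : ℤ, ((s ^ k) (0, b₀)).1 = k := by
    intro k
    induction k using Int.induction_on with
    | zero => rfl
    | succ i ih =>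
      rw [zpow_add_one, (Commute.refl s).zpow_left, Equiv.Perm.mul_apply]
      change ((s ^ (i : ℤ)) (0, b₀)).1 + 1 = _
      rw [ih]
    | pred i ih =>
      rw [zpow_sub_one, ((Commute.refl s).zpow_left _).inv_right, Equiv.Perm.mul_apply]
      change ((s ^ (-i : ℤ)) (0, b₀)).1 - 1 = _
      rw [ih]
  refine ⟨fun k => ((s ^ k) (0, b₀)).2, rfl, fun k => ?_⟩
  change u k * ((s ^ (k + 1)) (0, b₀)).2 = ((s ^ k) (0, b₀)).2
  rw [zpow_add_one, (Commute.refl s).zpow_left, Equiv.Perm.mul_apply]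
  change u k * ((u ((s ^ k) (0, b₀)).1)⁻¹ * _) = _
  rw [h1, mul_inv_cancel_left]

/-- A unipotent representation of a group with the presentation of a surface group. -/
theorem exists_unipotent_representation {Γ : Type*} [Group Γ] {g n : ℕ} (P Q : ℕ → Γ)
    (hgen : Subgroup.closure (P '' Iio (g + 1) ∪ Q '' Iio (g + 1)) = ⊤)
    (huniv : ∀ (K : Type) [Group K] (α β : ℕ → K),
      ((List.range (g + 1)).map fun k => α k * (β k)⁻¹ * (α k)⁻¹ * β k).prod = 1 →
      ∃ θ : Γ →* K, ∀ k < g + 1, θ (P k) = α k ∧ θ (Q k) = β k)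
    (X Y : ℕ → ℤ → (Matrix (Fin n) (Fin n) ℤ)ˣ) (hX : ∀ i, IsUniPoly fun k => (X i k).1)
    (hY : ∀ i, IsUniPoly fun k => (Y i k).1) (b₀ : (Matrix (Fin n) (Fin n) ℤ)ˣ)
    (h0 : ∀ i j, j < i → b₀.1 i j = 0) (h1 : ∀ i, b₀.1 i i = 1) :
    ∃ (θ : Γ →* ((ℤ → Fin n → ℤ) ≃ₗ[ℤ] (ℤ → Fin n → ℤ))) (b : ℤ → (Matrix (Fin n) (Fin n) ℤ)ˣ)
      (H : ℕ), 2 ≤ H ∧ (∀ x, θ x ∈ (polyFlag n H).unipotent) ∧ θ (P 0) = shiftEquiv n ∧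
      θ (Q 0) = (pointwise n b)⁻¹ ∧ b 0 = b₀ ∧
      ∀ i < g, θ (P (i + 1)) = pointwise n (X i) ∧ θ (Q (i + 1)) = (pointwise n (Y i))⁻¹ := by
  let f : ℕ → ℤ → (Matrix (Fin n) (Fin n) ℤ)ˣ := fun i => X i * Y i * (X i)⁻¹ * (Y i)⁻¹
  have hf : ∀ i, IsUniPoly fun k => (f i k).1 := fun i =>
    (((hX i).mul (hY i)).mul (hX i).inv).mul (hY i).inv
  -- As conjugation by the shift turns `b k` into `b (k + 1)`, the surface relation reads `b (k + 1)
  -- * (b k)⁻¹ * (∏ f) k = 1`, which is this recursion. Its initial value is free.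
  obtain ⟨b, hb0, hb⟩ := exists_cocycle ((List.range g).map f).prod b₀
  have hbu : IsUniPoly fun k => (b k).1 :=
    (IsUniPoly.list_prod (List.range g) f hf).of_recursion
      (fun k => by rw [← Units.val_mul, hb]) (by rw [hb0]; exact h0) (by rw [hb0]; exact h1)
  let α : ℕ → ((ℤ → Fin n → ℤ) ≃ₗ[ℤ] (ℤ → Fin n → ℤ)) := fun k =>
    match k with
    | 0 => shiftEquiv n
    | i + 1 => pointwise n (X i)
  let β : ℕ → ((ℤ → Fin n → ℤ) ≃ₗ[ℤ] (ℤ → Fin n → ℤ)) := fun k =>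
    match k with
    | 0 => (pointwise n b)⁻¹
    | i + 1 => (pointwise n (Y i))⁻¹
  obtain ⟨θ, hθ⟩ := huniv _ α β (by
      rw [List.range_succ_eq_map, List.map_cons, List.prod_cons, List.map_map]
      have e : ((fun k => α k * (β k)⁻¹ * (α k)⁻¹ * β k) ∘ Nat.succ) =
          fun i => pointwise n (f i) := by
        ext1 i
        simp only [Function.comp_apply, f, α, β, map_mul, map_inv, inv_inv]
      have e1 : α 0 * (β 0)⁻¹ * (α 0)⁻¹ * β 0 =
          shiftEquiv n * pointwise n b * (shiftEquiv n)⁻¹ * (pointwise n b)⁻¹ := by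
        simp only [α, β, inv_inv]
      have e2 := shift_conj (n := n) 1 b
      rw [zpow_one] at e2
      have e3 : ((List.range g).map fun i => pointwise n (f i)).prod =
          pointwise n ((List.range g).map f).prod := by
        rw [map_list_prod, List.map_map]
        rfl
      rw [e, e1, e2, e3, ← map_inv, ← map_mul, ← map_mul, ← map_one (pointwise n)]
      congr 1
      ext1 k
      simp only [Pi.mul_apply, Pi.inv_apply, Pi.one_apply]
      rw [← hb k]
      group)
  have hH : ∀ᶠ H in atTop, pointwise n b ∈ (polyFlag n H).unipotent ∧
      ∀ i ∈ Finset.range g, pointwise n (X i) ∈ (polyFlag n H).unipotent ∧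
        pointwise n (Y i) ∈ (polyFlag n H).unipotent :=
    (eventually_pointwise_mem_unipotent hbu).and ((Finset.range g).eventually_all.2 fun i _ =>
      (eventually_pointwise_mem_unipotent (hX i)).and (eventually_pointwise_mem_unipotent (hY i)))
  -- There are finitely many generators, so one weight `H` serves all of them.
  obtain ⟨H, ⟨hHb, hH⟩, hH2⟩ := (hH.and (eventually_ge_atTop 2)).exists
  refine ⟨θ, b, H, hH2, fun x => ?_, (hθ 0 (by omega)).1, (hθ 0 (by omega)).2, hb0,
    fun i hi => hθ (i + 1) (by omega)⟩
  suffices h : (⊤ : Subgroup Γ) ≤ (polyFlag n H).unipotent.comap θ from h (Subgroup.mem_top x)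
  rw [← hgen, Subgroup.closure_le]
  rintro _ (⟨k, hk, rfl⟩ | ⟨k, hk, rfl⟩)
  · change θ (P k) ∈ (polyFlag n H).unipotent
    rw [(hθ k hk).1]
    cases k with
    | zero => exact shiftEquiv_mem_unipotent n H
    | succ i => exact (hH i (Finset.mem_range.2 (by simpa using hk))).1
  · change θ (Q k) ∈ (polyFlag n H).unipotent
    rw [(hθ k hk).2]
    cases k with
    | zero => exact Subgroup.inv_mem _ hHb
    | succ i => exact Subgroup.inv_mem _ (hH i (Finset.mem_range.2 (by simpa using hk))).2

/-! ### A normal form in surface groups -/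

/-- The letters of the normal form: `none` stands for the inverse of the second generator, and the
others for the conjugates of the remaining generators by the powers of the first. -/
abbrev SurfaceLetter (g : ℕ) : Type := Option ((Fin g × Bool) × ℤ)

/-- The element of the group that a letter stands for. -/
def SurfaceLetter.eval {Γ : Type*} [Group Γ] {g : ℕ} (P Q : ℕ → Γ) : SurfaceLetter g → Γ
  | none => (Q 0)⁻¹
  | some ((i, true), m) => P 0 ^ m * P (i + 1) * (P 0 ^ m)⁻¹
  | some ((i, false), m) => P 0 ^ m * (Q (i + 1))⁻¹ * (P 0 ^ m)⁻¹

/-- The subgroup is the image of a free product of copies of `ℤ`, whose reduced words have the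
required form. -/
theorem exists_syllables {Γ ι : Type*} [Group Γ] (f : ι → Γ) {x : Γ}
    (hx : x ∈ Subgroup.closure (range f)) :
    ∃ l : List (ι × ℤ), x = (l.map fun s => f s.1 ^ s.2).prod ∧ (∀ s ∈ l, s.2 ≠ 0) ∧
      l.IsChain fun s s' => s.1 ≠ s'.1 := by
  classical
  let φ : Monoid.CoprodI (fun _ : ι => Multiplicative ℤ) →* Γ :=
    Monoid.CoprodI.lift fun i => zpowersHom Γ (f i)
  have hφ : Subgroup.closure (range f) ≤ φ.range := by
    rw [Subgroup.closure_le]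
    rintro _ ⟨i, rfl⟩
    exact ⟨Monoid.CoprodI.of (i := i) (Multiplicative.ofAdd 1), by simp [φ]⟩
  obtain ⟨w, rfl⟩ := hφ hx
  obtain ⟨w, rfl⟩ := Monoid.CoprodI.Word.equiv.symm.surjective w
  refine ⟨w.toList.map fun s => (s.1, Multiplicative.toAdd s.2), ?_, ?_, ?_⟩
  · change φ w.prod = _
    rw [Monoid.CoprodI.Word.prod, map_list_prod, List.map_map, List.map_map]
    congr 2
  · intro s hs
    obtain ⟨s', hs', rfl⟩ := List.mem_map.1 hs
    exact fun h => w.ne_one s' hs' h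
  · rw [List.isChain_map]
    exact w.chain_ne

/-- The subgroup `R` generated by the letters is normalised by `P 0`, so every element is in `R`
times a power of `P 0`. For the letter `(Q 0)⁻¹` this uses the relation: conjugation by `P 0`
multiplies it by `w⁻¹`, where `w` is the product of the other commutators, and all conjugates of `w`
by powers of `P 0` lie in `R`. -/
theorem exists_surface_normalForm {Γ : Type*} [Group Γ] {g : ℕ} (P Q : ℕ → Γ)
    (hgen : Subgroup.closure (P '' Iio (g + 1) ∪ Q '' Iio (g + 1)) = ⊤)
    (hrel : ((List.range (g + 1)).map fun k => P k * (Q k)⁻¹ * (P k)⁻¹ * Q k).prod = 1) (x : Γ) :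
    ∃ (l : List (SurfaceLetter g × ℤ)) (r : ℤ),
      x = (l.map fun s => SurfaceLetter.eval P Q s.1 ^ s.2).prod * P 0 ^ r ∧ (∀ s ∈ l, s.2 ≠ 0) ∧
      l.IsChain fun s s' => s.1 ≠ s'.1 := by
  set R := Subgroup.closure (range (SurfaceLetter.eval (g := g) P Q)) with hR
  have hmem : ∀ y : SurfaceLetter g, y.eval P Q ∈ R := fun y => Subgroup.subset_closure ⟨y, rfl⟩
  have hB : Q 0 ∈ R := R.inv_mem_iff.1 (hmem none)
  have hPR : ∀ i < g, P (i + 1) ∈ R := fun i hi => by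
    simpa [SurfaceLetter.eval] using hmem (some ((⟨i, hi⟩, true), 0))
  have hQR : ∀ i < g, Q (i + 1) ∈ R := fun i hi => by
    simpa [SurfaceLetter.eval] using hmem (some ((⟨i, hi⟩, false), 0))
  obtain ⟨w, hRel, hRelR, hrel'⟩ : ∃ w : Γ, w ∈ R ∧ (∀ m : ℤ, P 0 ^ m * w * (P 0 ^ m)⁻¹ ∈ R) ∧
      P 0 * (Q 0)⁻¹ * (P 0)⁻¹ = w⁻¹ * (Q 0)⁻¹ := by
    rw [List.range_succ_eq_map, List.map_cons, List.prod_cons, List.map_map] at hrel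
    have hconj : ∀ m : ℤ, P 0 ^ m * ((List.range g).map ((fun k => P k * (Q k)⁻¹ * (P k)⁻¹ * Q k) ∘
        Nat.succ)).prod * (P 0 ^ m)⁻¹ ∈ R := by
      intro m
      rw [← MulAut.conj_apply, map_list_prod, List.map_map]
      refine R.list_prod_mem fun y hy => ?_
      obtain ⟨i, hi, rfl⟩ := List.mem_map.1 hy
      have hi : i < g := List.mem_range.1 hi
      have h1 := hmem (some ((⟨i, hi⟩, true), m))
      have h2 := hmem (some ((⟨i, hi⟩, false), m))
      have h3 := R.mul_mem (R.mul_mem (R.mul_mem h1 h2) (R.inv_mem h1)) (R.inv_mem h2)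
      convert h3 using 1
      simp only [Function.comp_apply, SurfaceLetter.eval, MulAut.conj_apply, Nat.succ_eq_add_one]
      group
    refine ⟨_, by simpa using hconj 0, hconj, ?_⟩
    rw [eq_inv_mul_iff_mul_eq, ← mul_eq_one_iff_eq_inv]
    rw [mul_eq_one_iff_eq_inv] at hrel
    have := mul_eq_one_iff_inv_eq.2 hrel.symm
    rw [← this]
    group
  have hstep : ∀ y ∈ R, P 0 * y * (P 0)⁻¹ ∈ R := by
    intro y hy
    suffices h : R ≤ R.comap (MulAut.conj (P 0)).toMonoidHom from h hy
    conv_lhs => rw [hR]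
    rw [Subgroup.closure_le]
    rintro _ ⟨_ | ⟨⟨i, _ | _⟩, m⟩, rfl⟩
    · change P 0 * (Q 0)⁻¹ * (P 0)⁻¹ ∈ R
      rw [hrel']
      exact R.mul_mem (R.inv_mem hRel) (R.inv_mem hB)
    · have := hmem (some ((i, false), 1 + m))
      change P 0 * (P 0 ^ m * (Q (i + 1))⁻¹ * (P 0 ^ m)⁻¹) * (P 0)⁻¹ ∈ R
      convert this using 1
      simp only [SurfaceLetter.eval, zpow_one_add]
      group
    · have := hmem (some ((i, true), 1 + m))
      change P 0 * (P 0 ^ m * P (i + 1) * (P 0 ^ m)⁻¹) * (P 0)⁻¹ ∈ R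
      convert this using 1
      simp only [SurfaceLetter.eval, zpow_one_add]
      group
  have hstep' : ∀ y ∈ R, (P 0)⁻¹ * y * P 0 ∈ R := by
    intro y hy
    suffices h : R ≤ R.comap (MulAut.conj (P 0)⁻¹).toMonoidHom by
      have := h hy
      simpa using this
    conv_lhs => rw [hR]
    rw [Subgroup.closure_le]
    rintro _ ⟨_ | ⟨⟨i, _ | _⟩, m⟩, rfl⟩
    · change (P 0)⁻¹ * (Q 0)⁻¹ * (P 0)⁻¹⁻¹ ∈ R
      have h1 := hRelR (-1)
      -- The relation solved for the opposite conjugation; here a conjugate of `w` itself occurs.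
      have h2 : (P 0)⁻¹ * (Q 0)⁻¹ * (P 0)⁻¹⁻¹ = P 0 ^ (-1 : ℤ) * w * (P 0 ^ (-1 : ℤ))⁻¹ * (Q 0)⁻¹ := by
        have h3 : w * P 0 * (Q 0)⁻¹ = (Q 0)⁻¹ * P 0 := by
          rw [eq_inv_mul_iff_mul_eq] at hrel'
          have := congrArg (· * P 0) hrel'
          simpa [mul_assoc] using this
        simp only [zpow_neg, zpow_one, inv_inv]
        rw [mul_assoc, ← h3]
        group
      rw [h2]
      exact R.mul_mem h1 (R.inv_mem hB)
    · have := hmem (some ((i, false), -1 + m))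
      change (P 0)⁻¹ * (P 0 ^ m * (Q (i + 1))⁻¹ * (P 0 ^ m)⁻¹) * (P 0)⁻¹⁻¹ ∈ R
      convert this using 1
      simp only [SurfaceLetter.eval, zpow_add]
      group
    · have := hmem (some ((i, true), -1 + m))
      change (P 0)⁻¹ * (P 0 ^ m * P (i + 1) * (P 0 ^ m)⁻¹) * (P 0)⁻¹⁻¹ ∈ R
      convert this using 1
      simp only [SurfaceLetter.eval, zpow_add]
      group
  have hpow : ∀ (r : ℤ), ∀ y ∈ R, P 0 ^ r * y * (P 0 ^ r)⁻¹ ∈ R := by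
    intro r
    induction r using Int.induction_on with
    | zero => simp
    | succ i ih =>
      intro y hy
      have := ih _ (hstep y hy)
      convert this using 1
      rw [zpow_add_one]
      group
    | pred i ih =>
      intro y hy
      have := ih _ (hstep' y hy)
      convert this using 1
      rw [zpow_sub_one]
      group
  have key : ∃ f ∈ R, ∃ r : ℤ, x = f * P 0 ^ r := by
    have hx : x ∈ Subgroup.closure (P '' Iio (g + 1) ∪ Q '' Iio (g + 1)) := by
      rw [hgen]; exact Subgroup.mem_top x
    induction hx using Subgroup.closure_induction with
    | mem y hy =>
      rcases hy with ⟨k, hk, rfl⟩ | ⟨k, hk, rfl⟩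
      · cases k with
        | zero => exact ⟨1, R.one_mem, 1, by simp⟩
        | succ i => exact ⟨_, hPR i (by simpa using hk), 0, by simp⟩
      · cases k with
        | zero => exact ⟨_, hB, 0, by simp⟩
        | succ i => exact ⟨_, hQR i (by simpa using hk), 0, by simp⟩
    | one => exact ⟨1, R.one_mem, 0, by simp⟩
    | mul y z _ _ hy hz =>
      obtain ⟨f, hf, r, rfl⟩ := hy
      obtain ⟨f', hf', r', rfl⟩ := hz
      refine ⟨f * (P 0 ^ r * f' * (P 0 ^ r)⁻¹), R.mul_mem hf (hpow r f' hf'), r + r', ?_⟩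
      rw [zpow_add]
      group
    | inv y _ hy =>
      obtain ⟨f, hf, r, rfl⟩ := hy
      refine ⟨_, hpow (-r) _ (R.inv_mem hf), -r, ?_⟩
      group
  obtain ⟨f, hf, r, rfl⟩ := key
  obtain ⟨l, h1, h2, h3⟩ := exists_syllables _ hf
  exact ⟨l, r, by rw [h1], h2, h3⟩

/-! ### Superdiagonal matrices -/

/-- The matrix with the given entries above the diagonal. -/
def superdiag (n : ℕ) (χ : ℕ → ℤ) : Matrix (Fin n) (Fin n) ℤ :=
  Matrix.of fun i j => if j.1 = i.1 + 1 then χ i else 0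

theorem superdiag_apply (n : ℕ) (χ : ℕ → ℤ) (i j : Fin n) :
    superdiag n χ i j = if j.1 = i.1 + 1 then χ i else 0 := rfl

theorem one_add_superdiag_lower (n : ℕ) (χ : ℕ → ℤ) (i j : Fin n) (h : j < i) :
    (1 + superdiag n χ) i j = 0 := by
  have h' : j.1 < i.1 := h
  rw [Matrix.add_apply, Matrix.one_apply_ne h.ne', superdiag_apply, if_neg (by omega), add_zero]

theorem one_add_superdiag_diag (n : ℕ) (χ : ℕ → ℤ) (i : Fin n) :
    (1 + superdiag n χ) i i = 1 := by
  rw [Matrix.add_apply, Matrix.one_apply_eq, superdiag_apply, if_neg (by omega), add_zero]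

theorem exists_superdiag_unit (n : ℕ) (χ : ℕ → ℤ) :
    ∃ u : (Matrix (Fin n) (Fin n) ℤ)ˣ, u.1 = 1 + superdiag n χ := by
  have h : IsUnit (1 + superdiag n χ) := by
    rw [Matrix.isUnit_iff_isUnit_det, Matrix.det_of_isUpperTriangular fun i j h =>
      one_add_superdiag_lower n χ i j h]
    simp only [one_add_superdiag_diag, Finset.prod_const_one, isUnit_one]
  exact h

theorem isUniPoly_superdiag {n : ℕ} {χ : ℤ → ℕ → ℤ} (h : ∀ i, (fun k => χ k i) ∈ polyRing) :
    IsUniPoly fun k => 1 + superdiag n (χ k) where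
  lower i j hij k := one_add_superdiag_lower n _ i j hij
  diag i k := one_add_superdiag_diag n _ i
  poly i j := by
    have e : (fun k => (1 + superdiag n (χ k)) i j) = (fun _ => (1 : Matrix (Fin n) (Fin n) ℤ) i j) +
        (fun k => superdiag n (χ k) i j) := rfl
    rw [e]
    refine polyRing.add_mem (const_mem_polyRing _) ?_
    simp only [superdiag_apply]
    split_ifs
    · exact h i
    · exact const_mem_polyRing 0

theorem superdiag_sq {n : ℕ} {χ : ℕ → ℤ} (h : ∀ i, i + 2 < n → χ i * χ (i + 1) = 0) :
    superdiag n χ * superdiag n χ = 0 := by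
  ext i j
  rw [Matrix.mul_apply, Matrix.zero_apply]
  refine Finset.sum_eq_zero fun l _ => ?_
  rw [superdiag_apply, superdiag_apply]
  split_ifs with h1 h2
  · rw [h1]; exact h i (by have := j.2; omega)
  · simp
  · simp
  · simp

theorem unit_zpow_of_sq_eq_zero {R : Type*} [Ring R] {u : Rˣ} {N : R} (hu : u.1 = 1 + N)
    (hN : N * N = 0) (e : ℤ) : (u ^ e).1 = 1 + e • N := by
  have hinv : u⁻¹.1 = 1 - N := by
    rw [Units.inv_eq_of_mul_eq_one_right]
    rw [hu, mul_sub, add_mul, add_mul, hN]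
    simp
  induction e using Int.induction_on with
  | zero => simp
  | succ i ih =>
    rw [zpow_add_one, Units.val_mul, ih, hu, mul_add, add_mul, add_mul, smul_mul_assoc, smul_mul_assoc,
      hN, add_smul]
    simp only [mul_one, one_mul, smul_zero, add_zero, one_smul, add_assoc]
  | pred i ih =>
    rw [zpow_sub_one, Units.val_mul, ih, hinv, mul_sub, add_mul, add_mul, smul_mul_assoc, smul_mul_assoc,
      hN, sub_smul]
    simp only [mul_one, one_mul, smul_zero, add_zero, one_smul, add_sub_assoc]

theorem superdiag_mulVec (N : ℕ) (χ : ℕ → ℤ) (v : Fin (N + 1) → ℤ) (i : ℕ) (hi : i < N) :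
    (superdiag (N + 1) χ).mulVec v ⟨i, by omega⟩ = χ i * v ⟨i + 1, by omega⟩ := by
  rw [Matrix.mulVec, dotProduct, Finset.sum_eq_single ⟨i + 1, by omega⟩]
  · simp [superdiag_apply]
  · intro j _ hj
    rw [superdiag_apply, if_neg (fun h => hj (Fin.ext h)), zero_mul]
  · simp

/-- A product of powers of unitriangular matrices that detect the successive letters of a word is
nontrivial on the last basis vector. -/
theorem word_mulVec_ne {ι : Type*} (l : List (ι × ℤ)) (hl : ∀ s ∈ l, s.2 ≠ 0)
    (hchain : l.IsChain fun s s' => s.1 ≠ s'.1) (χ : ι → ℕ → ℤ)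
    (h1 : ∀ i (hi : i < l.length), χ l[i].1 i ≠ 0)
    (h2 : ∀ i (hi : i < l.length), ∀ s ∈ l, χ s.1 i ≠ 0 → s.1 = l[i].1)
    (u : ι → (Matrix (Fin (l.length + 1)) (Fin (l.length + 1)) ℤ)ˣ)
    (hu : ∀ y, (u y).1 = 1 + superdiag (l.length + 1) (χ y)) :
    ((l.map fun s => u s.1 ^ s.2).prod).1.mulVec (Pi.single (Fin.last _) 1) 0 ≠ 0 := by
  -- Neighbouring letters of the word differ, so no letter has two consecutive nonzero entries. The
  -- nilpotent part then has square zero, and powers are linear in the exponent.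
  have hsq : ∀ s ∈ l, superdiag (l.length + 1) (χ s.1) * superdiag (l.length + 1) (χ s.1) = 0 := by
    intro s hs
    refine superdiag_sq fun i hi => ?_
    by_contra h
    have ha := h2 i (by omega) s hs (left_ne_zero_of_mul h)
    have hb := h2 (i + 1) (by omega) s hs (right_ne_zero_of_mul h)
    exact (List.isChain_iff_getElem.1 hchain i (by omega)) (ha.symm.trans hb)
  -- Each letter of the word, read from the right, moves the first nonzero coordinate of the last
  -- basis vector up by exactly one place.
  suffices key : ∀ s p : List (ι × ℤ), l = p ++ s → ∀ i : Fin (l.length + 1),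
      (i.1 < p.length → ((s.map fun s => u s.1 ^ s.2).prod).1.mulVec
        (Pi.single (Fin.last _) 1) i = 0) ∧
      (i.1 = p.length → ((s.map fun s => u s.1 ^ s.2).prod).1.mulVec
        (Pi.single (Fin.last _) 1) i ≠ 0) from (key l [] rfl 0).2 rfl
  intro s
  induction s with
  | nil =>
    intro p hp i
    rw [List.append_nil] at hp
    subst hp
    simp only [List.map_nil, List.prod_nil, Units.val_one, Matrix.one_mulVec]
    refine ⟨fun h => Pi.single_eq_of_ne (fun h' => ?_) _, fun h => ?_⟩
    · rw [h'] at h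
      simp at h
    · have : i = Fin.last _ := Fin.ext h
      rw [this, Pi.single_eq_same]
      exact one_ne_zero
  | cons a s ih =>
    intro p hp i
    have ih' := ih (p ++ [a]) (by rw [hp]; simp)
    have ha : a ∈ l := by rw [hp]; simp
    have hlen : p.length < l.length := by rw [hp]; simp
    have hget : l[p.length] = a := by simp [hp]
    rw [List.map_cons, List.prod_cons, Units.val_mul, ← Matrix.mulVec_mulVec,
      unit_zpow_of_sq_eq_zero (hu a.1) (hsq a ha)]
    set w := ((s.map fun s => u s.1 ^ s.2).prod).1.mulVec (Pi.single (Fin.last _) 1) with hw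
    have e : ∀ hi : i.1 < l.length, ((1 + a.2 • superdiag (l.length + 1) (χ a.1)).mulVec w) i =
        w i + a.2 * (χ a.1 i * w ⟨i + 1, by omega⟩) := by
      intro hi
      rw [Matrix.add_mulVec, Matrix.one_mulVec, Matrix.smul_mulVec, Pi.add_apply, Pi.smul_apply,
        ← superdiag_mulVec _ _ _ _ hi, smul_eq_mul]
    refine ⟨fun h => ?_, fun h => ?_⟩
    · rw [e (by omega), (ih' i).1 (by simp; omega), (ih' ⟨i + 1, by omega⟩).1 (by simpa using h)]
      simp
    · rw [e (by omega), (ih' i).1 (by simp; omega), zero_add]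
      refine mul_ne_zero (hl a ha) (mul_ne_zero ?_ ((ih' ⟨i + 1, by omega⟩).2 (by simp [h])))
      have := h1 p.length hlen
      rwa [hget, ← h] at this

/-! ### Detecting letters -/

open Classical in
/-- A function of the second letter, polynomial in its exponent, that detects the first letter. -/
noncomputable def detect {g : ℕ} (T : Finset ℤ) : SurfaceLetter g → SurfaceLetter g → ℤ
  | none, none => 1
  | some (z, m), some (z', m') => if z = z' then ∏ k ∈ T.erase m, (m' - k) else 0
  | _, _ => 0

theorem detect_self {g : ℕ} (T : Finset ℤ) (y : SurfaceLetter g) : detect T y y ≠ 0 := by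
  rcases y with _ | ⟨z, m⟩
  · simp [detect]
  · simp only [detect, if_true]
    exact Finset.prod_ne_zero_iff.2 fun k hk h => Finset.ne_of_mem_erase hk (sub_eq_zero.1 h).symm

/-- The product over `T.erase m` vanishes at every exponent of `T` other than `m`, as for Lagrange
interpolation without the denominator. -/
theorem eq_of_detect {g : ℕ} {T : Finset ℤ} {y y' : SurfaceLetter g}
    (hy : ∀ z m, y' = some (z, m) → m ∈ T) (h : detect T y y' ≠ 0) : y' = y := by
  rcases y with _ | ⟨z, m⟩ <;> rcases y' with _ | ⟨z', m'⟩
  · rfl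
  · simp [detect] at h
  · simp [detect] at h
  · simp only [detect] at h
    split_ifs at h with hz
    · by_contra hne
      refine h (Finset.prod_eq_zero (i := m') (Finset.mem_erase.2 ⟨fun hm => ?_, hy _ _ rfl⟩) (sub_self _))
      exact hne (by rw [hz, hm])
    · exact absurd rfl h

theorem detect_mem_polyRing {g : ℕ} (T : Finset ℤ) (y : SurfaceLetter g) (z : Fin g × Bool) :
    (fun m => detect T y (some (z, m))) ∈ polyRing := by
  rcases y with _ | ⟨z', m'⟩
  · exact const_mem_polyRing 0
  · simp only [detect]
    split_ifs
    · have : (fun m : ℤ => ∏ k ∈ T.erase m', (m - k)) = ∏ k ∈ T.erase m', fun m : ℤ => m - k := by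
        ext m; simp
      rw [this]
      exact polyRing.prod_mem fun k _ => sub_const_mem_polyRing k
    · exact const_mem_polyRing 0

/-- Groups with the presentation of a surface group are residually torsion-free nilpotent and
residually `p`. -/
theorem surface_residual {Γ : Type*} [Group Γ] {g : ℕ} (P Q : ℕ → Γ)
    (hgen : Subgroup.closure (P '' Iio (g + 1) ∪ Q '' Iio (g + 1)) = ⊤)
    (hrel : ((List.range (g + 1)).map fun k => P k * (Q k)⁻¹ * (P k)⁻¹ * Q k).prod = 1)
    (huniv : ∀ (K : Type) [Group K] (α β : ℕ → K),
      ((List.range (g + 1)).map fun k => α k * (β k)⁻¹ * (α k)⁻¹ * β k).prod = 1 →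
      ∃ θ : Γ →* K, ∀ k < g + 1, θ (P k) = α k ∧ θ (Q k) = β k) :
    IsResiduallyTorsionFreeNilpotent Γ ∧ ∀ p : ℕ, p.Prime → IsResiduallyP p Γ := by
  classical
  suffices key : ∀ x : Γ, x ≠ 1 → ∃ (n H : ℕ) (θ : Γ →* ((ℤ → Fin n → ℤ) ≃ₗ[ℤ] (ℤ → Fin n → ℤ))),
      (∀ x, θ x ∈ (polyFlag n H).unipotent) ∧ ∃ v ∈ (polyFlag n H).L 0, θ x v ≠ v by
    refine ⟨fun x hx => ?_, fun p hp x hx => ?_⟩ <;>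
    obtain ⟨n, H, θ, hθ, v, hv, hxv⟩ := key x hx <;>
    obtain ⟨ι, hι⟩ := exists_embedding_polyFlag n H
    · exact ((polyFlag n H).residual hθ ι hι hv hxv).1
    · exact ((polyFlag n H).residual hθ ι hι hv hxv).2 p hp
  intro x hx
  obtain ⟨l, r, rfl, hl, hchain⟩ := exists_surface_normalForm P Q hgen hrel x
  rcases eq_or_ne r 0 with rfl | hr
  · rw [zpow_zero, mul_one] at hx ⊢
    have hl0 : l ≠ [] := by
      rintro rfl
      exact hx rfl
    let T : Finset ℤ := (l.filterMap fun s => s.1.map Prod.snd).toFinset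
    have hT : ∀ s ∈ l, ∀ z m, s.1 = some (z, m) → m ∈ T := by
      intro s hs z m h
      simp only [T, List.mem_toFinset, List.mem_filterMap]
      exact ⟨s, hs, by rw [h]; rfl⟩
    -- The `i`-th superdiagonal entry detects the `i`-th letter of the word among the letters that
    -- occur, and is polynomial in the conjugating exponent.
    let χ : SurfaceLetter g → ℕ → ℤ := fun y i =>
      if h : i < l.length then detect T l[i].1 y else 0
    have hχp : ∀ z i, (fun m => χ (some (z, m)) i) ∈ polyRing := by
      intro z i
      simp only [χ]
      split_ifs
      · exact detect_mem_polyRing T _ z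
      · exact const_mem_polyRing 0
    choose u hu using fun y => exists_superdiag_unit (l.length + 1) (χ y)
    let Z : Bool → ℕ → ℤ → (Matrix (Fin (l.length + 1)) (Fin (l.length + 1)) ℤ)ˣ := fun c i m =>
      if h : i < g then u (some ((⟨i, h⟩, c), m)) else 1
    have hZ : ∀ c i, IsUniPoly fun m => (Z c i m).1 := by
      intro c i
      by_cases h : i < g
      · simp only [Z, dif_pos h, hu]
        exact isUniPoly_superdiag (hχp _)
      · simp only [Z, dif_neg h]
        exact IsUniPoly.one
    -- Conjugation by `P 0 ^ m` shifts the argument by `m`, so at the argument `0` the letter with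
    -- exponent `m` acts by its own matrix; the free initial value `b 0` gives the letter `none` its
    -- matrix.
    obtain ⟨θ, b, H, hH, hθ, hP0, hQ0, hb, hPQ⟩ := exists_unipotent_representation P Q hgen huniv
      (Z true) (Z false) (hZ true) (hZ false) (u none)
      (fun i j hij => by rw [hu]; exact one_add_superdiag_lower _ _ i j hij)
      (fun i => by rw [hu]; exact one_add_superdiag_diag _ _ i)
    have hlet : ∀ y : SurfaceLetter g, ∃ f : ℤ → (Matrix (Fin (l.length + 1))
        (Fin (l.length + 1)) ℤ)ˣ, θ (y.eval P Q) = pointwise _ f ∧ f 0 = u y := by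
      rintro (_ | ⟨⟨i, _ | _⟩, m⟩)
      · refine ⟨b, ?_, hb⟩
        rw [SurfaceLetter.eval, map_inv, hQ0, inv_inv]
      · refine ⟨fun k => Z false i (k + m), ?_, ?_⟩
        · rw [SurfaceLetter.eval, map_mul, map_mul, map_inv, map_inv, map_zpow, hP0, (hPQ i i.2).2,
            inv_inv, shift_conj]
        · simp only [Z, zero_add, dif_pos i.2]
      · refine ⟨fun k => Z true i (k + m), ?_, ?_⟩
        · rw [SurfaceLetter.eval, map_mul, map_mul, map_inv, map_zpow, hP0, (hPQ i i.2).1,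
            shift_conj]
        · simp only [Z, zero_add, dif_pos i.2]
    choose f hf hf0 using hlet
    have hword : θ (l.map fun s => SurfaceLetter.eval P Q s.1 ^ s.2).prod =
        pointwise _ (l.map fun s => f s.1 ^ s.2).prod := by
      rw [map_list_prod, map_list_prod, List.map_map, List.map_map]
      congr 2
      ext1 s
      simp only [Function.comp_apply, map_zpow, hf]
    have hword0 : (l.map fun s => f s.1 ^ s.2).prod 0 = (l.map fun s => u s.1 ^ s.2).prod := by
      rw [Pi.list_prod_apply, List.map_map]
      congr 2
      ext1 s
      simp only [Function.comp_apply, Pi.pow_apply, hf0]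
    have hne := word_mulVec_ne l hl hchain χ
      (fun i hi => by simp only [χ, dif_pos hi]; exact detect_self T _)
      (fun i hi s hs h => by
        simp only [χ, dif_pos hi] at h
        exact eq_of_detect (hT s hs) h) u hu
    -- The test vector is the constant last basis vector. Its coordinate `0` vanishes since the word
    -- is nonempty, while that of its image at the argument `0` does not.
    refine ⟨l.length + 1, H, θ, hθ, fun _ => Pi.single (Fin.last _) 1, fun i => ?_, fun h => hne ?_⟩
    · refine polyFun_mono ?_ (const_mem_polyFun _)
      have : 0 < H * (l.length + 1 - i) := Nat.mul_pos (by omega) (by have := i.2; omega)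
      omega
    · have h0 := congrFun (congrFun h 0) 0
      rw [hword, pointwise_apply, hword0] at h0
      rw [h0]
      refine Pi.single_eq_of_ne (fun h => hl0 ?_) _
      have := congrArg Fin.val h
      simp at this
      exact List.length_eq_zero_iff.1 this.symm
  -- For `r ≠ 0` only `P 0` acts, by the shift; the word acts trivially, and the function `k ↦ k` is
  -- moved by `r`.
  · let α : ℕ → ((ℤ → Fin 1 → ℤ) ≃ₗ[ℤ] (ℤ → Fin 1 → ℤ)) := fun k =>
      if k = 0 then shiftEquiv 1 else 1
    have hprod : ((List.range (g + 1)).map fun k => α k * (1 : (ℤ → Fin 1 → ℤ) ≃ₗ[ℤ] _)⁻¹ *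
        (α k)⁻¹ * 1).prod = 1 := List.prod_eq_one fun y hy => by
      obtain ⟨k, -, rfl⟩ := List.mem_map.1 hy
      simp
    obtain ⟨θ, hθ⟩ := huniv _ α (fun _ => 1) hprod
    have hα : ∀ k, α k ∈ (polyFlag 1 2).unipotent := by
      intro k
      simp only [α]
      split_ifs
      · exact shiftEquiv_mem_unipotent 1 2
      · exact Subgroup.one_mem _
    have hu : ∀ x, θ x ∈ (polyFlag 1 2).unipotent := by
      intro x
      suffices h : (⊤ : Subgroup Γ) ≤ (polyFlag 1 2).unipotent.comap θ from h (Subgroup.mem_top x)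
      rw [← hgen, Subgroup.closure_le]
      rintro _ (⟨k, hk, rfl⟩ | ⟨k, hk, rfl⟩)
      · change θ (P k) ∈ (polyFlag 1 2).unipotent
        rw [(hθ k hk).1]
        exact hα k
      · change θ (Q k) ∈ (polyFlag 1 2).unipotent
        rw [(hθ k hk).2]
        exact Subgroup.one_mem _
    have hlet : ∀ y : SurfaceLetter g, θ (y.eval P Q) = 1 := by
      rintro (_ | ⟨⟨i, _ | _⟩, m⟩)
      · rw [SurfaceLetter.eval, map_inv, (hθ 0 (by omega)).2, inv_one]
      · rw [SurfaceLetter.eval, map_mul, map_mul, map_inv, map_inv, (hθ (i + 1) (by omega)).2,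
          inv_one, mul_one, mul_inv_cancel]
      · rw [SurfaceLetter.eval, map_mul, map_mul, map_inv, (hθ (i + 1) (by omega)).1]
        simp [α]
    have hword : θ (l.map fun s => SurfaceLetter.eval P Q s.1 ^ s.2).prod = 1 := by
      rw [map_list_prod, List.map_map]
      refine List.prod_eq_one fun y hy => ?_
      obtain ⟨s, -, rfl⟩ := List.mem_map.1 hy
      simp only [Function.comp_apply, map_zpow, hlet, one_zpow]
    have hP0 : θ (P 0) = shiftEquiv 1 := (hθ 0 (by omega)).1
    refine ⟨1, 2, θ, hu, fun k _ => k, fun i => ?_, fun h => hr ?_⟩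
    · have hi : i = 0 := Subsingleton.elim _ _
      subst hi
      change (fun k : ℤ => k) ∈ polyFun 2
      rw [mem_polyFun_succ]
      convert const_mem_polyFun 1 using 1
      ext k
      simp [forwardDiff_apply]
    · have h0 := congrFun (congrFun h 0) 0
      rw [map_mul, hword, one_mul, map_zpow, hP0, shiftEquiv_zpow_apply, zero_add] at h0
      exact h0

/-! ### Faces of simplices -/

theorem stdSimplex_map_succAbove_self {n : ℕ} (i : Fin (n + 2)) (v : stdSimplex ℝ (Fin (n + 1))) :
    (stdSimplex.map i.succAbove v).1 i = 0 := by
  change stdSimplex.map i.succAbove v i = 0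
  rw [stdSimplex.map_coe, FunOnFinite.linearMap_apply_apply]
  exact Finset.sum_eq_zero fun j hj => absurd (Finset.mem_filter.1 hj).2 (Fin.succAbove_ne i j)

theorem stdSimplex_map_succAbove {n : ℕ} (i : Fin (n + 2)) (v : stdSimplex ℝ (Fin (n + 1)))
    (j : Fin (n + 1)) : (stdSimplex.map i.succAbove v).1 (i.succAbove j) = v.1 j := by
  change stdSimplex.map i.succAbove v (i.succAbove j) = v j
  rw [stdSimplex.map_coe, FunOnFinite.linearMap_apply_apply]
  rw [Finset.sum_eq_single j]
  · exact fun k hk hkj => absurd (Fin.succAbove_right_injective (Finset.mem_filter.1 hk).2) hkj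
  · simp

namespace SingularSimplex

variable {X Y : Type*} [TopologicalSpace X] [TopologicalSpace Y]

theorem face_apply {n : ℕ} (s : SingularSimplex X (n + 1)) (i : Fin (n + 2))
    (v : stdSimplex ℝ (Fin (n + 1))) : s.face i v = s (stdSimplex.map i.succAbove v) := rfl

theorem face_comp {n : ℕ} (f : C(X, Y)) (s : SingularSimplex X (n + 1)) (i : Fin (n + 2)) :
    face (f.comp s) i = f.comp (s.face i) := rfl

end SingularSimplex

theorem coboundary_one_apply {X : Type*} [TopologicalSpace X] (w : SingularCochain X 1)
    (τ : SingularSimplex X 2) :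
    coboundary X 1 w τ = w (τ.face 0) - w (τ.face 1) + w (τ.face 2) := by
  change ∑ i : Fin 3, (-1) ^ (i : ℕ) * w (τ.face i) = _
  rw [Fin.sum_univ_three]
  simp
  ring

/-! ### Cocycles of degree one and functors -/

theorem stdSimplex_mem (v : stdSimplex ℝ (Fin 2)) : v.1 1 ∈ I :=
  ⟨v.2.1 1, by
    have h0 := v.2.1 0
    have := v.2.2
    rw [Fin.sum_univ_two] at this
    linarith⟩

theorem stdSimplex_zero (v : stdSimplex ℝ (Fin 2)) : v.1 0 = 1 - v.1 1 := by
  have := v.2.2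
  rw [Fin.sum_univ_two] at this
  linarith

/-- A path as a singular simplex. -/
def Path.simplex {X : Type*} [TopologicalSpace X] {x y : X} (γ : Path x y) : SingularSimplex X 1 where
  toFun v := γ ⟨v.1 1, stdSimplex_mem v⟩
  continuous_toFun := by
    have h : Continuous fun v : stdSimplex ℝ (Fin 2) => v.1 1 :=
      (continuous_apply 1).comp continuous_subtype_val
    exact γ.continuous.comp (h.subtype_mk _)

theorem Path.simplex_apply {X : Type*} [TopologicalSpace X] {x y : X} (γ : Path x y)
    (v : stdSimplex ℝ (Fin 2)) : γ.simplex v = γ ⟨v.1 1, stdSimplex_mem v⟩ := rfl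

/-- A singular triangle given by a function of the last two barycentric coordinates. -/
def triangle {X : Type*} [TopologicalSpace X] (f : ℝ → ℝ → X) (hf : Continuous (Function.uncurry f)) :
    SingularSimplex X 2 where
  toFun v := f (v.1 1) (v.1 2)
  continuous_toFun := by
    have h : Continuous fun v : stdSimplex ℝ (Fin 3) => (v.1 1, v.1 2) :=
      ((continuous_apply 1).comp continuous_subtype_val).prodMk
        ((continuous_apply 2).comp continuous_subtype_val)
    exact hf.comp h

theorem triangle_apply {X : Type*} [TopologicalSpace X] (f : ℝ → ℝ → X)
    (hf : Continuous (Function.uncurry f)) (v : stdSimplex ℝ (Fin 3)) :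
    triangle f hf v = f (v.1 1) (v.1 2) := rfl

/-- The coboundary of a cochain on a triangle with given edges. -/
theorem coboundary_triangle {X : Type*} [TopologicalSpace X] (w : SingularCochain X 1)
    (f : ℝ → ℝ → X) (hf : Continuous (Function.uncurry f)) {a b c a' b' c' : X}
    (p : Path a b) (p' : Path b' c) (p'' : Path a' c') (h : ∀ s : I, p s = f s 0)
    (h' : ∀ s : I, p' s = f (1 - s) s) (h'' : ∀ s : I, p'' s = f 0 s) :
    coboundary X 1 w (triangle f hf) = w p'.simplex - w p''.simplex + w p.simplex := by
  rw [coboundary_one_apply]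
  congr 2
  · congr 1
    ext v
    have h1 := stdSimplex_map_succAbove 0 v 0
    have h2 := stdSimplex_map_succAbove 0 v 1
    rw [SingularSimplex.face_apply, triangle_apply, Path.simplex_apply, h']
    change f ((stdSimplex.map (Fin.succAbove 0) v).1 (Fin.succAbove 0 0))
      ((stdSimplex.map (Fin.succAbove 0) v).1 (Fin.succAbove 0 1)) = _
    rw [h1, h2, stdSimplex_zero]
  · congr 1
    ext v
    have h1 := stdSimplex_map_succAbove_self 1 v
    have h2 := stdSimplex_map_succAbove 1 v 1
    rw [SingularSimplex.face_apply, triangle_apply, Path.simplex_apply, h'']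
    change f _ ((stdSimplex.map (Fin.succAbove 1) v).1 (Fin.succAbove 1 1)) = _
    rw [h1, h2]
  · ext v
    have h1 := stdSimplex_map_succAbove_self 2 v
    have h2 := stdSimplex_map_succAbove 2 v 1
    rw [SingularSimplex.face_apply, triangle_apply, Path.simplex_apply, h]
    change f ((stdSimplex.map (Fin.succAbove 2) v).1 (Fin.succAbove 2 1)) _ = _
    rw [h1, h2]

theorem simplex_of_const {X : Type*} [TopologicalSpace X] {x y a : X} {γ : Path x y}
    (h : ∀ s, γ s = a) : γ.simplex = ContinuousMap.const _ a := by
  ext v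
  exact h _

/-- A constant triangle has three equal faces with signs `+ - +`. Hence a cocycle of degree one
vanishes on constant paths. -/
theorem cochain_const {X : Type*} [TopologicalSpace X] (w : SingularCochain X 1) (a : X) :
    coboundary X 1 w (ContinuousMap.const _ a) = w (ContinuousMap.const _ a) := by
  rw [coboundary_one_apply]
  change w (ContinuousMap.const _ a) - w (ContinuousMap.const _ a) + w (ContinuousMap.const _ a) = _
  ring

/-- A cocycle of degree one determines a functor to the integers. -/
theorem exists_pathFunctor_of_cocycle {X : Type*} [TopologicalSpace X] (w : SingularCochain X 1)
    (hw : ∀ τ, coboundary X 1 w τ = 0) : ∃ F : PathFunctor X (Multiplicative ℤ),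
      ∀ {x y : X} (γ : Path x y), F.path γ = Multiplicative.ofAdd (w γ.simplex) := by
  have hconst : ∀ {x y a : X} (γ : Path x y), (∀ s, γ s = a) → w γ.simplex = 0 := by
    intro x y a γ h
    rw [simplex_of_const h, ← cochain_const w, hw]
  let pr : ℝ → I := projIcc 0 1 zero_le_one
  have hpr : Continuous pr := continuous_projIcc
  have hpr' : ∀ s : I, pr s = s := fun s => projIcc_val _ _
  have hpr0 : pr 0 = 0 := hpr' 0
  have hpr1 : pr 1 = 1 := hpr' 1
  have hhom : ∀ {x y : X} (γ γ' : Path x y), γ.Homotopic γ' → w γ.simplex = w γ'.simplex := by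
    rintro x y γ γ' ⟨H⟩
    -- The diagonal cuts the square of the homotopy into two triangles, each with one constant edge.
    let diag : Path x y :=
      ⟨⟨fun s => H (s, s), by fun_prop⟩, by simp, by simp⟩
    have h1 := coboundary_triangle w (fun a b => H (pr (a + b), pr b)) (by
      simp only [Function.uncurry_def]; fun_prop) (Path.refl x) γ' diag
      (fun s => by rw [hpr0]; simp) (fun s => by rw [sub_add_cancel, hpr1, hpr']; simp)
      (fun s => by rw [zero_add, hpr']; rfl)
    have h2 := coboundary_triangle w (fun a b => H (pr b, pr (a + b))) (by
      simp only [Function.uncurry_def]; fun_prop) γ (Path.refl y) diag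
      (fun s => by rw [hpr0, add_zero, hpr']; simp)
      (fun s => by rw [sub_add_cancel, hpr1, hpr']; simp)
      (fun s => by rw [zero_add, hpr']; rfl)
    rw [hw, hconst (Path.refl x) (fun _ => rfl)] at h1
    rw [hw, hconst (Path.refl y) (fun _ => rfl)] at h2
    linarith
  have htrans : ∀ {x y z : X} (γ : Path x y) (γ' : Path y z),
      w (γ.trans γ').simplex = w γ.simplex + w γ'.simplex := by
    intro x y z γ γ'
    -- A triangle factoring through the concatenation, with edges `γ`, `γ'` and `γ.trans γ'`.
    have h1 := coboundary_triangle w (fun a b => (γ.trans γ') (pr (a / 2 + b))) (by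
      simp only [Function.uncurry_def]; fun_prop) γ γ' (γ.trans γ')
      (fun s => by
        have hs : (s : ℝ) / 2 ∈ I := ⟨by linarith [s.2.1], by linarith [s.2.2]⟩
        have e : pr ((s : ℝ) / 2 + 0) = ⟨s / 2, hs⟩ := by rw [add_zero]; exact hpr' ⟨_, hs⟩
        rw [e, Path.trans_apply, dif_pos (by simp only; linarith [s.2.2])]
        congr 1
        ext
        simp only
        ring)
      (fun s => by
        have hs : (1 - (s : ℝ)) / 2 + s ∈ I := ⟨by linarith [s.2.1], by linarith [s.2.2]⟩
        have e : pr ((1 - (s : ℝ)) / 2 + s) = ⟨_, hs⟩ := hpr' ⟨_, hs⟩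
        rw [e, Path.trans_apply]
        split_ifs with h
        · simp only at h
          have h0 : s = 0 := Subtype.ext (le_antisymm (by simp only [Icc.coe_zero]; linarith) s.2.1)
          subst h0
          rw [γ'.source]
          symm
          convert γ.target
          simp
        · congr 1
          ext
          simp only
          ring)
      (fun s => by rw [zero_div, zero_add, hpr'])
    rw [hw] at h1
    linarith
  refine ⟨⟨fun {x y} p => Quotient.liftOn p (fun γ => Multiplicative.ofAdd (w γ.simplex))
    fun γ γ' h => congrArg _ (hhom γ γ' h), ?_⟩, fun γ => rfl⟩
  intro x y z p q
  induction p, q using Path.Homotopic.Quotient.ind₂ with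
  | mk γ γ' =>
    change Multiplicative.ofAdd (w (γ.trans γ').simplex) = _
    rw [htrans, ofAdd_add]
    rfl

/-! ### The cone over a singular simplex in the polygon -/

/-- The projection of a simplex, minus its first vertex, to the opposite face. -/
noncomputable def faceProj {n : ℕ} (v : stdSimplex ℝ (Fin (n + 2))) (h : v.1 0 ≠ 1) :
    stdSimplex ℝ (Fin (n + 1)) :=
  ⟨fun i => v.1 i.succ / (1 - v.1 0), by
    have hs := v.2.2
    rw [Fin.sum_univ_succ] at hs
    have h0 : ∑ i : Fin (n + 1), v.1 i.succ = 1 - v.1 0 := by linarith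
    have h1 : (0 : ℝ) ≤ 1 - v.1 0 := by
      rw [← h0]; exact Finset.sum_nonneg fun i _ => v.2.1 _
    refine ⟨fun i => div_nonneg (v.2.1 _) h1, ?_⟩
    rw [← Finset.sum_div, h0, div_self (sub_ne_zero.2 h.symm)]⟩

theorem stdSimplex_le_one {n : ℕ} (v : stdSimplex ℝ (Fin (n + 2))) : 0 ≤ 1 - v.1 0 := by
  have hs := v.2.2
  rw [Fin.sum_univ_succ] at hs
  have : 0 ≤ ∑ i : Fin (n + 1), v.1 i.succ := Finset.sum_nonneg fun i _ => v.2.1 _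
  linarith

open Classical in
/-- The point of the cone from the centre of the polygon. -/
noncomputable def coneFun {n : ℕ} (f : SingularSimplex PolygonDisk n) (v : stdSimplex ℝ (Fin (n + 2))) : ℂ :=
  if h : v.1 0 = 1 then 0 else ((1 - v.1 0 : ℝ) : ℂ) * (f (faceProj v h) : ℂ)

theorem norm_coneFun_le {n : ℕ} (f : SingularSimplex PolygonDisk n) (v : stdSimplex ℝ (Fin (n + 2))) :
    ‖coneFun f v‖ ≤ 1 - v.1 0 := by
  unfold coneFun
  split_ifs with h
  · rw [norm_zero]; exact stdSimplex_le_one v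
  · rw [norm_mul, Complex.norm_real, Real.norm_of_nonneg (stdSimplex_le_one v)]
    exact mul_le_of_le_one_right (stdSimplex_le_one v) (mem_closedBall_zero_iff.1 (f _).2)

/-- At the apex, where the projection to the face is undefined, continuity follows from the bound `1
- v 0` on the norm. -/
theorem continuous_coneFun {n : ℕ} (f : SingularSimplex PolygonDisk n) : Continuous (coneFun f) := by
  have hc : ∀ i, Continuous fun v : stdSimplex ℝ (Fin (n + 2)) => v.1 i := fun i =>
    (continuous_apply i).comp continuous_subtype_val
  rw [continuous_iff_continuousAt]
  intro v
  by_cases hv : v.1 0 = 1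
  · have h0 : coneFun f v = 0 := by rw [coneFun, dif_pos hv]
    rw [ContinuousAt, h0]
    refine squeeze_zero_norm (norm_coneFun_le f) ?_
    have : Tendsto (fun v : stdSimplex ℝ (Fin (n + 2)) => 1 - v.1 0) (𝓝 v) (𝓝 (1 - v.1 0)) :=
      (continuous_const.sub (hc 0)).continuousAt
    rwa [hv, sub_self] at this
  · have ho : IsOpen {v : stdSimplex ℝ (Fin (n + 2)) | v.1 0 ≠ 1} :=
      isOpen_ne_fun (hc 0) continuous_const
    refine ContinuousOn.continuousAt (s := {v | v.1 0 ≠ 1}) ?_ (ho.mem_nhds hv)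
    rw [continuousOn_iff_continuous_domRestrict]
    have e : {v : stdSimplex ℝ (Fin (n + 2)) | v.1 0 ≠ 1}.domRestrict (coneFun f) = fun v =>
        ((1 - v.1.1 0 : ℝ) : ℂ) * (f (faceProj v.1 v.2) : ℂ) := by
      ext v
      rw [domRestrict_apply, coneFun, dif_neg v.2]
    rw [e]
    refine (Complex.continuous_ofReal.comp
      (continuous_const.sub ((hc 0).comp continuous_subtype_val))).mul
      (continuous_subtype_val.comp (f.continuous.comp (Continuous.subtype_mk ?_ _)))
    refine continuous_pi fun i => ((hc i.succ).comp continuous_subtype_val).div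
      (continuous_const.sub ((hc 0).comp continuous_subtype_val)) fun v => ?_
    exact sub_ne_zero.2 (Ne.symm v.2)

/-- The cone over a singular simplex from the centre of the polygon. -/
noncomputable def coneSimplex {n : ℕ} (f : SingularSimplex PolygonDisk n) : SingularSimplex PolygonDisk (n + 1) where
  toFun v := ⟨coneFun f v, mem_closedBall_zero_iff.2 ((norm_coneFun_le f v).trans
    (by linarith [v.2.1 0]))⟩
  continuous_toFun := (continuous_coneFun f).subtype_mk _

theorem face_zero_coneSimplex {n : ℕ} (f : SingularSimplex PolygonDisk n) : (coneSimplex f).face 0 = f := by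
  ext v
  rw [SingularSimplex.face_apply]
  change coneFun f _ = _
  have h0 := stdSimplex_map_succAbove_self 0 v
  have h : (stdSimplex.map (Fin.succAbove 0) v).1 0 ≠ 1 := by rw [h0]; exact zero_ne_one
  have e : faceProj _ h = v := by
    refine Subtype.ext (funext fun i => ?_)
    change (stdSimplex.map (Fin.succAbove 0) v).1 (Fin.succAbove 0 i) / _ = _
    rw [stdSimplex_map_succAbove, h0, sub_zero, div_one]
  rw [coneFun, dif_neg h, e, h0]
  simp

theorem face_succ_coneSimplex {n : ℕ} (f : SingularSimplex PolygonDisk (n + 1)) (i : Fin (n + 2)) :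
    (coneSimplex f).face i.succ = coneSimplex (f.face i) := by
  ext v
  rw [SingularSimplex.face_apply]
  change coneFun f _ = coneFun (f.face i) v
  have h0 : (stdSimplex.map (Fin.succAbove i.succ) v).1 0 = v.1 0 := by
    have := stdSimplex_map_succAbove i.succ v 0
    rwa [Fin.succ_succAbove_zero] at this
  by_cases hv : v.1 0 = 1
  · rw [coneFun, dif_pos (h0.trans hv), coneFun, dif_pos hv]
  · have h : (stdSimplex.map (Fin.succAbove i.succ) v).1 0 ≠ 1 := by rwa [h0]
    have e : faceProj _ h = stdSimplex.map i.succAbove (faceProj v hv) := by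
      refine Subtype.ext (funext fun j => ?_)
      change (stdSimplex.map (Fin.succAbove i.succ) v).1 j.succ / _ = _
      rw [h0]
      rcases Fin.eq_self_or_eq_succAbove i j with rfl | ⟨k, rfl⟩
      · rw [stdSimplex_map_succAbove_self, stdSimplex_map_succAbove_self, zero_div]
      · rw [stdSimplex_map_succAbove, ← Fin.succ_succAbove_succ, stdSimplex_map_succAbove]
        rfl
    rw [coneFun, dif_neg h, coneFun, dif_neg hv, e, h0]
    rfl

/-- The pullback of a `2`-cocycle to the polygon is a coboundary. -/
theorem exists_cochain_polygon {S : Type*} [TopologicalSpace S] (q : C(PolygonDisk, S))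
    (z : TwoCocycle S) : ∃ d : SingularCochain PolygonDisk 1,
      ∀ τ, coboundary PolygonDisk 1 d τ = z.1 (q.comp τ) := by
  -- The cone is a chain homotopy: the face `0` of the cone over `τ` is `τ`, the others are cones
  -- over the faces of `τ`. The cocycle condition on this cone is the claim.
  refine ⟨fun f => z.1 (q.comp (coneSimplex f)), fun τ => ?_⟩
  have hz : coboundary S 2 z.1 (q.comp (coneSimplex τ)) = 0 :=
    congrFun (AddMonoidHom.mem_ker.1 z.2) _
  change ∑ i : Fin 4, (-1) ^ (i : ℕ) * z.1 (SingularSimplex.face (q.comp (coneSimplex τ)) i) = 0 at hz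
  rw [Fin.sum_univ_succ] at hz
  simp only [SingularSimplex.face_comp, face_zero_coneSimplex, face_succ_coneSimplex] at hz
  change ∑ i : Fin 3, (-1) ^ (i : ℕ) * z.1 (q.comp (coneSimplex (τ.face i))) = _
  simp only [Fin.val_zero, pow_zero, one_mul, Fin.val_succ, pow_succ, mul_neg, mul_one,
    neg_mul, Finset.sum_neg_distrib] at hz
  linarith

/-! ### Contractible neighbourhoods -/

/-- A contractible neighbourhood of `b`, the contraction fixing `b`. -/
structure Contraction {X : Type*} [TopologicalSpace X] (b : X) where
  /-- The neighbourhood. -/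
  O : Set X
  isOpen : IsOpen O
  mem : b ∈ O
  /-- The contraction. -/
  h : X → I → X
  cont : ContinuousOn (Function.uncurry h) (O ×ˢ univ)
  zero : ∀ x ∈ O, h x 0 = b
  one : ∀ x ∈ O, h x 1 = x
  self : ∀ s, h b s = b

theorem ConeNbhd.exists_contraction {Y X : Type*} [TopologicalSpace Y] [TopologicalSpace X] {q : Y → X}
    (hq : Function.Surjective q) {b : X} (N : ConeNbhd q b) :
    ∃ c : Contraction b, c.O = N.O ∧ c.h = N.h := by
  refine ⟨⟨N.O, N.isOpen, N.mem, N.h, N.conth, ?_, ?_, ?_⟩, rfl, rfl⟩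
  · intro x hx
    obtain ⟨y, rfl⟩ := hq x
    rw [← N.q_H y hx, N.H_zero y hx]
  · intro x hx
    obtain ⟨y, rfl⟩ := hq x
    rw [← N.q_H y hx, N.H_one y hx]
  · intro s
    obtain ⟨y, rfl⟩ := hq b
    rw [← N.q_H y N.mem, N.H_self y rfl]

theorem Contraction.eventually_mem {X : Type*} [TopologicalSpace X] {b : X} (c : Contraction b)
    {x : X} (hx : x ∈ c.O) {V : Set X} (hV : ∀ s, V ∈ 𝓝 (c.h x s)) :
    ∀ᶠ y in 𝓝 x, ∀ s, c.h y s ∈ V := by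
  have h1 : ∀ᶠ y in 𝓝 x, ∀ s ∈ (univ : Set I), c.h y s ∈ V := by
    refine isCompact_univ.eventually_forall_of_forall_eventually fun s _ => ?_
    have hc : ContinuousAt (Function.uncurry c.h) (x, s) :=
      c.cont.continuousAt (prod_mem_nhds (c.isOpen.mem_nhds hx) univ_mem)
    exact hc.eventually_mem (hV s)
  exact h1.mono fun y hy s => hy s (mem_univ s)

/-! ### Charts of circle bundles -/

/-- A local product structure. -/
structure CircleChart {M S : Type*} [TopologicalSpace M] [TopologicalSpace S] (π : M → S) (b : S) where
  /-- The domain. -/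
  V : Set S
  isOpen : IsOpen V
  mem : b ∈ V
  /-- The parametrization. -/
  s : S → Circle → M
  /-- The fibre coordinate. -/
  u : M → Circle
  cont_s : ContinuousOn (Function.uncurry s) (V ×ˢ univ)
  cont_u : ContinuousOn u (π ⁻¹' V)
  proj : ∀ x ∈ V, ∀ ζ, π (s x ζ) = x
  u_s : ∀ x ∈ V, ∀ ζ, u (s x ζ) = ζ
  s_u : ∀ m, π m ∈ V → s (π m) (u m) = m

theorem IsCircleBundle.nonempty_chart {M S : Type*} [TopologicalSpace M] [TopologicalSpace S]
    {π : M → S} (hπ : IsCircleBundle π) (b : S) : Nonempty (CircleChart π b) := by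
  obtain ⟨e, he⟩ := hπ b
  refine ⟨⟨e.baseSet, e.open_baseSet, he, fun x ζ => e.toOpenPartialHomeomorph.symm (x, ζ),
    fun m => (e m).2, ?_, ?_, ?_, ?_, ?_⟩⟩
  · have := e.toOpenPartialHomeomorph.continuousOn_symm
    rwa [e.target_eq] at this
  · have := e.toOpenPartialHomeomorph.continuousOn
    rw [show e.toOpenPartialHomeomorph.source = π ⁻¹' e.baseSet from e.source_eq] at this
    exact continuous_snd.comp_continuousOn this
  · intro x hx ζ
    exact e.proj_symm_apply' hx
  · intro x hx ζ
    exact congrArg Prod.snd (e.apply_symm_apply' hx)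
  · intro m hm
    exact e.symm_apply_mk_proj (e.mem_source.2 hm)

namespace CircleChart

variable {M S A : Type*} [TopologicalSpace M] [TopologicalSpace S] [TopologicalSpace A] {π : M → S}
  {b : S} (c : CircleChart π b)

theorem continuous_s {f : A → S} {ζ : A → Circle} (hf : Continuous f) (hζ : Continuous ζ)
    (h : ∀ a, f a ∈ c.V) : Continuous fun a => c.s (f a) (ζ a) :=
  c.cont_s.comp_continuous (f := fun a => (f a, ζ a)) (hf.prodMk hζ) fun a => mk_mem_prod (h a) (mem_univ _)

theorem continuous_u {f : A → M} (hf : Continuous f) (h : ∀ a, π (f a) ∈ c.V) :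
    Continuous fun a => c.u (f a) := c.cont_u.comp_continuous hf h

end CircleChart

/-! ### Gauge transformations and descent of functors along a map -/

namespace PathFunctor

variable {X Y K K' : Type*} [TopologicalSpace X] [TopologicalSpace Y] [Group K] [Group K']

/-- The composition of a functor with a homomorphism. -/
def mapHom (F : PathFunctor X K) (f : K →* K') : PathFunctor X K' where
  val p := f (F.val p)
  map_trans p q := by rw [F.map_trans, map_mul]

/-- The change of a functor by a gauge transformation. -/
def gauge (F : PathFunctor X K) (δ : X → K) : PathFunctor X K where
  val {x y} p := δ x * F.val p * (δ y)⁻¹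
  map_trans p q := by rw [F.map_trans]; group

theorem path_gauge (F : PathFunctor X K) (δ : X → K) {x y : X} (γ : Path x y) :
    (F.gauge δ).path γ = δ x * F.path γ * (δ y)⁻¹ := rfl

/-- Descent of functors that are locally induced from functions on the target. -/
theorem exists_descent (q : C(Y, X)) (G : PathFunctor Y K) (τ : X → X → K) (O : X → Set X)
    (hO : ∀ b, O b ∈ 𝓝 b) (hself : ∀ b, τ b b = 1)
    (small : ∀ b {y y' : Y} (γ : Path y y'), (∀ t, q (γ t) ∈ O b) →
      τ b (q y) * G.path γ = τ b (q y'))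
    (loc : ∀ x, ∀ V ∈ 𝓝 x, ∀ᶠ x' in 𝓝 x, ∃ (y y' : Y) (γ : Path y y'),
      q y = x ∧ q y' = x' ∧ ∀ t, q (γ t) ∈ V) :
    ∃ F : PathFunctor X K, ∀ {y y' : Y} (p : Path.Homotopic.Quotient y y'),
      F.val (p.map q) = G.val p := by
  have hτ : IsTransportGerm τ := by
    intro b
    filter_upwards [eventually_mem_nhds_iff.2 (hO b)] with x hx
    filter_upwards [loc x (O b ∩ O x) (inter_mem hx (hO x))] with x' ⟨y, y', γ, hy, hy', hγ⟩
    have h1 := small b γ fun t => (hγ t).1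
    have h2 := small x γ fun t => (hγ t).2
    rw [hy, hy'] at h1 h2
    rw [hself, one_mul] at h2
    rw [← h2, h1]
  obtain ⟨F, hF⟩ := hτ.exists_pathFunctor
  refine ⟨F, fun {y y'} p => ?_⟩
  refine path_induction (fun y y' p => F.val (p.map q) = G.val p) ?_ ?_ p
  · intro x y z p p' h h'
    have := (F.comap q).map_trans p p'
    change F.val _ = F.val (p.map q) * F.val (p'.map q) at this
    rw [this, h, h', G.map_trans]
  · intro y
    obtain ⟨W, hW, hWF⟩ := hF (q y)
    refine ⟨q ⁻¹' (W ∩ O (q y)), q.continuous.continuousAt.preimage_mem_nhds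
      (inter_mem hW (hO _)), fun x x' γ hγ => ?_⟩
    have h1 := hWF (γ.map q.continuous) (by
      rintro _ ⟨t, rfl⟩
      exact (hγ ⟨t, rfl⟩).1)
    rw [← Path.Homotopic.Quotient.mk_map, h1, ← small (q y) γ fun t => (hγ ⟨t, rfl⟩).2,
      inv_mul_cancel_left]
    rfl

end PathFunctor

/-! ### The homotopy sequence of a circle bundle -/

instance : PathConnectedSpace Circle :=
  Circle.exp_surjective.pathConnectedSpace Circle.exp.continuous

namespace IsCircleBundle

variable {M S : Type*} [TopologicalSpace M] [TopologicalSpace S] {π : C(M, S)}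

theorem exists_fibre_path (hπ : IsCircleBundle π) {x y : M} (h : π x = π y) :
    ∃ γ : Path x y, ∀ t, π (γ t) = π x := by
  obtain ⟨c⟩ := hπ.nonempty_chart (π x)
  let p := PathConnectedSpace.somePath (c.u x) (c.u y)
  refine ⟨⟨⟨fun t => c.s (π x) (p t), c.continuous_s continuous_const p.continuous fun _ => c.mem⟩,
    ?_, ?_⟩, fun t => c.proj _ c.mem _⟩
  · change c.s (π x) (p 0) = x
    rw [p.source, c.s_u _ c.mem]
  · change c.s (π x) (p 1) = y
    rw [p.target]
    exact (congrArg (fun b' => c.s b' (c.u y)) h).trans (c.s_u y (h ▸ c.mem))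

theorem surjective (hπ : IsCircleBundle π) : Function.Surjective π := fun b => by
  obtain ⟨c⟩ := hπ.nonempty_chart b
  exact ⟨c.s b 1, c.proj _ c.mem _⟩

theorem exists_joined (hπ : IsCircleBundle π) {x y : S} (p : Path.Homotopic.Quotient x y) :
    ∀ m, π m = x → ∃ m', π m' = y ∧ Joined m m' := by
  refine path_induction (fun x y _ => ∀ m, π m = x → ∃ m', π m' = y ∧ Joined m m') ?_ ?_ p
  · intro x y z _ _ h h' m hm
    obtain ⟨m', hm', hj⟩ := h m hm
    obtain ⟨m'', hm'', hj'⟩ := h' m' hm'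
    exact ⟨m'', hm'', hj.trans hj'⟩
  · intro b
    obtain ⟨c⟩ := hπ.nonempty_chart b
    refine ⟨c.V, c.isOpen.mem_nhds c.mem, fun x y γ hγ m hm => ?_⟩
    have hV : ∀ t, γ t ∈ c.V := fun t => hγ ⟨t, rfl⟩
    have hy : y ∈ c.V := by simpa using hV 1
    have hx : π m ∈ c.V := by rw [hm]; simpa using hV 0
    refine ⟨c.s y (c.u m), c.proj y hy _, ⟨⟨⟨fun t => c.s (γ t) (c.u m),
      c.continuous_s γ.continuous continuous_const hV⟩, ?_, ?_⟩⟩⟩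
    · change c.s (γ 0) (c.u m) = m
      rw [γ.source, ← hm, c.s_u m hx]
    · change c.s (γ 1) (c.u m) = _
      rw [γ.target]

theorem pathConnectedSpace (hπ : IsCircleBundle π) [PathConnectedSpace S] : PathConnectedSpace M where
  nonempty := by
    obtain ⟨b⟩ := PathConnectedSpace.nonempty (X := S)
    exact ⟨(hπ.surjective b).choose⟩
  joined x y := by
    obtain ⟨m', hm', hj⟩ := hπ.exists_joined
      (.mk (PathConnectedSpace.somePath (π x) (π y))) x rfl
    obtain ⟨γ, -⟩ := hπ.exists_fibre_path hm'
    exact hj.trans ⟨γ⟩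

/-- Loops in the fibres can be moved along paths. -/
theorem exists_moved_loop (hπ : IsCircleBundle π) {K : Type*} [Group K] (F : PathFunctor M K) {x y : M}
    (p : Path.Homotopic.Quotient x y) : ∀ l : Path y y, (∀ t, π (l t) = π y) →
      ∃ l' : Path x x, (∀ t, π (l' t) = π x) ∧ F.path l' = F.val p * F.path l * (F.val p)⁻¹ := by
  refine path_induction (fun x y p => ∀ l : Path y y, (∀ t, π (l t) = π y) →
      ∃ l' : Path x x, (∀ t, π (l' t) = π x) ∧ F.path l' = F.val p * F.path l * (F.val p)⁻¹) ?_ ?_ p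
  · intro x y z p p' h h' l hl
    obtain ⟨l', hl', e'⟩ := h' l hl
    obtain ⟨l'', hl'', e''⟩ := h l' hl'
    refine ⟨l'', hl'', ?_⟩
    rw [e'', e', F.map_trans]
    group
  · intro b
    obtain ⟨c⟩ := hπ.nonempty_chart (π b)
    refine ⟨π ⁻¹' c.V, π.continuous.continuousAt.preimage_mem_nhds (c.isOpen.mem_nhds c.mem),
      fun x y γ hγ l hl => ?_⟩
    have hV : ∀ t, π (γ t) ∈ c.V := fun t => hγ ⟨t, rfl⟩
    have hx : π x ∈ c.V := by simpa using hV 0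
    have hy : π y ∈ c.V := by simpa using hV 1
    have hu : Continuous fun t => c.u (l t) := c.continuous_u l.continuous fun t => by rw [hl]; exact hy
    have hu' : Continuous fun t => c.u (γ t) := c.continuous_u γ.continuous hV
    -- The copy of `l` over `γ t` is rotated so that it is based at `γ t`; both vertical edges of
    -- the square are then `γ`.
    let f : C(I × I, M) := ⟨fun z => c.s (π (γ z.2)) (c.u (l z.1) * (c.u y)⁻¹ * c.u (γ z.2)),
      c.continuous_s (by fun_prop) (((hu.comp continuous_fst).mul continuous_const).mul
        (hu'.comp continuous_snd)) fun z => hV z.2⟩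
    have hf : ∀ s t, f (s, t) = c.s (π (γ t)) (c.u (l s) * (c.u y)⁻¹ * c.u (γ t)) := fun _ _ => rfl
    have hγ' : ∀ s, l s = y → ∀ t, f (s, t) = γ t := by
      intro s hs t
      rw [hf, hs, mul_inv_cancel, one_mul, c.s_u _ (hV t)]
    let l' : Path x x := ⟨⟨fun s => f (s, 0), by fun_prop⟩,
      (hγ' 0 l.source 0).trans γ.source, (hγ' 1 l.target 0).trans γ.source⟩
    refine ⟨l', fun t => ?_, ?_⟩
    · change π (f (t, 0)) = _
      rw [hf, c.proj _ (hV 0), γ.source]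
    · have := F.square f l' γ γ l (fun _ => rfl) (fun t => (hγ' 1 l.target t).symm)
        (fun t => (hγ' 0 l.source t).symm) (fun s => by
          rw [hf, γ.target, inv_mul_cancel_right, ← hl s, c.s_u]
          rw [hl]; exact hy)
      rw [eq_mul_inv_iff_mul_eq]
      exact this

/-- A functor that is trivial on the paths in the fibres descends to the base. -/
theorem exists_descent (hπ : IsCircleBundle π) (hS : ∀ b : S, Nonempty (Contraction b))
    {K : Type*} [Group K] (G : PathFunctor M K)
    (hG : ∀ {x y : M} (γ : Path x y), (∀ t, π (γ t) = π x) → G.path γ = 1) :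
    ∃ F : PathFunctor S K, ∀ {y y' : M} (p : Path.Homotopic.Quotient y y'),
      F.val (p.map π) = G.val p := by
  classical
  let e : ∀ b, CircleChart π b := fun b => (hπ.nonempty_chart b).some
  let N : ∀ b, Contraction b := fun b => (hS b).some
  let O : S → Set S := fun b => {x | x ∈ (N b).O ∧ ∀ s, (N b).h x s ∈ (e b).V}
  have hO : ∀ b, O b ∈ 𝓝 b := fun b => inter_mem ((N b).isOpen.mem_nhds (N b).mem)
    ((N b).eventually_mem (N b).mem fun s => by
      rw [(N b).self]; exact (e b).isOpen.mem_nhds (e b).mem)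
  let L : ∀ b x, x ∈ O b → ∀ ζ, Path ((e b).s b ζ) ((e b).s x ζ) := fun b x hx ζ =>
    { toFun := fun s => (e b).s ((N b).h x s) ζ
      continuous_toFun := (e b).continuous_s ((N b).cont.comp_continuous (f := fun s => (x, s))
        (by fun_prop) fun s => mk_mem_prod hx.1 (mem_univ s)) continuous_const hx.2
      source' := by rw [(N b).zero x hx.1]
      target' := by rw [(N b).one x hx.1] }
  have hL : ∀ b x hx ζ s, L b x hx ζ s = (e b).s ((N b).h x s) ζ := fun _ _ _ _ _ => rfl
  have hbO : ∀ b, b ∈ O b := fun b => mem_of_mem_nhds (hO b)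
  -- the square over a path in the base
  have main : ∀ b {y y' : M} (γ : Path y y') (hγ : ∀ t, π (γ t) ∈ O b) (hy : π y ∈ O b)
      (hy' : π y' ∈ O b), G.path (L b (π y) hy ((e b).u y)) * G.path γ =
        G.path (L b (π y') hy' ((e b).u y')) := by
    intro b y y' γ hγ hy hy'
    have hV : ∀ x ∈ O b, x ∈ (e b).V := fun x hx => by
      have := hx.2 1
      rwa [(N b).one x hx.1] at this
    have hu : Continuous fun t => (e b).u (γ t) :=
      (e b).continuous_u γ.continuous fun t => hV _ (hγ t)
    have hh : Continuous fun z : I × I => (N b).h (π (γ z.1)) z.2 :=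
      (N b).cont.comp_continuous (f := fun z : I × I => (π (γ z.1), z.2)) (by fun_prop)
        fun z => mk_mem_prod (hγ z.1).1 (mem_univ _)
    let f : C(I × I, M) := ⟨fun z => (e b).s ((N b).h (π (γ z.1)) z.2) ((e b).u (γ z.1)),
      (e b).continuous_s hh (hu.comp continuous_fst) fun z => (hγ z.1).2 z.2⟩
    have hf : ∀ s t, f (s, t) = (e b).s ((N b).h (π (γ s)) t) ((e b).u (γ s)) := fun _ _ => rfl
    let bot : Path ((e b).s b ((e b).u y)) ((e b).s b ((e b).u y')) :=
      { toFun := fun t => (e b).s b ((e b).u (γ t))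
        continuous_toFun := (e b).continuous_s continuous_const hu fun _ => (e b).mem
        source' := by rw [γ.source]
        target' := by rw [γ.target] }
    have hbot : G.path bot = 1 := hG bot fun t => by
      change π ((e b).s b _) = _
      rw [(e b).proj _ (e b).mem, (e b).proj _ (e b).mem]
    let γ' : Path ((e b).s (π y) ((e b).u y)) ((e b).s (π y') ((e b).u y')) :=
      γ.cast ((e b).s_u y (hV _ hy)) ((e b).s_u y' (hV _ hy'))
    have h := G.square f bot (L b (π y') hy' ((e b).u y')) (L b (π y) hy ((e b).u y)) γ'
      (fun t => by rw [hf, (N b).zero _ (hγ t).1]; rfl)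
      (fun t => by rw [hf, γ.target]; rfl) (fun t => by rw [hf, γ.source]; rfl)
      (fun t => by
        rw [hf, (N b).one _ (hγ t).1, (e b).s_u _ (hV _ (hγ t))]
        rfl)
    rw [hbot, one_mul] at h
    rw [show G.path γ = G.path γ' from G.path_eq_of_coe fun _ => rfl, h]
  -- The fibre is path connected and the functor is trivial on paths in it, so the horizontal path
  -- may start at any point of the fibre.
  have indep : ∀ b x (hx : x ∈ O b) ζ ζ', G.path (L b x hx ζ) = G.path (L b x hx ζ') := by
    intro b x hx ζ ζ'
    have hxV : x ∈ (e b).V := by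
      have := hx.2 1
      rwa [(N b).one x hx.1] at this
    have hp : π ((e b).s x ζ) = x := (e b).proj x hxV ζ
    have hp' : π ((e b).s x ζ') = x := (e b).proj x hxV ζ'
    obtain ⟨γ, hγ⟩ := hπ.exists_fibre_path (hp.trans hp'.symm)
    have h := main b γ (fun t => by rw [hγ, hp]; exact hx) (by rw [hp]; exact hx)
      (by rw [hp']; exact hx)
    rw [hG γ hγ, mul_one] at h
    have e1 : ∀ ζ, ∀ (hy : π ((e b).s x ζ) ∈ O b), G.path (L b _ hy ((e b).u ((e b).s x ζ))) =
        G.path (L b x hx ζ) := by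
      intro ζ hy
      refine G.path_eq_of_coe fun t => ?_
      rw [hL b _ hy, hL b x hx, (e b).u_s x hxV, (e b).proj x hxV]
    exact (e1 ζ (by rw [hp]; exact hx)).symm.trans (h.trans (e1 ζ' (by rw [hp']; exact hx)))
  let τ : S → S → K := fun b x => if hx : x ∈ O b then G.path (L b x hx 1) else 1
  have hτ : ∀ b x (hx : x ∈ O b), τ b x = G.path (L b x hx 1) := fun b x hx => dif_pos hx
  refine PathFunctor.exists_descent π G τ O hO (fun b => ?_) (fun b y y' γ hγ => ?_) ?_
  · rw [hτ b b (hbO b)]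
    refine G.path_const fun s => ?_
    rw [hL b b (hbO b), (N b).self]
  · have hy : π y ∈ O b := by simpa using hγ 0
    have hy' : π y' ∈ O b := by simpa using hγ 1
    rw [hτ b _ hy, hτ b _ hy', indep b _ hy 1 ((e b).u y), indep b _ hy' 1 ((e b).u y')]
    exact main b γ hγ hy hy'
  · intro x V hV
    filter_upwards [hO x, (N x).eventually_mem (N x).mem fun s => by rw [(N x).self]; exact hV]
      with x' hx' hx'V
    have hxV : x' ∈ (e x).V := by
      have := hx'.2 1
      rwa [(N x).one x' hx'.1] at this
    refine ⟨_, _, L x x' hx' 1, (e x).proj x (e x).mem 1, (e x).proj x' hxV 1, fun t => ?_⟩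
    rw [hL x x' hx', (e x).proj _ (hx'.2 t)]
    exact hx'V t

/-- Exactness of the sequence of fundamental groups: a loop whose projection is null-homotopic is
homotopic to a loop in the fibre. -/
theorem exists_fibre_loop (hπ : IsCircleBundle π) [PathConnectedSpace S]
    (hS : ∀ b : S, Nonempty (Contraction b)) (m : M) (x : FundamentalGroup M m)
    (hx : FundamentalGroup.map π m x = 1) :
    ∃ γ : Path m m, (∀ t, π (γ t) = π m) ∧ x = Path.Homotopic.Quotient.mk γ := by
  have := hπ.pathConnectedSpace
  let F : PathFunctor M (FundamentalGroup M m) := PathFunctor.tautological m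
  have hF : ∀ p : FundamentalGroup M m, F.val p = p⁻¹ := PathFunctor.tautological_val m
  -- The values of `F` on loops in the fibre; this subgroup is normal because such loops can be
  -- moved along any loop of `M`.
  let C : Subgroup (FundamentalGroup M m) :=
    { carrier := {g | ∃ γ : Path m m, (∀ t, π (γ t) = π m) ∧ F.path γ = g}
      one_mem' := ⟨Path.refl m, fun _ => rfl, F.path_const fun _ => rfl⟩
      mul_mem' := by
        rintro _ _ ⟨γ, hγ, rfl⟩ ⟨γ', hγ', rfl⟩
        refine ⟨γ.trans γ', fun t => ?_, F.path_trans _ _⟩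
        rw [Path.trans_apply]
        split_ifs
        · exact hγ _
        · exact hγ' _
      inv_mem' := by
        rintro _ ⟨γ, hγ, rfl⟩
        exact ⟨γ.symm, fun t => hγ _, F.path_symm _⟩ }
  have hC : C.Normal := ⟨by
    rintro _ ⟨γ, hγ, rfl⟩ g
    obtain ⟨l, hl, e⟩ := hπ.exists_moved_loop F (show Path.Homotopic.Quotient m m from (g⁻¹ : FundamentalGroup M m)) γ hγ
    refine ⟨l, hl, ?_⟩
    have h := hF g⁻¹
    rw [inv_inv] at h
    rw [e, show F.val (show Path.Homotopic.Quotient m m from (g⁻¹ : FundamentalGroup M m)) = g from h]⟩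
  let D : PathFunctor M (FundamentalGroup M m ⧸ C) := F.mapHom (QuotientGroup.mk' C)
  choose sec hsec using hπ.surjective
  -- Modulo `C` the functor is trivial on loops in the fibres; the gauge by paths from a chosen
  -- point of each fibre makes it trivial on all paths in the fibres, so it descends to `S`. A loop
  -- with null-homotopic projection then has value in `C`.
  choose φ hφ using fun x : M => hπ.exists_fibre_path (hsec (π x))
  have hloop : ∀ {a : M} (l : Path a a), (∀ t, π (l t) = π a) → D.path l = 1 := by
    intro a l hl
    obtain ⟨l', hl', e⟩ := hπ.exists_moved_loop F (.mk (PathConnectedSpace.somePath m a)) l hl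
    have h1 : F.path l' ∈ C := ⟨l', hl', rfl⟩
    rw [e] at h1
    have h2 := (QuotientGroup.eq_one_iff _).2 h1
    rw [QuotientGroup.mk_mul, QuotientGroup.mk_mul, QuotientGroup.mk_inv, mul_inv_eq_one,
      mul_eq_left] at h2
    exact h2
  obtain ⟨Φ, hΦ⟩ := hπ.exists_descent hS (D.gauge fun x => D.path (φ x)) (by
    intro x y γ hγ
    have hxy : π x = π y := by simpa using (hγ 1).symm
    let φ' : Path (sec (π x)) y := (φ y).cast (by rw [hxy]) rfl
    have e : D.path φ' = D.path (φ y) := D.path_eq_of_coe fun _ => rfl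
    rw [PathFunctor.path_gauge, ← e, ← D.path_trans, ← D.path_symm, ← D.path_trans]
    refine hloop _ fun t => ?_
    rw [hsec, Path.trans_apply]
    split_ifs
    · rw [Path.trans_apply]
      split_ifs
      · rw [hφ, hsec]
      · exact hγ _
    · change π (φ y _) = _
      rw [hφ, hsec, hxy])
  have h1 := hΦ (show Path.Homotopic.Quotient m m from x)
  have h2 : Path.Homotopic.Quotient.map (show Path.Homotopic.Quotient m m from x) π = .refl (π m) := hx
  rw [h2, Φ.map_refl] at h1
  change 1 = _ * D.val (show Path.Homotopic.Quotient m m from x) * _ at h1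
  rw [eq_mul_inv_iff_mul_eq, one_mul, left_eq_mul] at h1
  have h3 : F.val (show Path.Homotopic.Quotient m m from x) ∈ C := (QuotientGroup.eq_one_iff _).1 h1
  rw [hF, C.inv_mem_iff] at h3
  obtain ⟨γ, hγ, e⟩ := h3
  refine ⟨γ.symm, fun t => hγ _, ?_⟩
  rw [← e]
  change (F.val (show FundamentalGroup M m from Path.Homotopic.Quotient.mk γ)) = _
  rw [hF]
  rfl

end IsCircleBundle

/-! ### Loops in the fibres -/

theorem coboundary_comp {X Y : Type*} [TopologicalSpace X] [TopologicalSpace Y] {n : ℕ}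
    (c : SingularCochain Y n) (f : C(X, Y)) (τ : SingularSimplex X (n + 1)) :
    coboundary X n (fun s => c (f.comp s)) τ = coboundary Y n c (f.comp τ) := rfl

namespace IsCircleBundle

variable {M S : Type*} [TopologicalSpace M] [TopologicalSpace S] {π : C(M, S)}

/-- A loop in a fibre on which a cochain restricting to a generator of the cohomology of the fibre
vanishes is null-homotopic. -/
theorem homotopic_refl_of_cochain_eq_zero (hπ : IsCircleBundle π) (c : SingularCochain M 1)
    {b : S} (hc : ∀ τ : SingularSimplex M 2, (∀ v, π (τ v) = b) → coboundary M 1 c τ = 0)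
    (hgen : ∀ φ : Circle ≃ₜ (π ⁻¹' {b}), c (fibreLoop π φ) = 1 ∨ c (fibreLoop π φ) = -1)
    {m : M} (γ : Path m m) (hγ : ∀ t, π (γ t) = b) (h0 : c γ.simplex = 0) :
    γ.Homotopic (Path.refl m) := by
  obtain ⟨e⟩ := hπ.nonempty_chart b
  have hV : ∀ t, π (γ t) ∈ e.V := fun t => by rw [hγ]; exact e.mem
  let φ : Circle ≃ₜ (π ⁻¹' {b}) :=
    { toFun := fun ζ => ⟨e.s b ζ, e.proj b e.mem ζ⟩
      invFun := fun x => e.u x.1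
      left_inv := fun ζ => e.u_s b e.mem ζ
      right_inv := fun x => Subtype.ext (by
        have h : π x.1 = b := x.2
        have := e.s_u x.1 (by rw [h]; exact e.mem)
        rwa [h] at this)
      continuous_toFun := (e.continuous_s continuous_const continuous_id fun _ => e.mem).subtype_mk _
      continuous_invFun := e.continuous_u continuous_subtype_val fun x => by
        rw [show π x.1 = b from x.2]; exact e.mem }
  -- The universal cover of the fibre. There `c` has a primitive `D`, whose increment over each
  -- period is the value of `c` on the fibre, `1` or `-1`.
  let f : C(ℝ, M) := ⟨fun r => e.s b (Circle.exp r),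
    e.continuous_s continuous_const Circle.exp.continuous fun _ => e.mem⟩
  have hf : ∀ r, f r = e.s b (Circle.exp r) := fun _ => rfl
  obtain ⟨F, hF⟩ := exists_pathFunctor_of_cocycle (fun s : SingularSimplex ℝ 1 => c (f.comp s))
    fun τ => by
      rw [coboundary_comp]
      exact hc _ fun v => e.proj b e.mem _
  obtain ⟨δ, -, -, hδ⟩ := F.exists_coboundary 0
  let D : ℝ → ℤ := fun r => (δ r).toAdd
  have hD : ∀ {x y : ℝ} (p : Path x y), c (f.comp p.simplex) = D y - D x := by
    intro x y p
    have h1 := (hF p).symm.trans (hδ _)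
    have h2 := congrArg Multiplicative.toAdd h1
    rw [toAdd_ofAdd, toAdd_mul, toAdd_inv] at h2
    simp only [D]
    omega
  have hper : ∀ x, D (x + 2 * Real.pi) - D x = D (2 * Real.pi) - D 0 := by
    intro x
    let p : Path (0 : ℝ) x := PathConnectedSpace.somePath 0 x
    let p' : Path (0 + 2 * Real.pi) (x + 2 * Real.pi) := p.map (continuous_add_const (2 * Real.pi))
    have h : f.comp p'.simplex = f.comp p.simplex := by
      ext v
      change e.s b (Circle.exp (_ + 2 * Real.pi)) = _
      rw [Circle.exp_add_two_pi]
      rfl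
    have h1 := hD p
    have h2 := hD p'
    rw [h, zero_add] at h2
    omega
  have hone : D (2 * Real.pi) - D 0 = 1 ∨ D (2 * Real.pi) - D 0 = -1 := by
    let p : Path (0 : ℝ) (2 * Real.pi) :=
      ⟨⟨fun s => 2 * Real.pi * s, by fun_prop⟩, by simp, by simp⟩
    have h : f.comp p.simplex = fibreLoop π φ := rfl
    rw [← hD p, h]
    exact hgen φ
  have hint : ∀ (k : ℤ) (x : ℝ), D (x + k * (2 * Real.pi)) - D x = k * (D (2 * Real.pi) - D 0) := by
    intro k x
    induction k using Int.induction_on with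
    | zero => simp
    | succ k ih =>
      have := hper (x + (k : ℤ) * (2 * Real.pi))
      rw [show x + ((k : ℤ) + 1 : ℤ) * (2 * Real.pi) = x + (k : ℤ) * (2 * Real.pi) + 2 * Real.pi by
        push_cast; ring]
      linarith
    | pred k ih =>
      have := hper (x + (-(k : ℤ) - 1 : ℤ) * (2 * Real.pi))
      rw [show x + (-(k : ℤ) - 1 : ℤ) * (2 * Real.pi) + 2 * Real.pi =
        x + (-(k : ℤ) : ℤ) * (2 * Real.pi) by push_cast; ring] at this
      linarith
  have hu : Continuous fun t => e.u (γ t) := e.continuous_u γ.continuous hV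
  obtain ⟨θ, hθ, -⟩ := Circle.isCoveringMap_exp.exists_path_lifts ⟨_, hu⟩ (Complex.arg (e.u (γ 0)))
    (Circle.exp_arg _).symm
  have hθ' : ∀ t, Circle.exp (θ t) = e.u (γ t) := fun t => congrFun hθ t
  have hfθ : ∀ t, f (θ t) = γ t := by
    intro t
    have := e.s_u (γ t) (hV t)
    rwa [hγ, ← hθ'] at this
  have he : Circle.exp (θ 1) = Circle.exp (θ 0) := by
    rw [hθ', hθ', γ.source, γ.target]
  -- The winding number `k` of `γ` equals `c γ.simplex` up to sign, so it vanishes and the lift `θ`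
  -- is a loop in `ℝ`.
  obtain ⟨k, hk⟩ := Circle.exp_eq_exp.1 he
  let p : Path (θ 0) (θ 1) := ⟨θ, rfl, rfl⟩
  have hp : f.comp p.simplex = γ.simplex := by
    ext v
    exact hfθ _
  have h1 := hD p
  rw [hp, h0, hk, hint] at h1
  have hk0 : k = 0 := by
    rcases hone with h | h <;> rw [h] at h1 <;> omega
  have h01 : θ 0 = θ 1 := by rw [hk, hk0]; simp
  have hm : m = f (θ 0) := by rw [hfθ, γ.source]
  have hh := ((SimplyConnectedSpace.paths_homotopic (p.cast rfl h01) (Path.refl (θ 0))).map f)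
  have e1 : γ = ((p.cast rfl h01).map f.continuous).cast hm hm := Path.ext (funext fun t => (hfθ t).symm)
  have e2 : Path.refl m = ((Path.refl (θ 0)).map f.continuous).cast hm hm :=
    Path.ext (funext fun t => hm)
  rw [e1, e2]
  exact hh.pathCast hm hm

end IsCircleBundle

/-! ### The pullback of a bundle to the polygon -/

/-- The fibre product. -/
abbrev FibreProduct {Y M S : Type*} (q : Y → S) (π : M → S) : Type _ :=
  {w : Y × M // q w.1 = π w.2}

/-- Cone neighbourhoods of a fibre product. -/
theorem IsCircleBundle.exists_coneNbhd {Y M S : Type*} [TopologicalSpace Y] [TopologicalSpace M]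
    [TopologicalSpace S] {π : C(M, S)} (hπ : IsCircleBundle π) {q : Y → S}
    (hq : Function.Surjective q) (m : M) (N : ConeNbhd q (π m)) :
    ∃ N' : ConeNbhd (fun w : FibreProduct q π => w.1.2) m,
      ∀ w : FibreProduct q π, w.1.2 ∈ N'.O → q w.1.1 ∈ N.O ∧
        ∀ s, (N'.H w s).1 = (N.H w.1.1 s, N'.h w.1.2 s) := by
  classical
  obtain ⟨C, hCO, hCh⟩ := N.exists_contraction hq
  obtain ⟨e⟩ := hπ.nonempty_chart (π m)
  let v : M → ℂ := fun x => (e.u x * (e.u m)⁻¹ : Circle)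
  let O : Set M := {x | π x ∈ C.O ∧ (∀ s, C.h (π x) s ∈ e.V) ∧ v x ∈ Complex.slitPlane}
  have hV : ∀ x ∈ O, π x ∈ e.V := fun x hx => by
    have := hx.2.1 1
    rwa [C.one _ hx.1] at this
  have hvc : ∀ x, π x ∈ e.V → ContinuousAt v x := fun x hx =>
    continuous_subtype_val.continuousAt.comp ((e.cont_u.continuousAt
      (π.continuous.continuousAt.preimage_mem_nhds (e.isOpen.mem_nhds hx))).mul continuousAt_const)
  have hvm : v m = 1 := by simp [v]
  have hO : IsOpen O := by
    rw [isOpen_iff_mem_nhds]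
    intro x hx
    have h1 := C.eventually_mem hx.1 fun s => e.isOpen.mem_nhds (hx.2.1 s)
    filter_upwards [π.continuous.continuousAt.preimage_mem_nhds (C.isOpen.mem_nhds hx.1),
      π.continuous.continuousAt.eventually h1,
      (hvc x (hV x hx)).preimage_mem_nhds (Complex.isOpen_slitPlane.mem_nhds hx.2.2)]
      with y h2 h3 h4 using ⟨h2, h3, h4⟩
  -- In the chart the base point follows the contraction of the base while the fibre coordinate
  -- rotates towards that of `m`; the slit plane makes the angle continuous.
  let h : M → I → M := fun x s =>
    e.s (C.h (π x) s) (e.u m * Circle.exp (s * Complex.arg (v x)))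
  have hh : ContinuousOn (Function.uncurry h) (O ×ˢ univ) := by
    refine e.cont_s.comp (f := fun z : M × I => (C.h (π z.1) z.2,
      e.u m * Circle.exp (z.2 * Complex.arg (v z.1)))) (ContinuousOn.prodMk ?_ ?_)
      fun z hz => mk_mem_prod (hz.1.2.1 _) (mem_univ _)
    · exact C.cont.comp (f := fun z : M × I => (π z.1, z.2)) (by fun_prop)
        fun z hz => mk_mem_prod hz.1.1 (mem_univ _)
    · have hv : ContinuousOn (fun z : M × I => Complex.arg (v z.1)) (O ×ˢ univ) := fun z hz =>
        ((Complex.continuousAt_arg hz.1.2.2).comp (f := fun z : M × I => v z.1)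
          ((hvc z.1 (hV _ hz.1)).comp continuousAt_fst)).continuousWithinAt
      exact continuousOn_const.mul (Circle.exp.continuous.comp_continuousOn
        ((continuous_subtype_val.comp continuous_snd).continuousOn.mul hv))
  have hH : ∀ (w : FibreProduct q π), w.1.2 ∈ O → ∀ s, q (N.H w.1.1 s) = π (h w.1.2 s) := by
    intro w hw s
    rw [e.proj _ (hw.2.1 s), N.q_H _ (by rw [← hCO, w.2]; exact hw.1), w.2, hCh]
  let H : FibreProduct q π → I → FibreProduct q π := fun w s =>
    if hw : w.1.2 ∈ O then ⟨(N.H w.1.1 s, h w.1.2 s), hH w hw s⟩ else w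
  have hHv : ∀ (w : FibreProduct q π), w.1.2 ∈ O → ∀ s, (H w s).1 = (N.H w.1.1 s, h w.1.2 s) :=
    fun w hw s => by simp only [H]; rw [dif_pos hw]
  have hmO : m ∈ O := ⟨C.mem, fun s => by rw [C.self]; exact e.mem, by
    rw [hvm]; exact Complex.one_mem_slitPlane⟩
  have hN : ∀ w : FibreProduct q π, w.1.2 ∈ O → q w.1.1 ∈ N.O := fun w hw => by
    rw [← hCO, w.2]; exact hw.1
  have h_one : ∀ x ∈ O, h x 1 = x := by
    intro x hx
    simp only [h, Icc.coe_one, one_mul]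
    rw [C.one _ hx.1, Circle.exp_arg, mul_comm, inv_mul_cancel_right, e.s_u x (hV x hx)]
  have h_zero : ∀ x ∈ O, h x 0 = m := by
    intro x hx
    simp only [h, Icc.coe_zero, zero_mul, Circle.exp_zero, mul_one]
    rw [C.zero _ hx.1, e.s_u m e.mem]
  have h_self : ∀ s, h m s = m := by
    intro s
    simp only [h]
    rw [C.self, hvm, Complex.arg_one, mul_zero, Circle.exp_zero, mul_one, e.s_u m e.mem]
  refine ⟨⟨O, hO, hmO, H, h, ?_, hh, ?_, ?_, ?_, ?_⟩, fun w hw => ⟨hN w hw, hHv w hw⟩⟩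
  · refine IsInducing.subtypeVal.continuousOn_iff.2 ?_
    refine ContinuousOn.congr (f := fun z : FibreProduct q π × I =>
      (N.H z.1.1.1 z.2, h z.1.1.2 z.2)) (ContinuousOn.prodMk ?_ ?_) fun z hz => hHv z.1 hz.1 z.2
    · exact N.contH.comp (f := fun z : FibreProduct q π × I => (z.1.1.1, z.2)) (by fun_prop)
        fun z hz => mk_mem_prod (hN z.1 hz.1) (mem_univ _)
    · exact hh.comp (f := fun z : FibreProduct q π × I => (z.1.1.2, z.2)) (by fun_prop)
        fun z hz => mk_mem_prod hz.1 (mem_univ _)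
  · intro w hw
    refine Subtype.ext ?_
    rw [hHv w hw, N.H_one _ (hN w hw), h_one _ hw]
  · intro w hw
    rw [hHv w hw]
    exact h_zero _ hw
  · intro w hw s
    refine Subtype.ext ?_
    rw [hHv w (by rw [hw]; exact hmO), N.H_self _ (by rw [w.2, hw]), hw, h_self]
    exact Prod.ext rfl hw.symm
  · intro w hw s
    rw [hHv w hw]

/-! ### The Heisenberg group -/

/-- The integral Heisenberg group. -/
structure Heisenberg where
  /-- The first coordinate. -/
  a : ℤ
  /-- The second coordinate. -/
  b : ℤ
  /-- The central coordinate. -/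
  c : ℤ

namespace Heisenberg

instance : Mul Heisenberg := ⟨fun x y => ⟨x.a + y.a, x.b + y.b, x.c + y.c + x.a * y.b⟩⟩

instance : One Heisenberg := ⟨⟨0, 0, 0⟩⟩

instance : Inv Heisenberg := ⟨fun x => ⟨-x.a, -x.b, -x.c + x.a * x.b⟩⟩

theorem mul_def (x y : Heisenberg) : x * y = ⟨x.a + y.a, x.b + y.b, x.c + y.c + x.a * y.b⟩ := rfl

theorem one_def : (1 : Heisenberg) = ⟨0, 0, 0⟩ := rfl

theorem inv_def (x : Heisenberg) : x⁻¹ = ⟨-x.a, -x.b, -x.c + x.a * x.b⟩ := rfl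

instance : Group Heisenberg := Group.ofLeftAxioms
  (fun x y z => by simp only [mul_def, Heisenberg.mk.injEq]; refine ⟨?_, ?_, ?_⟩ <;> ring)
  (fun x => by simp [mul_def, one_def])
  (fun x => by simp only [mul_def, one_def, inv_def, Heisenberg.mk.injEq]; refine ⟨?_, ?_, ?_⟩ <;> ring)

/-- The inclusion of the centre. -/
def center : Multiplicative ℤ →* Heisenberg where
  toFun n := ⟨0, 0, n.toAdd⟩
  map_one' := rfl
  map_mul' x y := by simp [mul_def]

theorem center_comm (n : Multiplicative ℤ) (x : Heisenberg) : center n * x = x * center n := by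
  change (⟨0, 0, n.toAdd⟩ : Heisenberg) * x = x * ⟨0, 0, n.toAdd⟩
  simp only [mul_def, Heisenberg.mk.injEq]
  refine ⟨?_, ?_, ?_⟩ <;> ring

theorem center_zpow (n : ℤ) : center (Multiplicative.ofAdd 1) ^ n = center (Multiplicative.ofAdd n) := by
  rw [← map_zpow, ← ofAdd_zsmul, smul_eq_mul, mul_one]

theorem commutator (n : ℤ) : (⟨1, 0, 0⟩ : Heisenberg) * ⟨0, n, 0⟩⁻¹ * ⟨1, 0, 0⟩⁻¹ * ⟨0, n, 0⟩ =
    center (Multiplicative.ofAdd (-n)) := by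
  change _ = (⟨0, 0, -n⟩ : Heisenberg)
  simp only [mul_def, inv_def, Heisenberg.mk.injEq]
  refine ⟨?_, ?_, ?_⟩ <;> ring

theorem prod_center (f : ℕ → ℤ) (n : ℕ) :
    ((List.range n).map fun k => center (Multiplicative.ofAdd (f k))).prod =
      center (Multiplicative.ofAdd (∑ k ∈ Finset.range n, f k)) := by
  induction n with
  | zero => simp
  | succ n ih =>
    rw [List.range_succ, List.map_append, List.prod_append, ih, Finset.sum_range_succ, ofAdd_add,
      map_mul]
    simp

/-- Elements with prescribed product of commutators. -/
theorem exists_prod_eq_one {g : ℕ} (hg : 1 ≤ g) (f : ℕ → ℤ) : ∃ α β : ℕ → Heisenberg,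
    ((List.range g).map fun k => α k * (β k)⁻¹ * (α k)⁻¹ * β k *
      center (Multiplicative.ofAdd 1) ^ f k).prod = 1 := by
  classical
  let n := ∑ k ∈ Finset.range g, f k
  -- A single commutator, in the first handle, cancels the total `n`.
  refine ⟨fun k => if k = 0 then ⟨1, 0, 0⟩ else 1, fun k => if k = 0 then ⟨0, n, 0⟩ else 1, ?_⟩
  have e : (fun k : ℕ => (if k = 0 then (⟨1, 0, 0⟩ : Heisenberg) else 1) *
      (if k = 0 then (⟨0, n, 0⟩ : Heisenberg) else 1)⁻¹ *
      (if k = 0 then (⟨1, 0, 0⟩ : Heisenberg) else 1)⁻¹ *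
      (if k = 0 then (⟨0, n, 0⟩ : Heisenberg) else 1) * center (Multiplicative.ofAdd 1) ^ f k) =
      fun k => center (Multiplicative.ofAdd ((if k = 0 then -n else 0) + f k)) := by
    funext k
    rw [center_zpow, ofAdd_add, map_mul]
    congr 1
    split_ifs
    · exact commutator n
    · simp
  rw [e, prod_center, Finset.sum_add_distrib, Finset.sum_ite_eq', if_pos (Finset.mem_range.2 hg)]
  change center (Multiplicative.ofAdd (-n + n)) = 1
  rw [neg_add_cancel, ofAdd_zero, map_one]

/-- The standard representation. -/
def rep : Heisenberg →* ((Fin 3 → ℤ) ≃ₗ[ℤ] (Fin 3 → ℤ)) :=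
  let φ : Heisenberg → (Fin 3 → ℤ) →ₗ[ℤ] (Fin 3 → ℤ) := fun x =>
    { toFun := fun v => ![v 0 + x.a * v 1 + x.c * v 2, v 1 + x.b * v 2, v 2]
      map_add' := fun v w => by
        ext i
        fin_cases i <;> simp <;> ring
      map_smul' := fun r v => by
        ext i
        fin_cases i <;> simp <;> ring }
  have hφ : ∀ x y v, φ x (φ y v) = φ (x * y) v := fun x y v => by
    ext i
    fin_cases i <;> simp [φ, mul_def] <;> ring
  have h1 : ∀ v, φ 1 v = v := fun v => by
    ext i
    fin_cases i <;> simp [φ, one_def]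
  { toFun := fun x => LinearEquiv.ofLinearMap (φ x) (φ x⁻¹)
      (LinearMap.ext fun v => by simp [hφ, h1]) (LinearMap.ext fun v => by simp [hφ, h1])
    map_one' := LinearEquiv.ext h1
    map_mul' := fun x y => LinearEquiv.ext fun v => (hφ x y v).symm }

theorem rep_apply (x : Heisenberg) (v : Fin 3 → ℤ) :
    rep x v = ![v 0 + x.a * v 1 + x.c * v 2, v 1 + x.b * v 2, v 2] := rfl

/-- The standard flag. -/
def flag : DescendingFlag (Fin 3 → ℤ) where
  L i :=
    { carrier := {v | ∀ j : Fin 3, 3 ≤ (j : ℕ) + i → v j = 0}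
      add_mem' := fun hv hw j hj => by rw [Pi.add_apply, hv j hj, hw j hj, add_zero]
      zero_mem' := fun _ _ => rfl
      smul_mem' := fun r v hv j hj => by rw [Pi.smul_apply, hv j hj, smul_zero] }
  anti i i' h v hv j hj := hv j (by omega)
  len := 3
  eq_bot := by
    refine (Submodule.eq_bot_iff _).2 fun v hv => funext fun j => hv j (by omega)

theorem mem_flag {i : ℕ} {v : Fin 3 → ℤ} : v ∈ flag.L i ↔ ∀ j : Fin 3, 3 ≤ (j : ℕ) + i → v j = 0 :=
  Iff.rfl

theorem rep_mem (x : Heisenberg) : rep x ∈ flag.unipotent := by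
  intro i v hv
  rw [mem_flag] at hv ⊢
  have h1 : 3 ≤ 1 + i → v 1 = 0 := hv 1
  have h2 : 3 ≤ 2 + i → v 2 = 0 := hv 2
  intro j hj
  rw [rep_apply, Pi.sub_apply]
  fin_cases j
  · have hi : 3 ≤ 0 + (i + 1) := hj
    simp [h1 (by omega), h2 (by omega)]
  · have hi : 3 ≤ 1 + (i + 1) := hj
    simp [h2 (by omega)]
  · simp

/-- An element with nontrivial central image survives in a torsion-free nilpotent quotient and in
finite `p`-quotients. -/
theorem residual {G : Type*} [Group G] (θ : G →* Heisenberg) {x : G} {n : ℤ}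
    (hx : θ x = center (Multiplicative.ofAdd n)) (hn : n ≠ 0) :
    (∃ (N : Subgroup G) (_ : N.Normal), x ∉ N ∧ Group.IsNilpotent (G ⧸ N) ∧
      ∀ y : G ⧸ N, IsOfFinOrder y → y = 1) ∧
    ∀ p : ℕ, p.Prime → ∃ (N : Subgroup G) (_ : N.Normal), x ∉ N ∧ Finite (G ⧸ N) ∧
      IsPGroup p (G ⧸ N) := by
  refine flag.residual (ρ := rep.comp θ) (fun g => rep_mem _) (flag.L 0).subtype
    (Submodule.subtype_injective _) (x := x) (v := ![0, 0, 1]) ?_ ?_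
  · intro j hj
    omega
  · change rep (θ x) _ ≠ _
    rw [hx, rep_apply]
    intro h
    have := congrFun h 0
    simp at this
    exact hn this

end Heisenberg

/-! ### Pullback of residual properties -/

/-- The quotient by a preimage embeds into the quotient. -/
theorem Subgroup.exists_injective_quotient_comap {G Γ : Type*} [Group G] [Group Γ] (f : G →* Γ)
    (N : Subgroup Γ) [N.Normal] :
    ∃ φ : G ⧸ N.comap f →* Γ ⧸ N, Function.Injective φ := by
  refine ⟨QuotientGroup.map _ N f le_rfl, ?_⟩
  rw [injective_iff_map_eq_one]
  intro x
  induction x using QuotientGroup.induction_on with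
  | H y =>
    intro h
    exact (QuotientGroup.eq_one_iff _).2 ((QuotientGroup.eq_one_iff (N := N) (f y)).1 h)

theorem IsResiduallyTorsionFreeNilpotent.exists_of_map_ne_one {G Γ : Type*} [Group G] [Group Γ]
    (h : IsResiduallyTorsionFreeNilpotent Γ) (f : G →* Γ) {x : G} (hx : f x ≠ 1) :
    ∃ (N : Subgroup G) (_ : N.Normal), x ∉ N ∧ Group.IsNilpotent (G ⧸ N) ∧
      ∀ y : G ⧸ N, IsOfFinOrder y → y = 1 := by
  obtain ⟨N, hN, hxN, hnil, htf⟩ := h _ hx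
  obtain ⟨φ, hφ⟩ := N.exists_injective_quotient_comap f
  refine ⟨N.comap f, inferInstance, hxN, Subgroup.isNilpotent_of_ker_le_center φ
    (((MonoidHom.ker_eq_bot_iff φ).2 hφ).trans_le bot_le), fun y hy => hφ ?_⟩
  rw [htf _ (φ.isOfFinOrder hy), map_one]

theorem IsResiduallyP.exists_of_map_ne_one {p : ℕ} {G Γ : Type*} [Group G] [Group Γ]
    (h : IsResiduallyP p Γ) (f : G →* Γ) {x : G} (hx : f x ≠ 1) :
    ∃ (N : Subgroup G) (_ : N.Normal), x ∉ N ∧ Finite (G ⧸ N) ∧ IsPGroup p (G ⧸ N) := by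
  obtain ⟨N, hN, hxN, hfin, hp⟩ := h _ hx
  obtain ⟨φ, hφ⟩ := N.exists_injective_quotient_comap f
  exact ⟨N.comap f, inferInstance, hxN, Finite.of_injective φ hφ, hp.of_injective φ hφ⟩

/-! ### Cochains on the boundary of the polygon -/

namespace IsPolygonQuotient

variable {S : Type*} [TopologicalSpace S] {g : ℕ} {q : C(PolygonDisk, S)}

/-- The defect of a cochain whose coboundary comes from the surface is additive on each side. -/
theorem glueDefect_add (hq : IsPolygonQuotient g q) {z : SingularCochain S 2}
    {d : SingularCochain PolygonDisk 1} (hd : ∀ τ, coboundary PolygonDisk 1 d τ = z (q.comp τ))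
    {j : ℤ} {a b c : ℝ} (ha : a ∈ Icc (j : ℝ) (j + 1)) (hb : b ∈ Icc (j : ℝ) (j + 1))
    (hc : c ∈ Icc (j : ℝ) (j + 1)) :
    glueDefect (fun a b => d (arcPath g a b).simplex) j a b +
      glueDefect (fun a b => d (arcPath g a b).simplex) j b c =
        glueDefect (fun a b => d (arcPath g a b).simplex) j a c := by
  have hcont : ∀ a b c : ℝ,
      Continuous (Function.uncurry fun x y : ℝ => arcPt g (a + x * (b - a) + y * (c - a))) :=
    fun a b c => (continuous_arcPt g).comp (by fun_prop)
  have key : ∀ a b c : ℝ, z (q.comp (triangle _ (hcont a b c))) =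
      d (arcPath g b c).simplex - d (arcPath g a c).simplex + d (arcPath g a b).simplex := by
    intro a b c
    rw [← hd]
    refine coboundary_triangle d _ _ _ _ _ (fun s => ?_) (fun s => ?_) fun s => ?_ <;>
    · rw [arcPath_apply]
      congr 1
      ring
  -- A triangle inside a side and its mirror image have the same image in the surface, so `z` agrees
  -- on them and the two coboundary formulas for `d` can be subtracted.
  have h : q.comp (triangle _ (hcont a b c)) =
      q.comp (triangle _ (hcont (mirror j a) (mirror j b) (mirror j c))) := by
    ext v
    have h0 := v.2.1 0
    have h1 := v.2.1 1
    have h2 := v.2.1 2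
    have hs := v.2.2
    rw [Fin.sum_univ_three] at hs
    have hm : a + v.1 1 * (b - a) + v.1 2 * (c - a) ∈ Icc (j : ℝ) (j + 1) := by
      rw [show a + v.1 1 * (b - a) + v.1 2 * (c - a) = v.1 0 * a + v.1 1 * b + v.1 2 * c by
        rw [show v.1 0 = 1 - v.1 1 - v.1 2 by linarith]; ring]
      have e0 : (j : ℝ) = j * (v.1 0 + v.1 1 + v.1 2) := by rw [hs, mul_one]
      have ha0 := mul_nonneg h0 (sub_nonneg.2 ha.1)
      have ha1 := mul_nonneg h0 (sub_nonneg.2 ha.2)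
      have hb0 := mul_nonneg h1 (sub_nonneg.2 hb.1)
      have hb1 := mul_nonneg h1 (sub_nonneg.2 hb.2)
      have hc0 := mul_nonneg h2 (sub_nonneg.2 hc.1)
      have hc1 := mul_nonneg h2 (sub_nonneg.2 hc.2)
      constructor <;> linarith
    change q (arcPt g _) = q (arcPt g _)
    rw [hq.eq_iff.2 (GlueRel.side' hm)]
    congr 2
    unfold mirror
    ring
  have h1 := key a b c
  have h2 := key (mirror j a) (mirror j b) (mirror j c)
  rw [← h] at h2
  unfold glueDefect
  linarith

/-- The functor to the Heisenberg group determined by a cochain on the total space whose coboundary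
comes from the surface. -/
theorem exists_pathFunctor_heisenberg {M : Type*} [TopologicalSpace M] (hq : IsPolygonQuotient g q)
    (hg : 1 ≤ g) {π : C(M, S)} (hπ : IsCircleBundle π) (z : TwoCocycle S)
    (hz : ∀ b : S, z.1 (ContinuousMap.const _ b) = 0) (c : SingularCochain M 1)
    (hc : ∀ τ : SingularSimplex M 2, coboundary M 1 c τ = z.1 (π.comp τ)) :
    ∃ Φ : PathFunctor M Heisenberg, ∀ {m : M} (γ : Path m m), (∀ t, π (γ t) = π m) →
      Φ.path γ = Heisenberg.center (Multiplicative.ofAdd (c γ.simplex)) := by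
  obtain ⟨d, hd⟩ := exists_cochain_polygon q z
  have hd0 : ∀ y, d (ContinuousMap.const _ y) = 0 := fun y => by
    rw [← cochain_const d, hd]
    exact hz (q y)
  let D : ℝ → ℝ → ℤ := fun a b => d (arcPath g a b).simplex
  obtain ⟨α, β, hprod⟩ := Heisenberg.exists_prod_eq_one hg fun k => quadDefect D k
  set t := Heisenberg.center (Multiplicative.ofAdd 1) with ht
  obtain ⟨U, hU, -⟩ := exists_potential_of_prod hg t (Heisenberg.center_comm _) D (by
    intro m a b
    refine congrArg d (ContinuousMap.ext fun v => ?_)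
    rw [Path.simplex_apply, Path.simplex_apply, arcPath_apply, arcPath_apply, arcPt_eq_iff hg]
    exact ⟨m, by ring⟩) (fun j a b c ha hb hc => hq.glueDefect_add hd ha hb hc) α β hprod
  -- the functor on the fibre product
  let q₁ : C(FibreProduct q π, PolygonDisk) := ⟨fun w => w.1.1, by fun_prop⟩
  let q₂ : C(FibreProduct q π, M) := ⟨fun w => w.1.2, by fun_prop⟩
  have hq₂ : Function.Surjective q₂ := fun m => by
    obtain ⟨y, hy⟩ := hq.surjective (π m)
    exact ⟨⟨(y, m), hy⟩, rfl⟩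
  -- The two maps from the fibre product to `S` agree, so `c` and `d` have the same coboundary there
  -- and their difference is a cocycle.
  obtain ⟨F, hF⟩ := exists_pathFunctor_of_cocycle
    (fun s : SingularSimplex (FibreProduct q π) 1 => c (q₂.comp s) - d (q₁.comp s)) (fun τ => by
      change coboundary _ 1 ((fun s => c (q₂.comp s)) - fun s => d (q₁.comp s)) τ = 0
      rw [map_sub, Pi.sub_apply, coboundary_comp, coboundary_comp, hc, hd, sub_eq_zero]
      exact congrArg z.1 (ContinuousMap.ext fun v => (τ v).2.symm))
  let k : PathFunctor (FibreProduct q π) Heisenberg := F.mapHom Heisenberg.center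
  have hk : ∀ {w w' : FibreProduct q π} (γ : Path w w'), k.path γ =
      Heisenberg.center (Multiplicative.ofAdd (c (q₂.comp γ.simplex))) *
        (t ^ d (q₁.comp γ.simplex))⁻¹ := by
    intro w w' γ
    change Heisenberg.center (F.path γ) = _
    rw [hF, ht, Heisenberg.center_zpow, ← map_inv, ← map_mul, ofAdd_sub, div_eq_mul_inv]
  choose N hN using hq.exists_coneNbhd hg
  choose N' hN' using fun m => hπ.exists_coneNbhd hq.surjective m (N (π m))
  obtain ⟨Φ, hΦ⟩ := exists_pathFunctor_of_coneNbhd q₂ hq₂ N' (by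
      intro γ hγ s
      refine Subtype.ext (Prod.ext ?_ (hγ s))
      refine hq.fibre_path hg (q₁.comp γ) (fun s => ?_) s
      have h1 := (γ s).2
      have h2 := (γ 0).2
      have h3 : (γ s).1.2 = (γ 0).1.2 := hγ s
      rw [h3, ← h2] at h1
      exact h1) k (fun w => U w.1.1) (by
    intro m w w' hw hw' h
    have h' : w.1.2 = w'.1.2 := h
    obtain ⟨hy, hH⟩ := hN' m w hw
    obtain ⟨hy', hH'⟩ := hN' m w' hw'
    have hqq : q w.1.1 = q w'.1.1 := by rw [w.2, w'.2, h']
    have e1 : ∀ s, ((N' m).H w s).1.1 = (N (π m)).H w.1.1 s := fun s => congrArg Prod.fst (hH s)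
    have e2 : ∀ s, ((N' m).H w' s).1.1 = (N (π m)).H w'.1.1 s := fun s => congrArg Prod.fst (hH' s)
    -- Two lifts of the same point of `M` have the same track in `M`, so the terms in `c` cancel and
    -- only the condition on the potential and `d` remains.
    have ec : q₂.comp ((N' m).track w hw).simplex = q₂.comp ((N' m).track w' hw').simplex := by
      ext v
      change ((N' m).H w _).1.2 = ((N' m).H w' _).1.2
      rw [hH, hH', h']
    rw [hk, hk, ec]
    have hζ : ∀ n (a b e : Heisenberg), a * (Heisenberg.center n * b) * e =
        Heisenberg.center n * (a * b * e) := fun n a b e => by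
      rw [← mul_assoc a, ← Heisenberg.center_comm]
      simp only [mul_assoc]
    rw [hζ, hζ]
    congr 1
    rcases hN (π m) _ _ hy hqq with h1 | ⟨h1, h2⟩ | ⟨j, u, v, hu, hv, hs⟩
    · have : w = w' := Subtype.ext (Prod.ext h1 h')
      subst this
      rfl
    · have c1 : q₁.comp ((N' m).track w hw).simplex = ContinuousMap.const _ w.1.1 := by
        ext s
        exact congrArg Subtype.val ((e1 _).trans (h1 _))
      have c2 : q₁.comp ((N' m).track w' hw').simplex = ContinuousMap.const _ w'.1.1 := by
        ext s
        exact congrArg Subtype.val ((e2 _).trans (h2 _))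
      rw [c1, c2, hd0, hd0, e1, e2, h1, h2]
      simp
    · have c1 : q₁.comp ((N' m).track w hw).simplex = (arcPath g v u).simplex := by
        ext s
        exact congrArg Subtype.val ((e1 _).trans (hs _).1)
      have c2 : q₁.comp ((N' m).track w' hw').simplex =
          (arcPath g (mirror j v) (mirror j u)).simplex := by
        refine ContinuousMap.ext fun s => ((e2 _).trans (hs _).2).trans ?_
        rw [mirror_line]
        rfl
      have h0 := hs 0
      have h1 := hs 1
      rw [(N (π m)).H_one _ hy, (N (π m)).H_one _ hy'] at h1
      simp only [Icc.coe_zero, Icc.coe_one, zero_mul, one_mul, add_zero, add_sub_cancel] at h0 h1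
      rw [c1, c2, e1, e2, h0.1, h0.2, h1.1, h1.2]
      exact hU j u v hu hv)
  refine ⟨Φ, fun {m} γ hγ => ?_⟩
  obtain ⟨y, hy⟩ := hq.surjective (π m)
  -- A loop in a fibre lifts with constant polygon coordinate, where `d` vanishes; being central,
  -- its value is unaffected by the gauge `U`.
  let w : FibreProduct q π := ⟨(y, m), hy⟩
  let γ' : Path w w :=
    { toFun := fun s => ⟨(y, γ s), hy.trans (hγ s).symm⟩
      continuous_toFun := (continuous_const.prodMk γ.continuous).subtype_mk _
      source' := Subtype.ext (Prod.ext rfl γ.source)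
      target' := Subtype.ext (Prod.ext rfl γ.target) }
  have h1 := hΦ (.mk γ')
  have h2 : k.val (.mk γ') = Heisenberg.center (Multiplicative.ofAdd (c γ.simplex)) := by
    refine (hk γ').trans ?_
    rw [show q₁.comp γ'.simplex = ContinuousMap.const _ y from rfl, hd0, zpow_zero, inv_one, mul_one]
    rfl
  rw [h2, ← Heisenberg.center_comm, mul_inv_cancel_right] at h1
  exact h1

end IsPolygonQuotient

/-! ### Combining the base and the fibre -/

theorem theoremt {S M : Type*} [TopologicalSpace S] [TopologicalSpace M]
    (g : ℕ) (hg : 1 ≤ g) (hS : IsClosedOrientableSurface g S)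
    (π : C(M, S)) (hπ : IsCircleBundle π) (hmon : HasTrivialMonodromy π)
    (e : H2 S) (he : IsEulerClass π e) (hne : e ≠ 0) (m : M) :
    IsResiduallyTorsionFreeNilpotent (FundamentalGroup M m) ∧
      ∀ p : ℕ, p.Prime → IsResiduallyP p (FundamentalGroup M m) := by
  obtain ⟨q, hq⟩ := hS.exists_isPolygonQuotient hg
  obtain ⟨z, c, -, hz, hc, hgen⟩ := he
  have := hq.pathConnectedSpace
  have hcontr : ∀ b : S, Nonempty (Contraction b) := fun b => by
    obtain ⟨N, -⟩ := hq.exists_coneNbhd hg b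
    exact ⟨(N.exists_contraction hq.surjective).choose⟩
  obtain ⟨y, hy⟩ := hq.surjective (π m)
  -- The representation of the surface group singles out the first handle, so the genus is written
  -- as a successor.
  obtain ⟨n, rfl⟩ := Nat.exists_eq_add_of_le' hg
  have hΓ : IsResiduallyTorsionFreeNilpotent (FundamentalGroup S (π m)) ∧
      ∀ p : ℕ, p.Prime → IsResiduallyP p (FundamentalGroup S (π m)) := by
    rw [← hy]
    obtain ⟨P, Q, hPQ, hrel, huniv⟩ := hq.exists_presentation hg y
    exact surface_residual P Q hPQ hrel huniv
  obtain ⟨Φ, hΦ⟩ := hq.exists_pathFunctor_heisenberg hg hπ z hz c hc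
  have key : ∀ x : FundamentalGroup M m, x ≠ 1 → FundamentalGroup.map π m x = 1 →
      ∃ n : ℤ, Φ.hom m x = Heisenberg.center (Multiplicative.ofAdd n) ∧ n ≠ 0 := by
    intro x hx h1
    obtain ⟨γ, hγ, rfl⟩ := hπ.exists_fibre_loop hcontr m x h1
    refine ⟨-c γ.simplex, ?_, fun h0 => hx ?_⟩
    · change (Φ.path γ)⁻¹ = _
      rw [hΦ γ hγ, ofAdd_neg, map_inv]
    · refine Path.Homotopic.Quotient.eq.2 (hπ.homotopic_refl_of_cochain_eq_zero c
        (fun τ hτ => ?_) (hgen (π m)) γ hγ (neg_eq_zero.1 h0))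
      -- On a simplex inside a fibre the coboundary of `c` is `z` of a constant simplex, hence zero:
      -- `c` is a cocycle on the fibre.
      rw [hc, show π.comp τ = ContinuousMap.const _ (π m) from ContinuousMap.ext hτ, hz]
  refine ⟨fun x hx => ?_, fun p hp x hx => ?_⟩ <;>
  by_cases h1 : FundamentalGroup.map π m x = 1
  · obtain ⟨n, hn, hn0⟩ := key x hx h1
    exact (Heisenberg.residual _ hn hn0).1
  · exact hΓ.1.exists_of_map_ne_one _ h1
  · obtain ⟨n, hn, hn0⟩ := key x hx h1
    exact (Heisenberg.residual _ hn hn0).2 p hp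
  · exact (hΓ.2 p hp).exists_of_map_ne_one _ h1
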